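/- **Corollary 4.11.** For a $k\times k$ matrix $A=(a_{ij})$ of zeros and ones let $X_A=\{(x_n)_{n\ge1}\in\{1,\dots,k\}^{\mathbb N}: a_{x_nx_{n+1}}=1 \text{ for all } n\}$ with the shift $\sigma$; $B_n(X_A)$ is the set of words of length $n$ that appear in points of $X_A$, and $X_A$ is irreducible if for all words $u,v$ that appear in points of $X_A$ there is such a $w$ with $uwv$ also appearing. Let $X=X_A\subseteq\{1,2,3\}^{\mathbb N}$ be an irreducible shift of finite type, and let $Y\subseteq\{1,2\}^{\mathbb N}$ be the full shift or the shift of finite type with transition matrix $\begin{pmatrix}0&1\\1&1\end{pmatrix}$. Let $\pi:X\to Y$ be a factor map (continuous, surjective, commuting with the shifts) that is the one-block code given by $1\mapsto1$, $2\mapsto2$, $3\mapsto2$. Let $f:X\to\mathbb R$ depend only on the first two coordinates, and write $f[ij]$ for its value on a nonempty cylinder $[ij]$. Write $S_nf=\sum_{i=0}^{n-1}f\circ\sigma^i$. For $y\in Y$ and $n\ge1$ let $$g_n(y)=\sup_{E_n(y)}\sum_{x\in E_n(y)}e^{(S_nf)(x)},$$ the supremum over all sets $E_n(y)$ consisting of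 exactly one point from each nonempty cylinder $[x_1\cdots x_n]$ of $X$ with $\pi(x_1\cdots x_n)=y_1\cdots y_n$, and let $\mathcal G=\{\log g_n\}_{n\ge1}$. $\mathcal G$ is *weakly almost additive* if there are $C_n>0$ with $C_n/n\to0$ and $$e^{-C_n}g_n(y)\,g_m(\sigma^ny)\le g_{n+m}(y)\le e^{C_n}g_n(y)\,g_m(\sigma^ny)\quad\text{for all } y\in Y,\ n,m\ge1,$$ and *almost additive* if $C_n=C$ can be taken independent of $n$. A Borel probability measure $\nu$ on $Y$ is a *weak Gibbs measure* for a Borel function $\hat g:Y\to\mathbb R$ if there are $P\in\mathbb R$ and $C_n>0$ with $\frac1n\log C_n\to0$ and $$\frac1{C_n}\le\frac{\nu[y_1\cdots y_n]}{e^{-nP}e^{(S_n\hat g)(y)}}\le C_n\quad\text{for all } y\in Y,\ n\ge1,$$ and a *Gibbs measure* for $\hat g$ if $C_n=C$ can be taken independent of $n$. "Invariant" means $\sigma$-invariant, and "unique" means that there is exactly one invariant Borel probability measure with the property. Consider the condition $$\lim_{n\to\infty}\frac1n\|\log g_n-S_n\hat g\|_\infty=0,\tag{$*$}$$ where $\|\cdot\|_\infty$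 is the supremum norm over $Y$. (i) $\mathcal G$ is almost additive if and only if there is a Borel measurable $\hat g:Y\to\mathbb R$ satisfying $(*)$ for which there is a unique invariant Gibbs measure. If $\mathcal G$ is weakly almost additive, then there is a Borel measurable $\hat g:Y\to\mathbb R$ satisfying $(*)$ for which there is a unique invariant weak Gibbs measure. (ii) Let $M(i,j)=e^{f[ij]}$ if $ij\in B_2(X)$ and $M(i,j)=0$ otherwise ($i,j\in\{1,2,3\}$), and let $N=(M(i,j))_{i,j\in\{2,3\}}$. Suppose that either $N$ is not of the form $\begin{pmatrix}0&a_1\\a_2&0\end{pmatrix}$ with $a_1,a_2>0$, or $N=\begin{pmatrix}0&a_1\\a_1&0\end{pmatrix}$ for some $a_1>0$ and moreover $M(2,1)=M(3,1)$ or $M(1,2)=M(1,3)$. Then both statements of (i) hold with "Borel measurable $\hat g:Y\to\mathbb R$" replaced by "continuous $\hat g:Y\to\mathbb R$". -/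

import Mathlib

open MeasureTheory Filter Topology

namespace RelPressure

/-- The one-sided shift of finite type `X_A` over the alphabet `Fin k` with transition matrix `A`. -/
def SFT {k : ℕ} (A : Matrix (Fin k) (Fin k) ℕ) : Set (ℕ → Fin k) :=
  {x | ∀ n, A (x n) (x (n + 1)) = 1}

/-- The shift map `σ` of `X_A`. -/
def shift {k : ℕ} (A : Matrix (Fin k) (Fin k) ℕ) (x : SFT A) : SFT A :=
  ⟨fun i => x.1 (i + 1), fun n => x.2 (n + 1)⟩

/-- `B_n(X)`: the words of length `n` that appear in points of `X`. -/
def blocks {α : Type*} (X : Set (ℕ → α)) (n : ℕ) : Set (Fin n → α) :=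
  {w | ∃ x ∈ X, ∃ m : ℕ, ∀ i : Fin n, x (m + i) = w i}

/-- Irreducibility: for all allowable words `u`, `v` there is an allowable `w` with `uwv` allowable. -/
def IsIrreducible {α : Type*} (X : Set (ℕ → α)) : Prop :=
  ∀ (l n : ℕ), ∀ u ∈ blocks X l, ∀ v ∈ blocks X n,
    ∃ m : ℕ, ∃ w ∈ blocks X m, Fin.append (Fin.append u w) v ∈ blocks X (l + m + n)

/-- A factor map between shifts of finite type: continuous, onto, commuting with the shifts. -/
structure IsFactorMap {k l : ℕ} {A : Matrix (Fin k) (Fin k) ℕ} {B : Matrix (Fin l) (Fin l) ℕ}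
    (π : SFT A → SFT B) : Prop where
  continuous : Continuous π
  surjective : Function.Surjective π
  semiconj : Function.Semiconj π (shift A) (shift B)

/-- `π` is the one-block code induced by the map `p` of the alphabets. -/
def IsOneBlockCode {k l : ℕ} {A : Matrix (Fin k) (Fin k) ℕ} {B : Matrix (Fin l) (Fin l) ℕ}
    (π : SFT A → SFT B) (p : Fin k → Fin l) : Prop :=
  ∀ (x : SFT A) (i : ℕ), (π x).1 i = p (x.1 i)

/-- The words of `B_n(X_A)` that the one-block code `p` sends to `y_1 ⋯ y_n`. -/
def fiberBlocks {k l : ℕ} (A : Matrix (Fin k) (Fin k) ℕ) (p : Fin k → Fin l)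
    (n : ℕ) (y : ℕ → Fin l) : Set (Fin n → Fin k) :=
  {w | w ∈ blocks (SFT A) n ∧ ∀ i : Fin n, p (w i) = y i}

/-- `E` consists of exactly one point from each cylinder `[x_1 ⋯ x_n]` of `X_A` with
`p (x_1 ⋯ x_n) = y_1 ⋯ y_n`. -/
def IsSelection {k l : ℕ} (A : Matrix (Fin k) (Fin k) ℕ) (p : Fin k → Fin l)
    (n : ℕ) (y : ℕ → Fin l) (E : Finset (SFT A)) : Prop :=
  (∀ x ∈ E, (fun i : Fin n => x.1 i) ∈ fiberBlocks A p n y) ∧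
    ∀ w ∈ fiberBlocks A p n y, ∃! x : SFT A, x ∈ E ∧ ∀ i : Fin n, x.1 i = w i

/-- `g_n(y) = sup_E ∑_{x ∈ E} exp (S_n f (x))`; the functions `log g_n` form the sequence associated
to the relative pressure function of `f`. -/
noncomputable def relSeq {k l : ℕ} {A : Matrix (Fin k) (Fin k) ℕ} {B : Matrix (Fin l) (Fin l) ℕ}
    (p : Fin k → Fin l) (f : SFT A → ℝ) (n : ℕ) (y : SFT B) : ℝ :=
  sSup {s | ∃ E : Finset (SFT A), IsSelection A p n y.1 E ∧
    s = ∑ x ∈ E, Real.exp (birkhoffSum (shift A) f n x)}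

/-- Almost additivity of `{log F_n}` (for `n ≥ 1`). -/
def AlmostAdditive {k : ℕ} {B : Matrix (Fin k) (Fin k) ℕ} (F : ℕ → SFT B → ℝ) : Prop :=
  ∃ C : ℝ, 0 < C ∧ ∀ n m : ℕ, 1 ≤ n → 1 ≤ m → ∀ y : SFT B,
    F (n + m) y ≤ Real.exp C * F n y * F m ((shift B)^[n] y) ∧
    Real.exp (-C) * F n y * F m ((shift B)^[n] y) ≤ F (n + m) y

/-- Weak almost additivity of `{log F_n}` (for `n ≥ 1`). -/
def WeaklyAlmostAdditive {k : ℕ} {B : Matrix (Fin k) (Fin k) ℕ} (F : ℕ → SFT B → ℝ) : Prop :=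
  ∃ C : ℕ → ℝ, (∀ n, 1 ≤ n → 0 < C n) ∧ Tendsto (fun n : ℕ => C n / n) atTop (𝓝 0) ∧
    ∀ n m : ℕ, 1 ≤ n → 1 ≤ m → ∀ y : SFT B,
      F (n + m) y ≤ Real.exp (C n) * F n y * F m ((shift B)^[n] y) ∧
      Real.exp (-C n) * F n y * F m ((shift B)^[n] y) ≤ F (n + m) y

/-- The cylinder `[y_1 ⋯ y_n]`. -/
def cylinder {k : ℕ} {B : Matrix (Fin k) (Fin k) ℕ} (y : SFT B) (n : ℕ) : Set (SFT B) :=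
  {z | ∀ i < n, z.1 i = y.1 i}

/-- The shift-invariant Borel probability measures. -/
def IsInvariant {k : ℕ} {B : Matrix (Fin k) (Fin k) ℕ} (μ : Measure (SFT B)) : Prop :=
  IsProbabilityMeasure μ ∧ MeasurePreserving (shift B) μ μ

/-- `1 / C_n ≤ μ[y_1 ⋯ y_n] / (exp (-nP) exp (S_n g (y))) ≤ C_n` for all `y` and all `n ≥ 1`. -/
def GibbsBounds {k : ℕ} {B : Matrix (Fin k) (Fin k) ℕ} (μ : Measure (SFT B)) (g : SFT B → ℝ)
    (P : ℝ) (C : ℕ → ℝ) : Prop :=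
  ∀ n : ℕ, 1 ≤ n → ∀ y : SFT B,
    1 / C n ≤ μ.real (cylinder y n) /
        (Real.exp (-(n * P)) * Real.exp (birkhoffSum (shift B) g n y)) ∧
      μ.real (cylinder y n) /
        (Real.exp (-(n * P)) * Real.exp (birkhoffSum (shift B) g n y)) ≤ C n

/-- `μ` is a Gibbs measure for the function `g`. -/
def IsGibbs {k : ℕ} {B : Matrix (Fin k) (Fin k) ℕ} (μ : Measure (SFT B)) (g : SFT B → ℝ) : Prop :=
  ∃ (P C : ℝ), 0 < C ∧ GibbsBounds μ g P (fun _ => C)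

/-- `μ` is a weak Gibbs measure for the function `g`. -/
def IsWeakGibbs {k : ℕ} {B : Matrix (Fin k) (Fin k) ℕ} (μ : Measure (SFT B)) (g : SFT B → ℝ) :
    Prop :=
  ∃ (P : ℝ) (C : ℕ → ℝ), (∀ n, 1 ≤ n → 0 < C n) ∧
    Tendsto (fun n : ℕ => Real.log (C n) / n) atTop (𝓝 0) ∧ GibbsBounds μ g P C

/-- `(1/n) ‖log F_n - S_n g‖_∞ → 0`; the sup norm is taken with values in `[0, ∞]`. -/
def Approximates {k : ℕ} {B : Matrix (Fin k) (Fin k) ℕ} (F : ℕ → SFT B → ℝ) (g : SFT B → ℝ) :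
    Prop :=
  Tendsto (fun n : ℕ => (⨆ y : SFT B, ‖Real.log (F n y) - birkhoffSum (shift B) g n y‖ₑ) / n)
    atTop (𝓝 0)

open Classical in
/-- The matrix `M`: `M(i,j) = exp (f[ij])` if `ij ∈ B_2(X_A)` and `0` otherwise, where `f[ij]`
(given by `φ i j`) is the value of `f` on the cylinder `[ij]`. -/
noncomputable def weightMatrix {k : ℕ} (A : Matrix (Fin k) (Fin k) ℕ) (φ : Fin k → Fin k → ℝ) :
    Matrix (Fin k) (Fin k) ℝ :=
  Matrix.of fun i j => if ![i, j] ∈ blocks (SFT A) 2 then Real.exp (φ i j) else 0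

/-- The symbol map `1 ↦ 1`, `2 ↦ 2`, `3 ↦ 2` (the symbols `1, 2, 3` being `0, 1, 2` here). -/
def code : Fin 3 → Fin 2 := ![0, 1, 1]

/-- The restriction of `M` to the symbols `2, 3` over the symbol `2`. -/
noncomputable def block22 (A : Matrix (Fin 3) (Fin 3) ℕ) (φ : Fin 3 → Fin 3 → ℝ) :
    Matrix (Fin 2) (Fin 2) ℝ :=
  (weightMatrix A φ).submatrix ![1, 2] ![1, 2]

end RelPressure

/-! Write `M` for the weight matrix. Perron–Frobenius, applied to the symbols that occur in `X`,
gives an eigenvalue `t` with left and right eigenvectors `l`, `r`, and the hidden Markov measure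
`ν[y_0 ⋯ y_{n-1}] = l P_{y_0} ⋯ P_{y_{n-1}} r`, where `P_a` is the part of `t⁻¹ M` leading to
symbols over `a`. Up to a constant factor, `g_n(y)` is `t^n ν[y_0 ⋯ y_{n-1}]`, so every statement
about `g` is one about `ν`. With symbols numbered from 0, a single symbol of `X` lies over `0`;
hence `P_0` has rank one and `ν` renews at `0`: `ν[u0w] ν[0] = ν[u0] ν[0w]`. The record
`IsReference` collects what is used about `ν`.

Uniqueness. An invariant `ν'` that is weak Gibbs for a function satisfying `(*)` has cylinder masses
bounded by a subexponential factor times those of `ν`. Under `ν` the centered visits to a cylinder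
`[0w]` are martingale differences by renewal, with exponential moments at most `(1 + s²)^n`;
Jensen's inequality under `ν'` then forces `ν'[0w] / ν'[0] = ν[0w] / ν[0]`. Cylinders starting with
`1` follow by prepending ones, because `ν[1^n]` decays exponentially. So `ν` is the only candidate
(`eq_of_isWeakGibbs`). If it is Gibbs, then `log g_n` is within a constant of an exact Birkhoff sum,
which gives almost additivity.

Existence. The potential is `log (t ν[y_0 ⋯ y_m] / ν[y_1 ⋯ y_m])` with `m ≥ 1` a time at which `y_m
= 0`. By renewal the choice of `m` is immaterial, so Birkhoff sums telescope and (weak) almost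
additivity compares them with `log g_n`. Only `1^∞` and `01^∞` have no such `m`; they receive values
`α` and `β`, where `α` is the growth rate of `log g_n(1^∞)`.

Continuity can fail only at these two points. There it is the convergence of ratios of the sequences
`ν[1^m 0]` and `ν[0 1^m 0]`, which satisfy a common second order recurrence coming from the block
`N`. Bounded ratios converge unless the eigenvalues are `±ρ`, that is, unless `N` is antidiagonal;
in the symmetric antidiagonal case of (ii) the recurrence drops to first order. -/

namespace RelPressure

/-! ### Real sequences: recurrences, approximate additivity, majorants. -/

/-- The ratio of two positive solutions of a second order linear recurrence converges as soon as it
is bounded, unless the recurrence has eigenvalues `±ρ`. -/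
lemma exists_tendsto_div_of_recurrence {s t : ℕ → ℝ} {τ δ C : ℝ} (hs : ∀ j, 0 < s j)
    (ht : ∀ j, 0 < t j) (hsr : ∀ j, s (j + 2) = τ * s (j + 1) - δ * s j)
    (htr : ∀ j, t (j + 2) = τ * t (j + 1) - δ * t j) (hC : ∀ j, t j ≤ C * s j)
    (hδ : δ < 0 → 0 < τ) : ∃ L, Tendsto (fun j => t j / s j) atTop (𝓝 L) := by
  -- The Casoratian of the two solutions: it is multiplied by `δ` at each step and is the numerator
  -- of the increments of `t / s`. For `δ ≥ 0` its sign is constant and the ratio is monotone.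
  set d : ℕ → ℝ := fun j => t (j + 1) * s j - t j * s (j + 1) with hd
  have hds : ∀ j, d (j + 1) = δ * d j := fun j => by
    simp only [hd, hsr, htr]; ring
  have hdiff : ∀ j, t (j + 1) / s (j + 1) - t j / s j = d j / (s j * s (j + 1)) := fun j => by
    have := (hs j).ne'
    have := (hs (j + 1)).ne'
    simp only [hd]; field_simp
  have hbdd : ∀ j, t j / s j ≤ C := fun j => (div_le_iff₀ (hs j)).2 (hC j)
  have hnn : ∀ j, 0 ≤ t j / s j := fun j => (div_pos (ht j) (hs j)).le
  rcases le_or_gt 0 δ with h | h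
  · have hdp : ∀ j, d j = δ ^ j * d 0 := fun j => by
      induction j with
      | zero => simp
      | succ j ih => rw [hds, ih]; ring
    rcases le_total 0 (d 0) with h0 | h0
    · have hm : Monotone (fun j => t j / s j) := monotone_nat_of_le_succ fun j => by
        have : 0 ≤ t (j + 1) / s (j + 1) - t j / s j := by
          rw [hdiff, hdp]
          have := hs j
          have := hs (j + 1)
          positivity
        linarith
      exact ⟨_, tendsto_atTop_ciSup hm ⟨C, by rintro _ ⟨j, rfl⟩; exact hbdd j⟩⟩
    · have hm : Antitone (fun j => t j / s j) := antitone_nat_of_succ_le fun j => by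
        have : t (j + 1) / s (j + 1) - t j / s j ≤ 0 := by
          rw [hdiff, hdp]
          have := hs j
          have := hs (j + 1)
          exact div_nonpos_of_nonpos_of_nonneg
            (mul_nonpos_of_nonneg_of_nonpos (by positivity) h0) (by positivity)
        linarith
      exact ⟨_, tendsto_atTop_ciInf hm ⟨0, by rintro _ ⟨j, rfl⟩; exact hnn j⟩⟩
  -- For `δ < 0` the increments alternate in sign, but `s (j + 3) ≥ (τ² - δ) s (j + 1)` makes them
  -- contract by `θ`. The bound `s (k + 1) ≥ τ s k` needs a term preceding `s k`, so the ratios are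
  -- taken from index 1 on.
  · have hτ := hδ h
    set θ : ℝ := -δ / (τ ^ 2 - δ) with hθ
    have hpos : 0 < τ ^ 2 - δ := by have := sq_nonneg τ; linarith
    have hθ1 : θ < 1 := by rw [hθ, div_lt_one hpos]; have := pow_pos hτ 2; linarith
    have hθ0 : 0 ≤ θ := div_nonneg (by linarith) hpos.le
    set q : ℕ → ℝ := fun j => t (j + 1) / s (j + 1) with hq
    have hstep : ∀ j, |q (j + 1 + 1) - q (j + 1)| ≤ θ * |q (j + 1) - q j| := fun j => by
      simp only [hq]
      rw [hdiff, hdiff, hds, abs_div, abs_div, abs_mul, abs_of_neg h,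
        abs_of_pos (mul_pos (hs _) (hs _)), abs_of_pos (mul_pos (hs _) (hs _))]
      have h1 := hs (j + 1)
      have h2 := hs (j + 1 + 1)
      have h3 := hs (j + 1 + 1 + 1)
      have h4 : τ * s (j + 1) ≤ s (j + 1 + 1) := by
        have := hsr j
        have := mul_pos (neg_pos.2 h) (hs j)
        simp only [show j + 1 + 1 = j + 2 from rfl]; linarith
      have h5 : (τ ^ 2 - δ) * s (j + 1) ≤ s (j + 1 + 1 + 1) := by
        have := hsr (j + 1)
        have h6 := mul_le_mul_of_nonneg_left h4 hτ.le
        simp only [show j + 1 + 1 + 1 = j + 1 + 2 from rfl] at *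
        rw [this]; simp only [show j + 1 + 1 = j + 2 from rfl] at *; nlinarith
      rw [hθ, div_mul_div_comm, div_le_div_iff₀ (mul_pos h2 h3) (by positivity)]
      have h7 : 0 ≤ -δ * |d (j + 1)| * s (j + 1 + 1) :=
        mul_nonneg (mul_nonneg (by linarith) (abs_nonneg _)) h2.le
      nlinarith [mul_le_mul_of_nonneg_left h5 h7]
    have hgeo : ∀ j, dist (q j) (q (j + 1)) ≤ |q 1 - q 0| * θ ^ j := fun j => by
      rw [dist_comm, Real.dist_eq]
      induction j with
      | zero => simp
      | succ j ih =>
        refine (hstep j).trans ?_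
        rw [pow_succ]
        nlinarith [mul_le_mul_of_nonneg_left ih hθ0]
    obtain ⟨L, hL⟩ := cauchySeq_tendsto_of_complete (cauchySeq_of_le_geometric θ _ hθ1 hgeo)
    exact ⟨L, (tendsto_add_atTop_iff_nat 1).1 hL⟩

/-- Evaluating `a (n * m)` once as `m` blocks of length `n` and once as `n` blocks of length `m`
gives `(a n - C n) / n ≤ (a m + C m) / m`. Any number separating the two families works as `α`; the
supremum of the left sides is taken. -/
lemma exists_forall_abs_sub_le {a C : ℕ → ℝ}
    (h : ∀ n m, 1 ≤ n → 1 ≤ m → |a (n + m) - a n - a m| ≤ C n) :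
    ∃ α : ℝ, ∀ n : ℕ, 1 ≤ n → |a n - n * α| ≤ C n := by
  have hC : ∀ n, 1 ≤ n → 0 ≤ C n := fun n hn => (abs_nonneg _).trans (h n n hn hn)
  have hmul : ∀ n, 1 ≤ n → ∀ q : ℕ, |a ((q + 1) * n) - (q + 1) * a n| ≤ (q + 1) * C n := by
    intro n hn q
    induction q with
    | zero => simpa using hC n hn
    | succ q ih =>
      have h1 := h n ((q + 1) * n) hn (Nat.mul_pos q.succ_pos hn)
      rw [show (q + 1 + 1) * n = n + (q + 1) * n by ring]
      rw [abs_le] at *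
      push_cast
      constructor <;> linarith [h1.1, h1.2, ih.1, ih.2]
  have hmul' : ∀ n m : ℕ, 1 ≤ n → 1 ≤ m → |a (m * n) - m * a n| ≤ m * C n := by
    intro n m hn hm
    obtain ⟨q, rfl⟩ := Nat.exists_eq_add_of_le' hm
    exact_mod_cast hmul n hn q
  have hlr : ∀ n m : ℕ, 1 ≤ n → 1 ≤ m → (a n - C n) / n ≤ (a m + C m) / m := by
    intro n m hn hm
    have hn' : (0 : ℝ) < n := by exact_mod_cast hn
    have hm' : (0 : ℝ) < m := by exact_mod_cast hm
    have h1 := abs_le.1 (hmul' n m hn hm)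
    have h2 := abs_le.1 (hmul' m n hm hn)
    rw [mul_comm n m] at h2
    rw [div_le_div_iff₀ hn' hm']
    linarith [h1.2, h2.1]
  refine ⟨sSup ((fun n : ℕ => (a n - C n) / n) '' Set.Ici 1), fun n hn => ?_⟩
  have hn' : (0 : ℝ) < n := by exact_mod_cast hn
  have h1 : (a n - C n) / n ≤ sSup ((fun n : ℕ => (a n - C n) / n) '' Set.Ici 1) :=
    le_csSup ⟨(a 1 + C 1) / (1 : ℕ), by rintro _ ⟨m, hm, rfl⟩; exact hlr m 1 hm le_rfl⟩
      ⟨n, hn, rfl⟩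
  have h2 : sSup ((fun n : ℕ => (a n - C n) / n) '' Set.Ici 1) ≤ (a n + C n) / n :=
    csSup_le ⟨_, 1, Set.self_mem_Ici, rfl⟩ (by rintro _ ⟨m, hm, rfl⟩; exact hlr m n hm hn)
  rw [div_le_iff₀ hn'] at h1
  rw [le_div_iff₀ hn'] at h2
  rw [abs_le]
  constructor <;> linarith

/-- The error in weak almost additivity need not be monotone, while splitting an orbit segment of
length `n` produces errors of shorter lengths. The running maximum controls them all and is still
`o(n)`. -/
lemma exists_majorant {C : ℕ → ℝ} (hC : ∀ n, 0 ≤ C n)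
    (h : Tendsto (fun n : ℕ => C n / n) atTop (𝓝 0)) :
    ∃ E : ℕ → ℝ, (∀ k n, k ≤ n → C k ≤ E n) ∧ Tendsto (fun n : ℕ => E n / n) atTop (𝓝 0) := by
  set E : ℕ → ℝ := fun n => (Finset.range (n + 1)).sup' ⟨0, by simp⟩ C with hE
  have hle : ∀ k n, k ≤ n → C k ≤ E n := fun k n hk =>
    Finset.le_sup' C (Finset.mem_range.2 (Nat.lt_succ_of_le hk))
  refine ⟨E, hle, ?_⟩
  have hE0 : ∀ n, 0 ≤ E n := fun n => (hC 0).trans (hle 0 n n.zero_le)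
  refine Metric.tendsto_atTop.2 fun ε hε => ?_
  obtain ⟨N, hN⟩ := Metric.tendsto_atTop.1 h (ε / 2) (half_pos hε)
  -- Beyond `K` the finitely many values up to `N` are absorbed by `ε / 2 * n`; for larger indices
  -- the limit itself gives this bound.
  obtain ⟨K, hK⟩ := exists_nat_gt (E N / (ε / 2))
  refine ⟨max (K + 1) (N + 1), fun n hn => ?_⟩
  have hn1 : K + 1 ≤ n := (le_max_left _ _).trans hn
  have hn0 : (0 : ℝ) < n := by exact_mod_cast (by omega : 0 < n)
  have hKn : E N ≤ ε / 2 * n := by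
    rw [div_lt_iff₀ (half_pos hε)] at hK
    have : (K : ℝ) ≤ n := by exact_mod_cast (by omega : K ≤ n)
    nlinarith
  have hEn : E n ≤ ε / 2 * n := by
    refine Finset.sup'_le _ _ fun k hk => ?_
    have hkn : k ≤ n := Nat.lt_succ_iff.1 (Finset.mem_range.1 hk)
    rcases le_total k N with hkN | hkN
    · exact (hle k N hkN).trans hKn
    · have h1 := hN k hkN
      rw [Real.dist_eq, sub_zero, abs_lt] at h1
      rcases Nat.eq_zero_or_pos k with h0 | h0
      · subst h0; exact (hle 0 N (Nat.zero_le _)).trans hKn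
      · have hk0 : (0 : ℝ) < k := by exact_mod_cast h0
        have h2 := (div_lt_iff₀ hk0).1 h1.2
        have : (k : ℝ) ≤ n := by exact_mod_cast hkn
        nlinarith
  rw [Real.dist_eq, sub_zero, abs_of_nonneg (div_nonneg (hE0 n) hn0.le), div_lt_iff₀ hn0]
  nlinarith

end RelPressure

/-! ### Perron–Frobenius by the Collatz–Wielandt maximum. -/

namespace RelPressure

open Matrix in
/-- Perron–Frobenius: a nonnegative irreducible matrix has a positive eigenvector. -/
lemma exists_pos_eigenvector {ι : Type*} [Fintype ι] [DecidableEq ι] [Nonempty ι]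
    (M : Matrix ι ι ℝ) (hM : ∀ i j, 0 ≤ M i j)
    (hirr : ∀ i j, Relation.ReflTransGen (fun i j => 0 < M i j) i j) :
    ∃ (t : ℝ) (x : ι → ℝ), (∀ i, 0 < x i) ∧ M *ᵥ x = t • x := by
  -- a power of `1 + M` is positive
  have hone : ∀ (n : ℕ) (i j : ι), 0 ≤ ((1 + M) ^ n : Matrix ι ι ℝ) i j := by
    intro n
    induction n with
    | zero => intro i j; rw [pow_zero, one_apply]; split_ifs <;> norm_num
    | succ n ih =>
      intro i j
      rw [pow_succ, mul_apply]
      refine Finset.sum_nonneg fun k _ => mul_nonneg (ih i k) ?_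
      rw [Matrix.add_apply, one_apply]
      split_ifs <;> have := hM k j <;> linarith
  have hsucc : ∀ (n : ℕ) (i k j : ι), ((1 + M) ^ n : Matrix ι ι ℝ) i k * (1 + M) k j ≤ ((1 + M) ^ (n + 1)) i j := by
    intro n i k j
    rw [pow_succ, mul_apply]
    refine Finset.single_le_sum (f := fun k => ((1 + M) ^ n) i k * (1 + M) k j)
      (fun k _ => mul_nonneg (hone n i k) ?_) (Finset.mem_univ k)
    simpa using hone 1 k j
  have hmono : ∀ i j, Monotone fun n : ℕ => ((1 + M) ^ n : Matrix ι ι ℝ) i j := fun i j =>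
    monotone_nat_of_le_succ fun n => by
      refine le_trans ?_ (hsucc n i j j)
      have : 1 ≤ (1 + M) j j := by simpa using hM j j
      nlinarith [hone n i j]
  have hex : ∀ i j, ∃ n : ℕ, 0 < ((1 + M) ^ n : Matrix ι ι ℝ) i j := by
    intro i j
    induction hirr i j with
    | refl => exact ⟨0, by simp⟩
    | @tail k j _ hkj ih =>
      obtain ⟨n, hn⟩ := ih
      refine ⟨n + 1, lt_of_lt_of_le (mul_pos hn ?_) (hsucc n i k j)⟩
      rw [Matrix.add_apply, one_apply]
      split_ifs <;> linarith
  choose e he using hex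
  -- The diagonal of `1 + M` is at least 1, so entries of its powers grow with the exponent; one
  -- exponent above all `e i j` makes every entry positive.
  set n₀ := ∑ i, ∑ j, e i j
  set Q := (1 + M) ^ n₀ with hQ
  have hQpos : ∀ i j, 0 < Q i j := fun i j => by
    refine (he i j).trans_le (hmono i j ?_)
    exact (Finset.single_le_sum (f := fun j => e i j) (fun _ _ => Nat.zero_le _)
      (Finset.mem_univ j)).trans (Finset.single_le_sum (f := fun i => ∑ j, e i j)
      (fun _ _ => Nat.zero_le _) (Finset.mem_univ i))
  have hQv : ∀ z : ι → ℝ, (∀ i, 0 ≤ z i) → z ≠ 0 → ∀ i, 0 < (Q *ᵥ z) i := by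
    intro z hz hz0 i
    obtain ⟨k, hk⟩ := Function.ne_iff.1 hz0
    refine Finset.sum_pos' (fun j _ => mul_nonneg (hQpos i j).le (hz j))
      ⟨k, Finset.mem_univ k, mul_pos (hQpos i k) ((hz k).lt_of_ne' hk)⟩
  -- maximize `t` over the pairs with `t x ≤ M x`
  set R : ℝ := ∑ i, ∑ j, M i j with hR
  have hR0 : 0 ≤ R := Finset.sum_nonneg fun i _ => Finset.sum_nonneg fun j _ => hM i j
  have hentry : ∀ i j, M i j ≤ R := fun i j =>
    (Finset.single_le_sum (f := fun j => M i j) (fun j _ => hM i j) (Finset.mem_univ j)).trans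
      (Finset.single_le_sum (f := fun i => ∑ j, M i j)
        (fun i _ => Finset.sum_nonneg fun j _ => hM i j) (Finset.mem_univ i))
  set c : ℝ := Fintype.card ι * R with hc
  have hbound : ∀ (x : ι → ℝ) (t : ℝ), x ∈ stdSimplex ℝ ι → (∀ i, t * x i ≤ (M *ᵥ x) i) →
      t ≤ c := by
    intro x t hx ht
    have h1 : t ≤ ∑ i, (M *ᵥ x) i := by
      calc t = ∑ i, t * x i := by rw [← Finset.mul_sum, hx.2, mul_one]
        _ ≤ _ := Finset.sum_le_sum fun i _ => ht i
    have h2 : ∀ i, (M *ᵥ x) i ≤ R := fun i => by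
      calc (M *ᵥ x) i = ∑ j, M i j * x j := rfl
        _ ≤ ∑ j, R * x j := Finset.sum_le_sum fun j _ =>
            mul_le_mul_of_nonneg_right (hentry i j) (hx.1 j)
        _ = R := by rw [← Finset.mul_sum, hx.2, mul_one]
    refine h1.trans ((Finset.sum_le_sum fun i _ => h2 i).trans ?_)
    simp [hc]
  set K : Set ((ι → ℝ) × ℝ) :=
    (stdSimplex ℝ ι ×ˢ Set.Icc 0 c) ∩ {p | ∀ i, p.2 * p.1 i ≤ (M *ᵥ p.1) i} with hK
  have hKc : IsCompact K := by
    refine ((isCompact_stdSimplex ℝ ι).prod isCompact_Icc).inter_right ?_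
    rw [Set.ofPred_forall]
    refine isClosed_iInter fun i => isClosed_le (by fun_prop) ?_
    exact (continuous_apply i).comp (Continuous.matrix_mulVec continuous_const continuous_fst)
  obtain ⟨i₀⟩ := ‹Nonempty ι›
  have hKne : K.Nonempty := by
    refine ⟨(Pi.single i₀ 1, 0), ⟨single_mem_stdSimplex ℝ i₀, le_rfl, by positivity⟩, fun i => ?_⟩
    simpa using hM i i₀
  obtain ⟨⟨x, t⟩, ⟨⟨hxs, ht0, htc⟩, hxt⟩, hmax⟩ := hKc.exists_isMaxOn hKne continuous_snd.continuousOn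
  simp only at ht0 htc hxt hxs
  have hx0 : x ≠ 0 := fun h => by have := hxs.2; simp [h] at this
  have hcomm : M * Q = Q * M := ((Commute.one_right M).add_right (Commute.refl M)).pow_right n₀
  have heq : M *ᵥ x = t • x := by
    -- If the maximizer were not an eigenvector, the positive matrix `Q`, which commutes with `M`,
    -- would turn the nonzero slack `M x - t x` into a strictly positive one, and `t` could be
    -- increased.
    by_contra hne
    set z := M *ᵥ x - t • x with hz
    have hzpos := hQv z (fun i => by simpa [hz] using hxt i) (sub_ne_zero.2 hne)
    have hw := hQv x hxs.1 hx0
    set w := Q *ᵥ x with hwdef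
    have hgap : ∀ i, t * w i < (M *ᵥ w) i := fun i => by
      have h1 := hzpos i
      rw [hz, mulVec_sub, mulVec_smul, mulVec_mulVec, ← hcomm, ← mulVec_mulVec] at h1
      rw [hwdef]
      simpa [mulVec_mulVec] using h1
    obtain ⟨ε, hε, hεw⟩ : ∃ ε > 0, ∀ i, (t + ε) * w i ≤ (M *ᵥ w) i := by
      have : ∀ i, ∀ᶠ ε in 𝓝[>] (0 : ℝ), (t + ε) * w i < (M *ᵥ w) i := fun i => by
        refine Filter.Eventually.filter_mono nhdsWithin_le_nhds ?_
        refine ContinuousAt.eventually_lt (f := fun ε : ℝ => (t + ε) * w i) (g := fun _ => (M *ᵥ w) i)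
          (by fun_prop) continuousAt_const (by simpa using hgap i)
      obtain ⟨ε, h1, h2⟩ := ((eventually_all.2 this).and self_mem_nhdsWithin).exists
      exact ⟨ε, h2, fun i => (h1 i).le⟩
    set σ := ∑ i, w i with hσ
    have hσ0 : 0 < σ := Finset.sum_pos (fun i _ => hw i) ⟨i₀, Finset.mem_univ _⟩
    have hmem : σ⁻¹ • w ∈ stdSimplex ℝ ι := by
      refine ⟨fun i => mul_nonneg (inv_nonneg.2 hσ0.le) (hw i).le, ?_⟩
      simp only [Pi.smul_apply, smul_eq_mul]
      rw [← Finset.mul_sum, ← hσ, inv_mul_cancel₀ hσ0.ne']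
    have hle : ∀ i, (t + ε) * (σ⁻¹ • w) i ≤ (M *ᵥ (σ⁻¹ • w)) i := fun i => by
      rw [mulVec_smul]
      simp only [Pi.smul_apply, smul_eq_mul]
      have := mul_le_mul_of_nonneg_left (hεw i) (inv_nonneg.2 hσ0.le)
      linarith
    have := hmax (a := (σ⁻¹ • w, t + ε))
      ⟨⟨hmem, by positivity, hbound _ _ hmem hle⟩, hle⟩
    simp only [Set.mem_ofPred_eq] at this
    linarith
  refine ⟨t, x, fun i => ?_, heq⟩
  -- Positivity of `x`: `Q x` is strictly positive and equals `(1 + t)^n₀ x`.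
  have h1 : ∀ n : ℕ, ((1 + M) ^ n : Matrix ι ι ℝ) *ᵥ x = (1 + t) ^ n • x := fun n => by
    induction n with
    | zero => simp
    | succ n ih =>
      rw [pow_succ, ← mulVec_mulVec, add_mulVec, heq, one_mulVec,
        show x + t • x = (1 + t) • x by rw [add_smul, one_smul], mulVec_smul, ih, smul_smul, pow_succ,
        mul_comm]
  have h2 := hQv x hxs.1 hx0 i
  rw [hQ, h1] at h2
  simp only [Pi.smul_apply, smul_eq_mul] at h2
  exact pos_of_mul_pos_right h2 (by positivity)

/-! ### Measures on binary sequences with prescribed cylinder masses. -/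

lemma fin_two_eq (a : Fin 2) : a = 0 ∨ a = 1 := by
  revert a; decide

/-- Extend a word by zeros. -/
def extendWord {n : ℕ} (w : Fin n → Fin 2) (i : ℕ) : Fin 2 := if h : i < n then w ⟨i, h⟩ else 0

/-- The first `n` letters of a sequence. -/
def prefixWord (n : ℕ) (y : ℕ → Fin 2) (i : Fin n) : Fin 2 := y i

lemma extendWord_prefixWord {n : ℕ} (y : ℕ → Fin 2) {i : ℕ} (hi : i < n) :
    extendWord (prefixWord n y) i = y i := by
  simp [extendWord, prefixWord, hi]

lemma measurable_prefixWord (n : ℕ) : Measurable (prefixWord n) :=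
  measurable_pi_lambda _ fun i => measurable_pi_apply (i : ℕ)

lemma measurable_of_forall_eq {β : Type*} [MeasurableSpace β] (n : ℕ) (G : (ℕ → Fin 2) → β)
    (hG : ∀ y z, (∀ i < n, y i = z i) → G y = G z) : Measurable G := by
  have : G = (fun w : Fin n → Fin 2 => G (extendWord w)) ∘ prefixWord n :=
    funext fun y => hG _ _ fun i hi => (extendWord_prefixWord y hi).symm
  rw [this]
  exact (measurable_of_countable _).comp (measurable_prefixWord n)

lemma measurableSet_piNat_cylinder (y : ℕ → Fin 2) (n : ℕ) :
    MeasurableSet (PiNat.cylinder y n) := by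
  have : PiNat.cylinder y n = prefixWord n ⁻¹' {prefixWord n y} := by
    ext z
    simp only [PiNat.cylinder, Set.mem_ofPred_eq, Set.mem_preimage, Set.mem_singleton_iff, funext_iff,
      prefixWord, Fin.forall_iff]
  rw [this]
  exact measurable_prefixWord n (measurableSet_singleton _)

/-- A consistent family of weights on binary words is the family of cylinder masses of a probability
measure. -/
lemma exists_measure_of_weights (ρ : ℕ → (ℕ → Fin 2) → ℝ)
    (hcongr : ∀ n y z, (∀ i < n, y i = z i) → ρ n y = ρ n z) (h0 : ∀ y, ρ 0 y = 1)
    (hnn : ∀ n y, 0 ≤ ρ n y)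
    (hadd : ∀ n y, ρ (n + 1) (Function.update y n 0) + ρ (n + 1) (Function.update y n 1) = ρ n y) :
    ∃ μ : Measure (ℕ → Fin 2), IsProbabilityMeasure μ ∧
      ∀ n y, μ.real (PiNat.cylinder y n) = ρ n y := by
  classical
  -- The left endpoint of the subinterval of `[0, 1)` assigned to the word `y_0 ⋯ y_{n-1}`: the mass
  -- of the words of length `n` that precede it lexicographically.
  let F : ℕ → (ℕ → Fin 2) → ℝ := fun n y =>
    ∑ i ∈ Finset.range n, if y i = 1 then ρ (i + 1) (Function.update y i 0) else 0
  have hF : ∀ n y z, (∀ i < n, y i = z i) → F n y = F n z := fun n y z h => by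
    refine Finset.sum_congr rfl fun i hi => ?_
    rw [Finset.mem_range] at hi
    rw [h i hi, hcongr (i + 1) (Function.update y i 0) (Function.update z i 0)]
    intro j hj
    rcases eq_or_ne j i with rfl | hne
    · simp
    · simp [hne, h j (by omega)]
  have hF0 : ∀ n y, y n = 0 → F (n + 1) y = F n y := fun n y hy =>
    (Finset.sum_range_succ _ _).trans (by rw [if_neg (by rw [hy]; exact zero_ne_one), add_zero])
  have hF1 : ∀ n y, y n = 1 → F (n + 1) y = F n y + ρ (n + 1) (Function.update y n 0) := fun n y hy =>
    (Finset.sum_range_succ _ _).trans (by rw [if_pos hy])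
  have hr : ∀ n y a, y n = a → ρ (n + 1) (Function.update y n a) = ρ (n + 1) y := by
    rintro n y a rfl; rw [Function.update_eq_self]
  -- The coding map reads the digits of `t` by successive subdivision; after `n` steps only the
  -- first `n` entries of `st t n` have been decided. Lebesgue measure pushed forward by `Φ` is the
  -- required measure.
  let st : ℝ → ℕ → (ℕ → Fin 2) := fun t n => Nat.rec (fun _ => 0)
    (fun n y => Function.update y n
      (if t < F n y + ρ (n + 1) (Function.update y n 0) then 0 else 1)) n
  let Φ : ℝ → ℕ → Fin 2 := fun t n => st t (n + 1) n
  have hst_succ : ∀ t n, st t (n + 1) = Function.update (st t n) n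
      (if t < F n (st t n) + ρ (n + 1) (Function.update (st t n) n 0) then 0 else 1) :=
    fun t n => rfl
  have hst : ∀ t n, ∀ i < n, st t n i = Φ t i := by
    intro t n
    induction n with
    | zero => intro i hi; omega
    | succ n ih =>
      intro i hi
      rcases eq_or_ne i n with rfl | hne
      · rfl
      · rw [hst_succ, Function.update_of_ne hne, ih i (by omega)]
  have hΦ : ∀ t n, Φ t n = if t < F n (Φ t) + ρ (n + 1) (Function.update (Φ t) n 0) then 0 else 1 := by
    intro t n
    have h1 : F n (st t n) = F n (Φ t) := hF _ _ _ (hst t n)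
    have h2 : ρ (n + 1) (Function.update (st t n) n 0) = ρ (n + 1) (Function.update (Φ t) n 0) := by
      refine hcongr _ _ _ fun j hj => ?_
      rcases eq_or_ne j n with rfl | hne
      · simp
      · simp [hne, hst t n j (by omega)]
    rw [← h1, ← h2]
    simp [Φ, hst_succ]
  have hkey : ∀ t ∈ Set.Ico (0 : ℝ) 1, ∀ n y,
      (∀ i < n, Φ t i = y i) ↔ t ∈ Set.Ico (F n y) (F n y + ρ n y) := by
    intro t ht n
    induction n with
    | zero => intro y; simpa [F, h0] using ht
    | succ n ih =>
      intro y
      have hsplit : (∀ i < n + 1, Φ t i = y i) ↔ (∀ i < n, Φ t i = y i) ∧ Φ t n = y n := by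
        constructor
        · exact fun h => ⟨fun i hi => h i (by omega), h n (by omega)⟩
        · rintro ⟨h1, h2⟩ i hi
          rcases eq_or_ne i n with rfl | hne
          · exact h2
          · exact h1 i (by omega)
      have hadd' := hadd n y
      have hn0 := hnn (n + 1) (Function.update y n 0)
      have hn1 := hnn (n + 1) (Function.update y n 1)
      rw [hsplit]
      by_cases hpre : ∀ i < n, Φ t i = y i
      · have hmem := (ih y).1 hpre
        have h2 : ρ (n + 1) (Function.update (Φ t) n 0) = ρ (n + 1) (Function.update y n 0) := by
          refine hcongr _ _ _ fun j hj => ?_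
          rcases eq_or_ne j n with rfl | hne
          · simp
          · simp [hne, hpre j (by omega)]
        rw [hΦ, hF n (Φ t) y hpre, h2]
        simp only [Set.mem_Ico] at hmem ⊢
        rcases fin_two_eq (y n) with hy | hy
        · rw [hF0 n y hy, ← hr n y 0 hy, hy]
          constructor
          · rintro ⟨-, h⟩
            refine ⟨hmem.1, ?_⟩
            by_contra hlt
            rw [if_neg hlt] at h
            exact one_ne_zero h
          · rintro ⟨-, h⟩
            exact ⟨hpre, if_pos h⟩
        · rw [hF1 n y hy, ← hr n y 1 hy, hy]
          constructor
          · rintro ⟨-, h⟩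
            refine ⟨?_, by linarith [hmem.2]⟩
            by_contra hlt
            rw [if_pos (not_le.1 hlt)] at h
            exact zero_ne_one h
          · rintro ⟨h, -⟩
            exact ⟨hpre, if_neg (not_lt.2 h)⟩
      · have hmem := mt (ih y).2 hpre
        constructor
        · exact fun h => absurd h.1 hpre
        · intro h
          refine absurd ?_ hmem
          simp only [Set.mem_Ico] at h ⊢
          rcases fin_two_eq (y n) with hy | hy
          · rw [hF0 n y hy, ← hr n y 0 hy] at h
            exact ⟨h.1, by linarith⟩
          · rw [hF1 n y hy, ← hr n y 1 hy] at h
            exact ⟨by linarith, by linarith⟩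
  have hstm : ∀ n, Measurable fun t => st t n := by
    intro n
    induction n with
    | zero => exact measurable_const
    | succ n ih =>
      refine measurable_pi_lambda _ fun i => ?_
      have hG : Measurable fun y => F n y + ρ (n + 1) (Function.update y n 0) :=
        measurable_of_forall_eq n _ fun y z h => by
          rw [hF n y z h, hcongr (n + 1) (Function.update y n 0) (Function.update z n 0)]
          intro j hj
          rcases eq_or_ne j n with rfl | hne
          · simp
          · simp [hne, h j (by omega)]
      rcases eq_or_ne i n with rfl | hne
      · simp only [hst_succ, Function.update_self]
        exact Measurable.ite (measurableSet_lt measurable_id (hG.comp ih)) measurable_const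
          measurable_const
      · simp only [hst_succ, Function.update_of_ne hne]
        exact (measurable_pi_apply i).comp ih
  have hΦm : Measurable Φ := measurable_pi_lambda _ fun n => (measurable_pi_apply n).comp (hstm (n + 1))
  have hFnn : ∀ n y, 0 ≤ F n y := fun n y => Finset.sum_nonneg fun i _ => by
    split_ifs
    exacts [hnn _ _, le_rfl]
  have hFle : ∀ n y, F n y + ρ n y ≤ 1 := by
    intro n
    induction n with
    | zero => intro y; simp [F, h0]
    | succ n ih =>
      intro y
      have := ih y
      have := hadd n y
      have := hnn (n + 1) (Function.update y n 1)
      rcases fin_two_eq (y n) with hy | hy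
      · rw [hF0 n y hy, ← hr n y 0 hy]
        linarith
      · rw [hF1 n y hy, ← hr n y 1 hy]
        linarith
  refine ⟨(volume.restrict (Set.Ico (0 : ℝ) 1)).map Φ, ?_, fun n y => ?_⟩
  · have : IsProbabilityMeasure (volume.restrict (Set.Ico (0 : ℝ) 1)) := ⟨by simp⟩
    exact Measure.isProbabilityMeasure_map hΦm.aemeasurable
  · have hpre : Φ ⁻¹' PiNat.cylinder y n ∩ Set.Ico 0 1 = Set.Ico (F n y) (F n y + ρ n y) := by
      ext t
      constructor
      · rintro ⟨h1, h2⟩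
        exact (hkey t h2 n y).1 h1
      · intro h
        have ht : t ∈ Set.Ico (0 : ℝ) 1 := ⟨(hFnn n y).trans h.1, h.2.trans_le (hFle n y)⟩
        exact ⟨(hkey t ht n y).2 h, ht⟩
    rw [map_measureReal_apply hΦm (measurableSet_piNat_cylinder y n), measureReal_def,
      Measure.restrict_apply (hΦm (measurableSet_piNat_cylinder y n)), hpre, Real.volume_Ico,
      add_sub_cancel_left, ENNReal.toReal_ofReal (hnn n y)]

end RelPressure

/-! ### The binary shift and uniqueness under subexponential domination. -/

namespace RelPressure

/-- The shift on all binary sequences. -/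
def fullShift (y : ℕ → Fin 2) (i : ℕ) : Fin 2 := y (i + 1)

lemma fullShift_iterate (n : ℕ) (y : ℕ → Fin 2) (i : ℕ) : fullShift^[n] y i = y (n + i) := by
  induction n generalizing y with
  | zero => simp
  | succ n ih => rw [Function.iterate_succ_apply, ih, fullShift]; congr 1; ring

lemma measurable_fullShift : Measurable fullShift :=
  measurable_pi_lambda _ fun i => measurable_pi_apply (i + 1)

lemma cylinder_eq_preimage_prefixWord (y : ℕ → Fin 2) (n : ℕ) :
    PiNat.cylinder y n = prefixWord n ⁻¹' {prefixWord n y} := by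
  ext z
  simp only [PiNat.cylinder, Set.mem_ofPred_eq, Set.mem_preimage, Set.mem_singleton_iff, funext_iff,
    prefixWord, Fin.forall_iff]

lemma prefixWord_extendWord {n : ℕ} (w : Fin n → Fin 2) : prefixWord n (extendWord w) = w :=
  funext fun i => by simp [prefixWord, extendWord]

/-- Two finite measures on binary sequences that agree on cylinders are equal. -/
lemma ext_of_cylinder {μ μ' : Measure (ℕ → Fin 2)} [IsFiniteMeasure μ] [IsFiniteMeasure μ']
    (h : ∀ n y, μ.real (PiNat.cylinder y n) = μ'.real (PiNat.cylinder y n)) : μ = μ' := by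
  set 𝒞 : Set (Set (ℕ → Fin 2)) := {s | ∃ y n, s = PiNat.cylinder y n} with h𝒞
  have hmeas : ∀ y n, μ (PiNat.cylinder y n) = μ' (PiNat.cylinder y n) := fun y n => by
    rw [← ENNReal.toReal_eq_toReal_iff' (measure_ne_top _ _) (measure_ne_top _ _)]
    exact h n y
  refine ext_of_generate_finite 𝒞 ?_ ?_ ?_ ?_
  · refine le_antisymm ?_ (MeasurableSpace.generateFrom_le ?_)
    · refine iSup_le fun i => ?_
      rintro _ ⟨s, -, rfl⟩
      have : (fun y : ℕ → Fin 2 => y i) ⁻¹' s =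
          ⋃ w ∈ {w : Fin (i + 1) → Fin 2 | w (Fin.last i) ∈ s},
            PiNat.cylinder (extendWord w) (i + 1) := by
        ext z
        simp only [Set.mem_preimage, Set.mem_iUnion, cylinder_eq_preimage_prefixWord,
          prefixWord_extendWord, Set.mem_singleton_iff, exists_prop, exists_eq_right',
          Set.mem_ofPred_eq]
        rfl
      rw [this]
      exact MeasurableSet.biUnion (Set.to_countable _) fun w _ =>
        MeasurableSpace.measurableSet_generateFrom ⟨_, _, rfl⟩
    · rintro _ ⟨y, n, rfl⟩
      exact measurableSet_piNat_cylinder y n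
  · rintro _ ⟨y, n, rfl⟩ _ ⟨z, m, rfl⟩ ⟨x, hx, hx'⟩
    rw [PiNat.mem_cylinder_iff_eq.1 hx |>.symm, PiNat.mem_cylinder_iff_eq.1 hx' |>.symm]
    refine ⟨x, max n m, ?_⟩
    ext z
    simp only [PiNat.cylinder, Set.mem_inter_iff, Set.mem_ofPred_eq, lt_max_iff]
    exact ⟨fun h i hi => hi.elim (h.1 i) (h.2 i), fun h => ⟨fun i hi => h i (Or.inl hi),
      fun i hi => h i (Or.inr hi)⟩⟩
  · rintro _ ⟨y, n, rfl⟩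
    exact hmeas y n
  · simpa using hmeas (fun _ => 0) 0

lemma integral_comp_prefixWord (μ : Measure (ℕ → Fin 2)) [IsFiniteMeasure μ] {n : ℕ}
    (F : (Fin n → Fin 2) → ℝ) :
    ∫ y, F (prefixWord n y) ∂μ = ∑ w, μ.real (PiNat.cylinder (extendWord w) n) * F w := by
  have h := integral_map (μ := μ) (measurable_prefixWord n).aemeasurable
    (f := F) (measurable_of_countable F).aestronglyMeasurable
  rw [← h, integral_fintype (Integrable.of_finite)]
  refine Finset.sum_congr rfl fun w _ => ?_
  rw [map_measureReal_apply (measurable_prefixWord n) (measurableSet_singleton _),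
    cylinder_eq_preimage_prefixWord, prefixWord_extendWord, smul_eq_mul]

lemma integrable_comp_prefixWord (μ : Measure (ℕ → Fin 2)) [IsFiniteMeasure μ] {n : ℕ}
    (F : (Fin n → Fin 2) → ℝ) : Integrable (fun y => F (prefixWord n y)) μ :=
  (Integrable.of_finite (μ := μ.map (prefixWord n)) (f := F)).comp_measurable
    (measurable_prefixWord n)

lemma eq_comp_prefixWord {n : ℕ} (Φ : (ℕ → Fin 2) → ℝ)
    (hΦ : ∀ y z, (∀ i < n, y i = z i) → Φ y = Φ z) :
    Φ = fun y => (fun w : Fin n → Fin 2 => Φ (extendWord w)) (prefixWord n y) :=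
  funext fun _ => hΦ _ _ fun _ hi => (extendWord_prefixWord _ hi).symm

lemma integrable_of_forall_eq (μ : Measure (ℕ → Fin 2)) [IsFiniteMeasure μ] {n : ℕ}
    (Φ : (ℕ → Fin 2) → ℝ) (hΦ : ∀ y z, (∀ i < n, y i = z i) → Φ y = Φ z) : Integrable Φ μ := by
  rw [eq_comp_prefixWord Φ hΦ]
  exact integrable_comp_prefixWord μ fun w : Fin n → Fin 2 => Φ (extendWord w)

/-- The sequence `y_0 ⋯ y_{n-1} v`. -/
def splice (n : ℕ) (y v : ℕ → Fin 2) (i : ℕ) : Fin 2 := if i < n then y i else v (i - n)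

lemma cylinder_inter_preimage (n q : ℕ) (y v : ℕ → Fin 2) :
    PiNat.cylinder y n ∩ fullShift^[n] ⁻¹' PiNat.cylinder v q =
      PiNat.cylinder (splice n y v) (n + q) := by
  ext z
  simp only [PiNat.cylinder, Set.mem_inter_iff, Set.mem_ofPred_eq, Set.mem_preimage,
    fullShift_iterate, splice]
  constructor
  · rintro ⟨h1, h2⟩ i hi
    split_ifs with h
    · exact h1 i h
    · have := h2 (i - n) (by omega)
      rwa [show n + (i - n) = i by omega] at this
  · intro h
    refine ⟨fun i hi => ?_, fun i hi => ?_⟩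
    · have := h i (by omega)
      rwa [if_pos hi] at this
    · have := h (n + i) (by omega)
      rwa [if_neg (by omega), Nat.add_sub_cancel_left] at this

/-- The exponential moment of a centered Bernoulli variable. With `exp x ≤ 1 + x + x²` for `|x| ≤ 1`
the linear terms cancel, and the quadratic ones sum to `p (1 - p) t²`. -/
lemma exp_mix_le {p t : ℝ} (hp : 0 ≤ p) (hp1 : p ≤ 1) (ht : |t| ≤ 1) :
    (1 - p) * Real.exp (-(t * p)) + p * Real.exp (t * (1 - p)) ≤ 1 + t ^ 2 := by
  have key : ∀ x : ℝ, |x| ≤ 1 → Real.exp x ≤ 1 + x + x ^ 2 := fun x hx => by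
    have := (abs_le.1 (Real.abs_exp_sub_one_sub_id_le hx)).2
    linarith
  have h1 := key (-(t * p)) (by
    rw [abs_neg, abs_mul, abs_of_nonneg hp]; nlinarith [abs_nonneg t])
  have h2 := key (t * (1 - p)) (by
    rw [abs_mul, abs_of_nonneg (by linarith : 0 ≤ 1 - p)]; nlinarith [abs_nonneg t])
  have h3 := mul_le_mul_of_nonneg_left h1 (by linarith : 0 ≤ 1 - p)
  have h4 := mul_le_mul_of_nonneg_left h2 hp
  nlinarith [mul_nonneg (sq_nonneg t) (sq_nonneg (p - 1 / 2)), sq_nonneg t]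

variable {μ μ' : Measure (ℕ → Fin 2)} [IsProbabilityMeasure μ] [IsProbabilityMeasure μ']

lemma setIntegral_preimage_iterate {n q : ℕ} {v : ℕ → Fin 2} (Φ : (ℕ → Fin 2) → ℝ)
    (hΦ : ∀ y z, (∀ i < n, y i = z i) → Φ y = Φ z) :
    ∫ y in fullShift^[n] ⁻¹' PiNat.cylinder v q, Φ y ∂μ =
      ∑ w : Fin n → Fin 2, μ.real (PiNat.cylinder (splice n (extendWord w) v) (n + q)) *
        Φ (extendWord w) := by
  rw [eq_comp_prefixWord Φ hΦ, integral_comp_prefixWord]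
  refine Finset.sum_congr rfl fun w _ => ?_
  rw [measureReal_restrict_apply (measurableSet_piNat_cylinder _ _), cylinder_inter_preimage]
  congr 1
  exact hΦ _ _ fun i hi => (extendWord_prefixWord _ hi).symm

/-- Under a measure that renews at the symbol `0`, the exponential moments of the centered visits to
a cylinder `[v]`, `v_0 = 0`, along an arithmetic progression are those of a martingale. -/
lemma integral_exp_sum_le {q : ℕ} (hq : 1 ≤ q) {v : ℕ → Fin 2} {p t : ℝ}
    (hp : 0 ≤ p) (hp1 : p ≤ 1) (ht : |t| ≤ 1)
    (hM : ∀ n y, μ.real (PiNat.cylinder (splice n y v) (n + q)) =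
      p * μ.real (PiNat.cylinder (splice n y v) (n + 1)))
    (h : (ℕ → Fin 2) → ℝ)
    (hh : h = fun y => (PiNat.cylinder v q).indicator 1 y - p * (PiNat.cylinder v 1).indicator 1 y)
    (n : ℕ) :
    ∫ y, Real.exp (t * ∑ i ∈ Finset.range n, h (fullShift^[i * q] y)) ∂μ ≤ (1 + t ^ 2) ^ n := by
  classical
  have hdep : ∀ n y z, (∀ i < n * q, y i = z i) →
      Real.exp (t * ∑ i ∈ Finset.range n, h (fullShift^[i * q] y)) =
      Real.exp (t * ∑ i ∈ Finset.range n, h (fullShift^[i * q] z)) := by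
    intro n y z hyz
    congr 2
    refine Finset.sum_congr rfl fun i hi => ?_
    have hi' : i + 1 ≤ n := Finset.mem_range.1 hi
    have hiq : i * q + q ≤ n * q := by
      calc i * q + q = (i + 1) * q := by ring
        _ ≤ n * q := Nat.mul_le_mul_right q hi'
    have hmem : ∀ k ≤ q, (fullShift^[i * q] y ∈ PiNat.cylinder v k ↔
        fullShift^[i * q] z ∈ PiNat.cylinder v k) := fun k hk => by
      simp only [PiNat.cylinder, Set.mem_ofPred_eq, fullShift_iterate]
      exact forall₂_congr fun j hj => by rw [hyz _ (by omega)]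
    simp only [hh, Set.indicator_apply, hmem q le_rfl, hmem 1 hq, Pi.one_apply]
  induction n with
  | zero => simp
  | succ n ih =>
    set Φ : (ℕ → Fin 2) → ℝ := fun y =>
      Real.exp (t * ∑ i ∈ Finset.range n, h (fullShift^[i * q] y)) with hΦ
    have hΦdep : ∀ y z, (∀ i < n * q, y i = z i) → Φ y = Φ z := hdep n
    set V := fullShift^[n * q] ⁻¹' PiNat.cylinder v q with hV
    set Z := fullShift^[n * q] ⁻¹' PiNat.cylinder v 1 with hZ
    have hVm : MeasurableSet V :=
      (measurable_fullShift.iterate _) (measurableSet_piNat_cylinder v q)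
    have hZm : MeasurableSet Z :=
      (measurable_fullShift.iterate _) (measurableSet_piNat_cylinder v 1)
    have hVZ : V ⊆ Z := Set.preimage_mono (PiNat.cylinder_anti v hq)
    have hint : Integrable Φ μ := integrable_of_forall_eq μ Φ hΦdep
    -- The martingale property: `Φ` depends on the first `n * q` letters only, so given the past and
    -- the symbol `v 0` at time `n * q`, the word `v` occurs with probability `p`.
    have hVI : ∫ y in V, Φ y ∂μ = p * ∫ y in Z, Φ y ∂μ := by
      rw [setIntegral_preimage_iterate Φ hΦdep, setIntegral_preimage_iterate Φ hΦdep, Finset.mul_sum]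
      refine Finset.sum_congr rfl fun w _ => ?_
      rw [hM]; ring
    set a := Real.exp (-(t * p)) with ha
    set b := Real.exp (t * (1 - p)) with hb
    -- The new factor is `1` off `Z`, `a` on `Z \ V` and `b` on `V`.
    have hpt : ∀ y, Real.exp (t * ∑ i ∈ Finset.range (n + 1), h (fullShift^[i * q] y)) =
        Φ y + (a - 1) * Z.indicator Φ y + (b - a) * V.indicator Φ y := by
      intro y
      rw [Finset.sum_range_succ, mul_add, Real.exp_add]
      change Φ y * _ = _
      have hmV : fullShift^[n * q] y ∈ PiNat.cylinder v q ↔ y ∈ V := Iff.rfl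
      have hmZ : fullShift^[n * q] y ∈ PiNat.cylinder v 1 ↔ y ∈ Z := Iff.rfl
      simp only [hh, Set.indicator_apply, hmV, hmZ, Pi.one_apply]
      by_cases h1 : y ∈ V
      · have h2 := hVZ h1
        simp only [h1, h2, if_true, mul_one]
        rw [← hb]; ring
      · by_cases h2 : y ∈ Z
        · simp only [h1, h2, if_true, if_false, mul_one, mul_zero, zero_sub, mul_neg]
          rw [← ha]; ring
        · simp [h1, h2]
    have hcalc : ∫ y, Real.exp (t * ∑ i ∈ Finset.range (n + 1), h (fullShift^[i * q] y)) ∂μ =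
        ∫ y, Φ y ∂μ + ((1 - p) * a + p * b - 1) * ∫ y in Z, Φ y ∂μ := by
      simp only [hpt]
      rw [integral_add (f := fun y => Φ y + (a - 1) * Z.indicator Φ y)
        (hint.add ((hint.indicator hZm).const_mul _)) ((hint.indicator hVm).const_mul _),
        integral_add hint ((hint.indicator hZm).const_mul _),
        integral_const_mul, integral_const_mul, integral_indicator hZm, integral_indicator hVm, hVI]
      ring
    have hΦ0 : ∀ y, 0 ≤ Φ y := fun y => (Real.exp_pos _).le
    have hmix := exp_mix_le hp hp1 ht
    have hZle : ∫ y in Z, Φ y ∂μ ≤ ∫ y, Φ y ∂μ := setIntegral_le_integral hint (ae_of_all _ hΦ0)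
    have hZ0 : 0 ≤ ∫ y in Z, Φ y ∂μ := integral_nonneg hΦ0
    rw [hcalc]
    have h1 : ((1 - p) * a + p * b - 1) * ∫ y in Z, Φ y ∂μ ≤ t ^ 2 * ∫ y, Φ y ∂μ := by
      calc _ ≤ t ^ 2 * ∫ y in Z, Φ y ∂μ := mul_le_mul_of_nonneg_right (by linarith) hZ0
        _ ≤ _ := mul_le_mul_of_nonneg_left hZle (sq_nonneg t)
    calc _ ≤ (1 + t ^ 2) * ∫ y, Φ y ∂μ := by linarith
      _ ≤ (1 + t ^ 2) * (1 + t ^ 2) ^ n := mul_le_mul_of_nonneg_left ih (by positivity)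
      _ = _ := by ring

/-- A measure that is subexponentially dominated by a measure renewing at `0` has the same
conditional masses of cylinders `[v]` with `v_0 = 0`. -/
lemma real_cylinder_eq_mul {D : ℕ → ℝ} {N q : ℕ} (hq : 1 ≤ q) {v : ℕ → Fin 2} {p : ℝ}
    (hp : 0 ≤ p) (hp1 : p ≤ 1)
    (hM : ∀ n y, μ.real (PiNat.cylinder (splice n y v) (n + q)) =
      p * μ.real (PiNat.cylinder (splice n y v) (n + 1)))
    (hinv : MeasurePreserving fullShift μ' μ')
    (hD0 : ∀ n, 0 < D n) (hD : Tendsto (fun n : ℕ => Real.log (D n) / n) atTop (𝓝 0))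
    (hle : ∀ n, N ≤ n → ∀ y, μ'.real (PiNat.cylinder y n) ≤ D n * μ.real (PiNat.cylinder y n)) :
    μ'.real (PiNat.cylinder v q) = p * μ'.real (PiNat.cylinder v 1) := by
  classical
  set h : (ℕ → Fin 2) → ℝ := fun y =>
    (PiNat.cylinder v q).indicator 1 y - p * (PiNat.cylinder v 1).indicator 1 y with hh
  have hVm := measurableSet_piNat_cylinder v q
  have hZm := measurableSet_piNat_cylinder v 1
  have hone : Integrable (1 : (ℕ → Fin 2) → ℝ) μ' := integrable_const 1
  have hint : Integrable h μ' := (hone.indicator hVm).sub ((hone.indicator hZm).const_mul p)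
  set a := ∫ y, h y ∂μ' with ha
  have haval : a = μ'.real (PiNat.cylinder v q) - p * μ'.real (PiNat.cylinder v 1) := by
    rw [ha, hh, integral_sub (hone.indicator hVm) ((hone.indicator hZm).const_mul p),
      integral_const_mul, integral_indicator_one hVm, integral_indicator_one hZm]
  suffices a = 0 by linarith
  have hit : ∀ k, ∫ y, h (fullShift^[k] y) ∂μ' = a ∧ Integrable (fun y => h (fullShift^[k] y)) μ' := by
    intro k
    have hk := hinv.iterate k
    refine ⟨?_, (hk.integrable_comp hint.aestronglyMeasurable).2 hint⟩
    rw [ha, ← integral_map (φ := fullShift^[k]) (f := h) hk.measurable.aemeasurable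
      (by rw [hk.map_eq]; exact hint.aestronglyMeasurable), hk.map_eq]
  -- Jensen under `μ'`, domination on words of length `n * q`, and the moment bound under `μ` give
  -- `exp (n t a) ≤ D (n * q) (1 + t²)^n`. After logarithms and division by `n` the factor `D`
  -- disappears in the limit.
  have hbound : ∀ t : ℝ, |t| ≤ 1 → t * a ≤ t ^ 2 := by
    intro t ht
    have hn : ∀ n : ℕ, max 1 N ≤ n → t * a ≤ Real.log (D (n * q)) / (n * q : ℕ) * q + t ^ 2 := by
      intro n hN
      have hn : 1 ≤ n := (le_max_left _ _).trans hN
      set Ψ : (ℕ → Fin 2) → ℝ := fun y => t * ∑ i ∈ Finset.range n, h (fullShift^[i * q] y) with hΨ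
      have hΨdep : ∀ y z, (∀ i < n * q, y i = z i) → Ψ y = Ψ z := by
        intro y z hyz
        simp only [hΨ]
        congr 1
        refine Finset.sum_congr rfl fun i hi => ?_
        have hi' : i + 1 ≤ n := Finset.mem_range.1 hi
        have hiq : i * q + q ≤ n * q := by
          calc i * q + q = (i + 1) * q := by ring
            _ ≤ n * q := Nat.mul_le_mul_right q hi'
        have hmem : ∀ k ≤ q, (fullShift^[i * q] y ∈ PiNat.cylinder v k ↔
            fullShift^[i * q] z ∈ PiNat.cylinder v k) := fun k hk => by
          simp only [PiNat.cylinder, Set.mem_ofPred_eq, fullShift_iterate]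
          exact forall₂_congr fun j hj => by rw [hyz _ (by omega)]
        simp only [hh, Set.indicator_apply, hmem q le_rfl, hmem 1 hq, Pi.one_apply]
      have hΨint : Integrable Ψ μ' := integrable_of_forall_eq μ' Ψ hΨdep
      have hEdep : ∀ y z, (∀ i < n * q, y i = z i) → Real.exp (Ψ y) = Real.exp (Ψ z) :=
        fun y z hyz => by rw [hΨdep y z hyz]
      have hnq : N ≤ n * q := ((le_max_right _ _).trans hN).trans (Nat.le_mul_of_pos_right n hq)
      have h1 : Real.exp (n * (t * a)) ≤ ∫ y, Real.exp (Ψ y) ∂μ' := by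
        have hmean : ∫ y, Ψ y ∂μ' = n * (t * a) := by
          simp only [hΨ]
          rw [integral_const_mul, integral_finsetSum _ fun i _ => (hit _).2]
          simp only [(hit _).1, Finset.sum_const, Finset.card_range, nsmul_eq_mul]
          ring
        rw [← hmean]
        exact convexOn_exp.map_integral_le Real.continuous_exp.continuousOn isClosed_univ
          (ae_of_all _ fun _ => Set.mem_univ _) hΨint
          (integrable_of_forall_eq μ' (fun y => Real.exp (Ψ y)) hEdep)
      have h2 : ∫ y, Real.exp (Ψ y) ∂μ' ≤ D (n * q) * ∫ y, Real.exp (Ψ y) ∂μ := by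
        rw [eq_comp_prefixWord (fun y => Real.exp (Ψ y)) hEdep]
        rw [integral_comp_prefixWord μ' (fun w : Fin (n * q) → Fin 2 => Real.exp (Ψ (extendWord w))),
          integral_comp_prefixWord μ (fun w : Fin (n * q) → Fin 2 => Real.exp (Ψ (extendWord w))),
          Finset.mul_sum]
        refine Finset.sum_le_sum fun w _ => ?_
        rw [← mul_assoc]
        exact mul_le_mul_of_nonneg_right (hle _ hnq _) (Real.exp_pos _).le
      have h3 := integral_exp_sum_le hq hp hp1 ht hM h hh n
      have h4 : Real.exp (n * (t * a)) ≤ D (n * q) * (1 + t ^ 2) ^ n :=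
        h1.trans (h2.trans (mul_le_mul_of_nonneg_left h3 (hD0 _).le))
      have h5 : (n : ℝ) * (t * a) ≤ Real.log (D (n * q)) + n * t ^ 2 := by
        have h6 : (0 : ℝ) < 1 + t ^ 2 := by positivity
        have h7 := Real.log_le_sub_one_of_pos h6
        rw [← Real.le_log_iff_exp_le (mul_pos (hD0 _) (pow_pos h6 n)),
          Real.log_mul (hD0 _).ne' (pow_pos h6 n).ne', Real.log_pow] at h4
        have : (n : ℝ) * Real.log (1 + t ^ 2) ≤ n * t ^ 2 :=
          mul_le_mul_of_nonneg_left (by linarith) n.cast_nonneg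
        linarith
      have hn0 : (0 : ℝ) < n := by exact_mod_cast hn
      have hq0 : (0 : ℝ) < q := by exact_mod_cast hq
      have h8 : Real.log (D (n * q)) / (n * q : ℕ) * q = Real.log (D (n * q)) / n := by
        push_cast; field_simp
      rw [h8, ← sub_le_iff_le_add, le_div_iff₀ hn0]
      linarith
    have hlim : Tendsto (fun n : ℕ => Real.log (D (n * q)) / (n * q : ℕ) * q + t ^ 2) atTop
        (𝓝 (0 * q + t ^ 2)) :=
      ((hD.comp (tendsto_id.atTop_mul_const' (Nat.pos_of_ne_zero (by omega)))).mul_const _).add_const _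
    have := ge_of_tendsto hlim (eventually_atTop.2 ⟨max 1 N, hn⟩)
    linarith
  by_contra hne
  -- Small and of the sign of `a`: then `t * a = 2 (1 + |a|) t²` exceeds `t²`.
  set t : ℝ := a / (2 * (1 + |a|)) with ht
  have hpos : 0 < 2 * (1 + |a|) := by positivity
  have h1 := hbound t (by
    rw [ht, abs_div, abs_of_pos hpos, div_le_one hpos]; linarith [abs_nonneg a])
  have h2 : a = t * (2 * (1 + |a|)) := by rw [ht]; field_simp
  have h3 : 0 < t ^ 2 := by
    refine (sq_nonneg t).lt_of_ne' fun h0 => hne ?_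
    rw [h2, pow_eq_zero_iff two_ne_zero |>.1 h0, zero_mul]
  have h4 : t * a = t ^ 2 * (2 * (1 + |a|)) := (congrArg (t * ·) h2).trans (by ring)
  nlinarith [abs_nonneg a]

/-- The sequence `a y_0 y_1 ⋯`. -/
def consSeq (a : Fin 2) (y : ℕ → Fin 2) (i : ℕ) : Fin 2 := if i = 0 then a else y (i - 1)

lemma real_cylinder_eq_add (hinv : MeasurePreserving fullShift μ μ) (y : ℕ → Fin 2) (n : ℕ) :
    μ.real (PiNat.cylinder y n) = μ.real (PiNat.cylinder (consSeq 0 y) (n + 1)) +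
      μ.real (PiNat.cylinder (consSeq 1 y) (n + 1)) := by
  have hmem : ∀ a z, z ∈ PiNat.cylinder (consSeq a y) (n + 1) ↔
      z 0 = a ∧ fullShift z ∈ PiNat.cylinder y n := by
    intro a z
    simp only [PiNat.cylinder, Set.mem_ofPred_eq, consSeq, fullShift]
    constructor
    · exact fun h => ⟨by simpa using h 0 (by omega), fun i hi => by simpa using h (i + 1) (by omega)⟩
    · rintro ⟨h1, h2⟩ i hi
      rcases i with _ | i
      · simpa using h1
      · simpa using h2 i (by omega)
  rw [← hinv.measureReal_preimage (measurableSet_piNat_cylinder y n).nullMeasurableSet,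
    ← measureReal_union _ (measurableSet_piNat_cylinder _ _)]
  · congr 1
    ext z
    rw [Set.mem_union, hmem, hmem, Set.mem_preimage]
    rcases fin_two_eq (z 0) with h | h <;> simp [h]
  · refine Set.disjoint_left.2 fun z h0 h1 => ?_
    rw [hmem] at h0 h1
    rw [h0.1] at h1
    exact zero_ne_one h1.1

/-- Uniqueness: an invariant measure that is subexponentially dominated by an invariant measure which
renews at `0` and gives exponentially small mass to `[1^n]` is equal to it. -/
theorem eq_of_subexponential_le {D : ℕ → ℝ} {N K : ℕ} {θ : ℝ} (hK : 1 ≤ K) (hθ0 : 0 < θ) (hθ : θ < 1)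
    (hM : ∀ n q, 1 ≤ q → ∀ y v : ℕ → Fin 2, v 0 = 0 →
      μ.real (PiNat.cylinder (splice n y v) (n + q)) * μ.real (PiNat.cylinder v 1) =
        μ.real (PiNat.cylinder (splice n y v) (n + 1)) * μ.real (PiNat.cylinder v q))
    (hpos : 0 < μ.real (PiNat.cylinder 0 1))
    (hdecay : ∀ n, μ.real (PiNat.cylinder 1 (n * K)) ≤ θ ^ n)
    (hinv : MeasurePreserving fullShift μ μ) (hinv' : MeasurePreserving fullShift μ' μ')
    (hD0 : ∀ n, 0 < D n) (hD : Tendsto (fun n : ℕ => Real.log (D n) / n) atTop (𝓝 0))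
    (hle : ∀ n, N ≤ n → ∀ y, μ'.real (PiNat.cylinder y n) ≤ D n * μ.real (PiNat.cylinder y n)) :
    μ' = μ := by
  have hcyl1 : ∀ v : ℕ → Fin 2, v 0 = 0 → PiNat.cylinder v 1 = PiNat.cylinder 0 1 := by
    intro v hv
    ext z
    simp [PiNat.cylinder, hv]
  -- The defect `e` of proportionality vanishes on cylinders starting with `0`; it remains to show
  -- that it vanishes everywhere and that `κ = 1`.
  set κ := μ'.real (PiNat.cylinder 0 1) / μ.real (PiNat.cylinder 0 1) with hκ
  set e : (ℕ → Fin 2) → ℕ → ℝ := fun y n =>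
    μ'.real (PiNat.cylinder y n) - κ * μ.real (PiNat.cylinder y n) with he
  have hκ0 : 0 ≤ κ := div_nonneg measureReal_nonneg measureReal_nonneg
  have he0 : ∀ v : ℕ → Fin 2, v 0 = 0 → ∀ q, 1 ≤ q → e v q = 0 := by
    intro v hv q hq
    have h1 := real_cylinder_eq_mul (μ := μ) (μ' := μ') (D := D) hq (v := v)
      (p := μ.real (PiNat.cylinder v q) / μ.real (PiNat.cylinder v 1))
      (div_nonneg measureReal_nonneg measureReal_nonneg)
      (div_le_one_of_le₀ (measureReal_mono (PiNat.cylinder_anti v hq)) measureReal_nonneg)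
      (fun n y => by
        have := hM n q hq y v hv
        rw [hcyl1 v hv] at this ⊢
        field_simp
        linarith) hinv' hD0 hD hle
    rw [hcyl1 v hv] at h1
    simp only [he]
    rw [h1, hκ]; ring
  -- By invariance the defect of `[y]` is the sum of those of `[0y]` and `[1y]`, and the first is
  -- zero. Iterating, it equals the defect of `[1^k y]`, which lies in `[1^k]`.
  have hstep : ∀ y n, e y n = e (consSeq 1 y) (n + 1) := by
    intro y n
    have h1 := he0 (consSeq 0 y) rfl (n + 1) (by omega)
    simp only [he] at h1 ⊢
    rw [real_cylinder_eq_add hinv, real_cylinder_eq_add hinv']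
    linarith
  have hiter : ∀ k y n, e y n = e ((consSeq 1)^[k] y) (n + k) := by
    intro k
    induction k with
    | zero => intro y n; rfl
    | succ k ih =>
      intro y n
      rw [ih y n, hstep, Function.iterate_succ_apply']; rfl
  have hsub : ∀ k y n, PiNat.cylinder ((consSeq 1)^[k] y) (n + k) ⊆ PiNat.cylinder 1 k := by
    intro k y n z hz i hi
    rw [hz i (by omega)]
    clear hz
    induction k generalizing i with
    | zero => omega
    | succ k ih =>
      rw [Function.iterate_succ_apply', consSeq]
      split_ifs with h0
      · rfl
      · exact ih (i - 1) (by omega)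
  have hzero : ∀ y n, e y n = 0 := by
    intro y n
    have hb : ∀ k : ℕ, N ≤ k → |e y n| ≤ D (k * K) * θ ^ k + κ * θ ^ k := by
      intro k hk
      rw [hiter (k * K) y n]
      have h1 := hdecay k
      have h2 := measureReal_mono (μ := μ) (hsub (k * K) y n)
      have h3 := measureReal_mono (μ := μ') (hsub (k * K) y n)
      have hkK : N ≤ k * K := hk.trans (Nat.le_mul_of_pos_right k hK)
      have h4 := hle (k * K) hkK 1
      have h5 := mul_le_mul_of_nonneg_left h1 (hD0 (k * K)).le
      have h6 := mul_le_mul_of_nonneg_left (h2.trans h1) hκ0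
      have h7 : 0 ≤ μ'.real (PiNat.cylinder ((consSeq 1)^[k * K] y) (n + k * K)) := measureReal_nonneg
      have h8 : 0 ≤ κ * μ.real (PiNat.cylinder ((consSeq 1)^[k * K] y) (n + k * K)) :=
        mul_nonneg hκ0 measureReal_nonneg
      simp only [he]
      rw [abs_le]
      constructor <;> linarith
    have hpow : Tendsto (fun k : ℕ => θ ^ k) atTop (𝓝 0) :=
      tendsto_pow_atTop_nhds_zero_of_lt_one hθ0.le hθ
    -- Exponential decay beats the subexponential factor: the logarithm of the product is `k` times
    -- a sequence tending to `log θ < 0`.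
    have hDθ : Tendsto (fun k : ℕ => D (k * K) * θ ^ k) atTop (𝓝 0) := by
      have hlog : Real.log θ < 0 := Real.log_neg hθ0 hθ
      have h1 : Tendsto (fun k : ℕ => Real.log (D (k * K)) / (k * K : ℕ) * K + Real.log θ) atTop
          (𝓝 (0 * K + Real.log θ)) :=
        ((hD.comp (tendsto_id.atTop_mul_const' (Nat.pos_of_ne_zero (by omega)))).mul_const _).add_const _
      rw [zero_mul, zero_add] at h1
      have h2 := h1.neg_mul_atTop hlog tendsto_natCast_atTop_atTop
      refine (Real.tendsto_exp_atBot.comp h2).congr' (eventually_atTop.2 ⟨1, fun k hk => ?_⟩)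
      have hk0 : (0 : ℝ) < k := by exact_mod_cast hk
      have hK0 : (0 : ℝ) < K := by exact_mod_cast hK
      have h3 : (Real.log (D (k * K)) / (k * K : ℕ) * K + Real.log θ) * k =
          Real.log (D (k * K)) + Real.log (θ ^ k) := by
        rw [Real.log_pow]; push_cast; field_simp
      simp only [Function.comp_apply]
      rw [h3, Real.exp_add, Real.exp_log (hD0 _), Real.exp_log (by positivity)]
    have h0 : Tendsto (fun k : ℕ => D (k * K) * θ ^ k + κ * θ ^ k) atTop (𝓝 0) := by
      simpa using hDθ.add (hpow.const_mul κ)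
    have := ge_of_tendsto h0 (eventually_atTop.2 ⟨N, hb⟩)
    exact abs_eq_zero.1 (le_antisymm this (abs_nonneg _))
  -- The cylinder of length zero is the whole space.
  have hκ1 : κ = 1 := by
    have := hzero 0 0
    simp [he] at this
    linarith
  refine ext_of_cylinder fun n y => ?_
  have := hzero y n
  simp only [he, hκ1] at this
  linarith

end RelPressure

/-! ### Products of symbol matrices: stationarity, renewal and decay. -/

namespace RelPressure
open Matrix

lemma mulVec_apply_eq_sum (M : Matrix (Fin 3) (Fin 3) ℝ) (u : Fin 3 → ℝ) (i : Fin 3) :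
    (M *ᵥ u) i = ∑ j, M i j * u j := rfl

/-- The product `P_{y_0} ⋯ P_{y_{n-1}}`. -/
def wordMatrix (P : Fin 2 → Matrix (Fin 3) (Fin 3) ℝ) : ℕ → (ℕ → Fin 2) → Matrix (Fin 3) (Fin 3) ℝ
  | 0, _ => 1
  | n + 1, y => wordMatrix P n y * P (y n)

variable {P : Fin 2 → Matrix (Fin 3) (Fin 3) ℝ} {l r : Fin 3 → ℝ}

lemma wordMatrix_congr (n : ℕ) {y z : ℕ → Fin 2} (h : ∀ i < n, y i = z i) :
    wordMatrix P n y = wordMatrix P n z := by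
  induction n with
  | zero => rfl
  | succ n ih => rw [wordMatrix, wordMatrix, ih fun i hi => h i (by omega), h n (by omega)]

lemma wordMatrix_splice (n q : ℕ) (y v : ℕ → Fin 2) :
    wordMatrix P (n + q) (splice n y v) = wordMatrix P n y * wordMatrix P q v := by
  induction q with
  | zero =>
    rw [wordMatrix, mul_one, add_zero]
    exact wordMatrix_congr n fun i hi => if_pos hi
  | succ q ih =>
    rw [← add_assoc, wordMatrix, ih, wordMatrix, mul_assoc]
    congr 3
    simp [splice]

lemma wordMatrix_succ' (n : ℕ) (y : ℕ → Fin 2) :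
    wordMatrix P (n + 1) y = P (y 0) * wordMatrix P n (fullShift y) := by
  have h := wordMatrix_splice (P := P) 1 n y (fullShift y)
  rw [add_comm 1 n] at h
  rw [show wordMatrix P 1 y = P (y 0) by rw [wordMatrix, wordMatrix, one_mul]] at h
  rw [← h]
  refine wordMatrix_congr _ fun i hi => ?_
  rw [splice]
  split_ifs with h1
  · rfl
  · rw [fullShift]; congr 1; omega

lemma wordMatrix_const (n : ℕ) (a : Fin 2) : wordMatrix P n (fun _ => a) = P a ^ n := by
  induction n with
  | zero => rfl
  | succ n ih => rw [wordMatrix, ih, pow_succ]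

/-- The data of a stationary process on `{0, 1}` with three hidden states which renews at the
symbol `0`; the state `0` lies over the symbol `0`. -/
structure IsRenewalData (P : Fin 2 → Matrix (Fin 3) (Fin 3) ℝ) (l r : Fin 3 → ℝ) : Prop where
  nonneg : ∀ a i j, 0 ≤ P a i j
  left_nonneg : ∀ i, 0 ≤ l i
  right_nonneg : ∀ i, 0 ≤ r i
  left_pos : 0 < l 0
  right_pos : 0 < r 0
  mulVec_eq : P 0 *ᵥ r + P 1 *ᵥ r = r
  vecMul_eq : l ᵥ* P 0 + l ᵥ* P 1 = l
  dotProduct_eq : l ⬝ᵥ r = 1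
  zero_col : ∀ i j, j ≠ 0 → P 0 i j = 0
  one_col : ∀ i, P 1 i 0 = 0
  reach : ∀ i, 0 < r i → Relation.TransGen (fun i j => 0 < P 0 i j ∨ 0 < P 1 i j) i 0

namespace IsRenewalData

variable (h : IsRenewalData P l r)
include h

lemma wordMatrix_nonneg (n : ℕ) (y : ℕ → Fin 2) (i j : Fin 3) : 0 ≤ wordMatrix P n y i j := by
  induction n generalizing j with
  | zero => rw [wordMatrix, one_apply]; split_ifs <;> norm_num
  | succ n ih =>
    rw [wordMatrix, mul_apply]
    exact Finset.sum_nonneg fun k _ => mul_nonneg (ih k) (h.nonneg _ _ _)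

lemma weight_nonneg (n : ℕ) (y : ℕ → Fin 2) : 0 ≤ l ⬝ᵥ (wordMatrix P n y *ᵥ r) :=
  Finset.sum_nonneg fun i _ => mul_nonneg (h.left_nonneg i) <| by
    rw [mulVec_apply_eq_sum]
    exact (Finset.sum_nonneg fun j _ => mul_nonneg (h.wordMatrix_nonneg n y i j) (h.right_nonneg j))

/-- The stationary measure on binary sequences. -/
lemma exists_measure : ∃ μ : Measure (ℕ → Fin 2), IsProbabilityMeasure μ ∧
    MeasurePreserving fullShift μ μ ∧
    ∀ n y, μ.real (PiNat.cylinder y n) = l ⬝ᵥ (wordMatrix P n y *ᵥ r) := by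
  obtain ⟨μ, hμ, hcyl⟩ := exists_measure_of_weights (fun n y => l ⬝ᵥ (wordMatrix P n y *ᵥ r))
    (fun n y z hyz => by rw [wordMatrix_congr n hyz])
    (fun y => by simp [wordMatrix, h.dotProduct_eq]) h.weight_nonneg
    (fun n y => by
      have hu : ∀ a, wordMatrix P n (Function.update y n a) = wordMatrix P n y := fun a =>
        wordMatrix_congr n fun i hi => Function.update_of_ne (by omega) _ _
      simp only [wordMatrix, hu, Function.update_self]
      rw [← dotProduct_add, ← mulVec_mulVec, ← mulVec_mulVec, ← mulVec_add, h.mulVec_eq])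
  refine ⟨μ, hμ, ⟨measurable_fullShift, ?_⟩, hcyl⟩
  have : IsProbabilityMeasure (μ.map fullShift) :=
    Measure.isProbabilityMeasure_map measurable_fullShift.aemeasurable
  refine ext_of_cylinder fun n y => ?_
  rw [map_measureReal_apply measurable_fullShift (measurableSet_piNat_cylinder y n), hcyl]
  have hpre : fullShift ⁻¹' PiNat.cylinder y n =
      PiNat.cylinder (consSeq 0 y) (n + 1) ∪ PiNat.cylinder (consSeq 1 y) (n + 1) := by
    ext z
    simp only [PiNat.cylinder, Set.mem_ofPred_eq, Set.mem_preimage, Set.mem_union, fullShift, consSeq]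
    constructor
    · intro hz
      rcases fin_two_eq (z 0) with h0 | h0
      · left
        rintro (_ | i) hi
        · simpa using h0
        · simpa using hz i (by omega)
      · right
        rintro (_ | i) hi
        · simpa using h0
        · simpa using hz i (by omega)
    · rintro (hz | hz) i hi <;> simpa using hz (i + 1) (by omega)
  rw [hpre, measureReal_union _ (measurableSet_piNat_cylinder _ _), hcyl, hcyl, wordMatrix_succ',
    wordMatrix_succ']
  · have hc : ∀ a, fullShift (consSeq a y) = y := fun a => funext fun i => by
      simp [fullShift, consSeq]
    rw [hc, hc, show consSeq 0 y 0 = 0 from rfl, show consSeq 1 y 0 = 1 from rfl,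
      ← mulVec_mulVec, ← mulVec_mulVec, dotProduct_mulVec l (P 0), dotProduct_mulVec l (P 1),
      ← add_dotProduct, h.vecMul_eq]
  · refine Set.disjoint_left.2 fun z h0 h1 => ?_
    have h0 := h0 0 (by omega)
    have h1 := h1 0 (by omega)
    rw [h0] at h1
    exact zero_ne_one h1

/-- Only the column of the state `0` survives in `P 0`, so this matrix has rank one and forgets the
past. This is the source of renewal. -/
lemma dotProduct_zero_mulVec (u z : Fin 3 → ℝ) :
    u ⬝ᵥ (P 0 *ᵥ z) = (u ⬝ᵥ fun i => P 0 i 0) * z 0 := by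
  have : P 0 *ᵥ z = fun i => P 0 i 0 * z 0 := funext fun i => by
    rw [mulVec_apply_eq_sum]
    exact Finset.sum_eq_single_of_mem 0 (Finset.mem_univ _) fun j _ hj => by
      rw [h.zero_col i j hj, zero_mul]
  rw [this]
  simp only [dotProduct, Finset.sum_mul, mul_assoc]

lemma renewal (n q : ℕ) (hq : 1 ≤ q) (y v : ℕ → Fin 2) (hv : v 0 = 0) :
    (l ⬝ᵥ (wordMatrix P (n + q) (splice n y v) *ᵥ r)) * (l ⬝ᵥ (wordMatrix P 1 v *ᵥ r)) =
      (l ⬝ᵥ (wordMatrix P (n + 1) (splice n y v) *ᵥ r)) * (l ⬝ᵥ (wordMatrix P q v *ᵥ r)) := by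
  obtain ⟨q, rfl⟩ := Nat.exists_eq_add_of_le' hq
  rw [wordMatrix_splice, wordMatrix_splice, wordMatrix_succ' q v, wordMatrix_succ' 0 v, hv]
  simp only [← mulVec_mulVec]
  rw [dotProduct_mulVec l (wordMatrix P n y), dotProduct_mulVec l (wordMatrix P n y)]
  simp only [h.dotProduct_zero_mulVec]
  ring

/-- From `P 0 r + P 1 r = r` one gets `P 1 r ≤ r`, with strict inequality at states that can emit
`0` next. Every state with `r i > 0` reaches the state `0`, and only through `P 0`, so some power of
`P 1` strictly lowers `r` at each of them; finitely many states allow one exponent `K` and one ratio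
`θ`. -/
lemma exists_decay : ∃ (K : ℕ) (θ : ℝ), 1 ≤ K ∧ 0 < θ ∧ θ < 1 ∧
    ∀ n, l ⬝ᵥ (wordMatrix P (n * K) 1 *ᵥ r) ≤ θ ^ n := by
  have hmono : ∀ u v : Fin 3 → ℝ, (∀ i, u i ≤ v i) → ∀ i, (P 1 *ᵥ u) i ≤ (P 1 *ᵥ v) i :=
    fun u v huv i => by
      rw [mulVec_apply_eq_sum, mulVec_apply_eq_sum]
      exact Finset.sum_le_sum fun j _ => mul_le_mul_of_nonneg_left (huv j) (h.nonneg 1 i j)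
  have hmonopow : ∀ (k : ℕ) (u v : Fin 3 → ℝ), (∀ i, u i ≤ v i) →
      ∀ i, ((P 1 ^ k) *ᵥ u) i ≤ ((P 1 ^ k) *ᵥ v) i := by
    intro k u v huv
    induction k with
    | zero => simpa using huv
    | succ k ih =>
      simp only [pow_succ', ← mulVec_mulVec]
      exact hmono _ _ ih
  have hsplit : ∀ i, (P 1 *ᵥ r) i = r i - P 0 i 0 * r 0 := fun i => by
    have h1 := congrFun h.mulVec_eq i
    have h2 : (P 0 *ᵥ r) i = P 0 i 0 * r 0 := by
      rw [mulVec_apply_eq_sum]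
      exact Finset.sum_eq_single_of_mem 0 (Finset.mem_univ _) fun j _ hj => by
        rw [h.zero_col i j hj, zero_mul]
    rw [Pi.add_apply, h2] at h1
    linarith
  have hP1r : ∀ i, (P 1 *ᵥ r) i ≤ r i := fun i => by
    rw [hsplit]
    have := mul_nonneg (h.nonneg 0 i 0) h.right_pos.le
    linarith
  have hanti : ∀ i, Antitone fun k : ℕ => ((P 1 ^ k) *ᵥ r) i := fun i =>
    antitone_nat_of_succ_le fun k => by
      rw [pow_succ, ← mulVec_mulVec]
      exact hmonopow k _ _ hP1r i
  have hle : ∀ (k : ℕ) i, ((P 1 ^ k) *ᵥ r) i ≤ r i := fun k i => by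
    simpa using hanti i k.zero_le
  have hstrict : ∀ i, Relation.TransGen (fun i j => 0 < P 0 i j ∨ 0 < P 1 i j) i 0 →
      ∃ k : ℕ, ((P 1 ^ k) *ᵥ r) i < r i := by
    intro i hi
    have hbase : ∀ i, 0 < P 0 i 0 → ∃ k : ℕ, ((P 1 ^ k) *ᵥ r) i < r i := fun i hi => ⟨1, by
      rw [pow_one, hsplit]
      have := mul_pos hi h.right_pos
      linarith⟩
    induction hi using Relation.TransGen.head_induction_on with
    | single hi =>
      rcases hi with hi | hi
      · exact hbase _ hi
      · rw [h.one_col] at hi; exact absurd hi (lt_irrefl _)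
    | @head i j hij _ ih =>
      rcases hij with hij | hij
      · rcases eq_or_ne j 0 with rfl | hj
        · exact hbase _ hij
        · rw [h.zero_col i j hj] at hij; exact absurd hij (lt_irrefl _)
      · obtain ⟨k, hk⟩ := ih
        refine ⟨k + 1, lt_of_lt_of_le ?_ (hP1r i)⟩
        rw [pow_succ', ← mulVec_mulVec]
        exact Finset.sum_lt_sum
          (fun m _ => mul_le_mul_of_nonneg_left (hle k m) (h.nonneg 1 i m))
          ⟨j, Finset.mem_univ j, mul_lt_mul_of_pos_left hk hij⟩
  have hex : ∀ i, ∃ k : ℕ, 0 < r i → ((P 1 ^ k) *ᵥ r) i < r i := fun i => by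
    by_cases hi : 0 < r i
    · obtain ⟨k, hk⟩ := hstrict i (h.reach i hi)
      exact ⟨k, fun _ => hk⟩
    · exact ⟨0, fun hi' => absurd hi' hi⟩
  choose k hk using hex
  -- `P 1 ^ k` applied to `r` decreases in `k`, so an exponent above all `k i` serves every state.
  set K := (∑ i, k i) + 1 with hK
  have hKlt : ∀ i, 0 < r i → ((P 1 ^ K) *ᵥ r) i < r i := fun i hi =>
    (hanti i ((Finset.single_le_sum (fun _ _ => Nat.zero_le _) (Finset.mem_univ i)).trans
      (Nat.le_succ _))).trans_lt (hk i hi)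
  obtain ⟨θ, hθ, hθ0, hθ1⟩ : ∃ θ : ℝ, (∀ i, ((P 1 ^ K) *ᵥ r) i ≤ θ * r i) ∧ 0 < θ ∧ θ < 1 := by
    have hev : ∀ i, ∀ᶠ θ in 𝓝[<] (1 : ℝ), ((P 1 ^ K) *ᵥ r) i ≤ θ * r i := fun i => by
      rcases (h.right_nonneg i).lt_or_eq with hi | hi
      · have : ∀ᶠ θ in 𝓝 (1 : ℝ), ((P 1 ^ K) *ᵥ r) i < θ * r i :=
          ContinuousAt.eventually_lt (f := fun _ : ℝ => ((P 1 ^ K) *ᵥ r) i)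
            (g := fun θ : ℝ => θ * r i) continuousAt_const (by fun_prop) (by simpa using hKlt i hi)
        exact (this.filter_mono nhdsWithin_le_nhds).mono fun θ hθ => hθ.le
      · refine Eventually.of_forall fun θ => ?_
        rw [← hi, mul_zero, hi]
        exact hle K i
    obtain ⟨θ, h1, h2⟩ := ((eventually_all.2 hev).and (Ioo_mem_nhdsLT (zero_lt_one))).exists
    exact ⟨θ, h1, h2.1, h2.2⟩
  refine ⟨K, θ, by omega, hθ0, hθ1, fun n => ?_⟩
  have hn : ∀ n : ℕ, ∀ i, ((P 1 ^ (n * K)) *ᵥ r) i ≤ θ ^ n * r i := by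
    intro n
    induction n with
    | zero => simp
    | succ n ih =>
      intro i
      rw [add_mul, one_mul, add_comm (n * K), pow_add (P 1), ← mulVec_mulVec]
      refine (hmonopow K _ (θ ^ n • r) ih i).trans ?_
      rw [mulVec_smul, Pi.smul_apply, smul_eq_mul, pow_succ θ, mul_assoc]
      exact mul_le_mul_of_nonneg_left (hθ i) (pow_nonneg hθ0.le n)
  rw [show (1 : ℕ → Fin 2) = fun _ => 1 from rfl, wordMatrix_const]
  calc l ⬝ᵥ ((P 1 ^ (n * K)) *ᵥ r) ≤ l ⬝ᵥ (θ ^ n • r) :=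
        Finset.sum_le_sum fun i _ => mul_le_mul_of_nonneg_left (hn n i) (h.left_nonneg i)
    _ = θ ^ n := by rw [dotProduct_smul, h.dotProduct_eq, smul_eq_mul, mul_one]

end IsRenewalData

end RelPressure

/-! ### The weight matrix of `X` and its Perron eigenvectors. -/

namespace RelPressure
open Matrix

section Transition

variable {k : ℕ} {A : Matrix (Fin k) (Fin k) ℕ} {φ : Fin k → Fin k → ℝ}

lemma shift_iterate_val {B : Matrix (Fin k) (Fin k) ℕ} (n : ℕ) (y : SFT B) (i : ℕ) :
    ((shift B)^[n] y).1 i = y.1 (n + i) := by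
  induction n generalizing y with
  | zero => simp
  | succ n ih => rw [Function.iterate_succ_apply, ih, show n + 1 + i = n + i + 1 by omega]; rfl

/-- The symbol `i` appears in `X_A`. -/
def Appears (A : Matrix (Fin k) (Fin k) ℕ) (i : Fin k) : Prop := ∃ x : SFT A, x.1 0 = i

lemma appears_apply (x : SFT A) (n : ℕ) : Appears A (x.1 n) :=
  ⟨(shift A)^[n] x, shift_iterate_val n x 0⟩

lemma mem_blocks_iff {n : ℕ} {w : Fin n → Fin k} :
    w ∈ blocks (SFT A) n ↔ ∃ x : SFT A, ∀ i : Fin n, x.1 i = w i := by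
  constructor
  · rintro ⟨x, hx, m, hm⟩
    exact ⟨(shift A)^[m] ⟨x, hx⟩, fun i => by rw [shift_iterate_val]; exact hm i⟩
  · rintro ⟨x, hx⟩
    exact ⟨x.1, x.2, 0, fun i => by rw [zero_add]; exact hx i⟩

lemma weightMatrix_nonneg (i j : Fin k) : 0 ≤ weightMatrix A φ i j := by
  rw [weightMatrix, of_apply]
  split_ifs
  exacts [(Real.exp_pos _).le, le_rfl]

lemma weightMatrix_apply (x : SFT A) (n : ℕ) :
    weightMatrix A φ (x.1 n) (x.1 (n + 1)) = Real.exp (φ (x.1 n) (x.1 (n + 1))) := by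
  rw [weightMatrix, of_apply, if_pos]
  refine ⟨x.1, x.2, n, fun i => ?_⟩
  fin_cases i <;> rfl

lemma weightMatrix_pos_apply (x : SFT A) (n : ℕ) :
    0 < weightMatrix A φ (x.1 n) (x.1 (n + 1)) := by
  rw [weightMatrix_apply]; exact Real.exp_pos _

lemma exists_of_weightMatrix_ne_zero {i j : Fin k} (h : weightMatrix A φ i j ≠ 0) :
    ∃ x : SFT A, x.1 0 = i ∧ x.1 1 = j := by
  have hb : ![i, j] ∈ blocks (SFT A) 2 := by
    by_contra hne
    exact h (by rw [weightMatrix, of_apply, if_neg hne])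
  obtain ⟨x, hx⟩ := mem_blocks_iff.1 hb
  exact ⟨x, hx 0, hx 1⟩

/-- A word with allowed transitions is continued by a point through its last letter. The hypothesis
on that letter carries the content for words of length one, which have no transition. -/
lemma mem_blocks_of_prod_ne_zero {n : ℕ} {w : Fin (n + 1) → Fin k}
    (hw : ∀ i : Fin n, weightMatrix A φ (w i.castSucc) (w i.succ) ≠ 0)
    (hlast : Appears A (w (Fin.last n))) : w ∈ blocks (SFT A) (n + 1) := by
  obtain ⟨x, hx⟩ := hlast
  set z : ℕ → Fin k := fun i => if h : i < n + 1 then w ⟨i, h⟩ else x.1 (i - n) with hz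
  have hz1 : ∀ (i : ℕ) (hi : i < n + 1), z i = w ⟨i, hi⟩ := fun i hi => dif_pos hi
  have hz2 : ∀ i, n ≤ i → z i = x.1 (i - n) := fun i hi => by
    rcases hi.eq_or_lt with rfl | hi
    · rw [hz1 n n.lt_succ_self, Nat.sub_self, hx]; rfl
    · exact dif_neg (by omega)
  have hzA : ∀ i, A (z i) (z (i + 1)) = 1 := fun i => by
    rcases lt_or_ge i n with hi | hi
    · obtain ⟨u, h0, h1⟩ := exists_of_weightMatrix_ne_zero (hw ⟨i, hi⟩)
      have := u.2 0
      rw [zero_add, h0, h1] at this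
      rw [hz1 i (by omega), hz1 (i + 1) (by omega)]
      exact this
    · have := x.2 (i - n)
      rwa [hz2 i hi, hz2 (i + 1) (by omega), show i + 1 - n = i - n + 1 by omega]
  exact mem_blocks_iff.2 ⟨⟨z, hzA⟩, fun i => hz1 i i.2⟩

lemma exists_path (hirr : IsIrreducible (SFT A)) {i j : Fin k} (hi : Appears A i)
    (hj : Appears A j) : ∃ (x : SFT A) (b : ℕ), 0 < b ∧ x.1 0 = i ∧ x.1 b = j := by
  obtain ⟨xi, hxi⟩ := hi
  obtain ⟨xj, hxj⟩ := hj
  obtain ⟨m, w, -, hw⟩ := hirr 1 1 (fun _ => i) (mem_blocks_iff.2 ⟨xi, fun a => by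
    rw [Subsingleton.elim a 0]; exact hxi⟩) (fun _ => j) (mem_blocks_iff.2 ⟨xj, fun a => by
    rw [Subsingleton.elim a 0]; exact hxj⟩)
  obtain ⟨x, hx⟩ := mem_blocks_iff.1 hw
  refine ⟨x, 1 + m, by omega, ?_, ?_⟩
  · have := hx (Fin.castAdd 1 (Fin.castAdd m 0))
    rw [Fin.append_left, Fin.append_left] at this
    exact this
  · have := hx (Fin.natAdd (1 + m) 0)
    rw [Fin.append_right] at this
    exact this

lemma transGen_of_lt {ι : Type*} {R : ι → ι → Prop} {z : ℕ → ι} (hz : ∀ n, R (z n) (z (n + 1)))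
    {b : ℕ} (hb : 0 < b) : Relation.TransGen R (z 0) (z b) := by
  induction b, hb using Nat.le_induction with
  | base => exact .single (hz 0)
  | succ b _ ih => exact ih.tail (hz b)

end Transition

/-- A symbol may fail to occur in `X`, and then the full matrix is not irreducible. Perron–Frobenius
is applied to the occurring symbols and the eigenvector is extended by zero. -/
lemma exists_eigenvector_of_support (M : Matrix (Fin 3) (Fin 3) ℝ) (S : Fin 3 → Prop)
    (hM : ∀ i j, 0 ≤ M i j) (hS : ∀ i j, M i j ≠ 0 → S i ∧ S j) (h0 : S 0)
    (hirr : ∀ i j : {i // S i}, Relation.ReflTransGen (fun i j : {i // S i} => 0 < M i j) i j) :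
    ∃ (t : ℝ) (r : Fin 3 → ℝ), (∀ i, 0 ≤ r i) ∧ (∀ i, 0 < r i ↔ S i) ∧ M *ᵥ r = t • r := by
  classical
  have : Nonempty {i // S i} := ⟨⟨0, h0⟩⟩
  obtain ⟨t, ρ, hρ, hMρ⟩ := exists_pos_eigenvector (M.submatrix Subtype.val Subtype.val)
    (fun i j : {i // S i} => hM i j) hirr
  set r : Fin 3 → ℝ := fun i => if h : S i then ρ ⟨i, h⟩ else 0 with hr
  have hrS : ∀ i : {i // S i}, r i = ρ i := fun i => dif_pos i.2
  have hrn : ∀ i, ¬ S i → r i = 0 := fun i hi => dif_neg hi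
  have hpos : ∀ i, 0 < r i ↔ S i := fun i => by
    by_cases hi : S i
    · exact ⟨fun _ => hi, fun _ => by rw [hrS ⟨i, hi⟩]; exact hρ _⟩
    · exact ⟨fun h => by rw [hrn i hi] at h; exact absurd h (lt_irrefl _), fun h => absurd h hi⟩
  refine ⟨t, r, fun i => ?_, hpos, funext fun i => ?_⟩
  · by_cases hi : S i
    · exact ((hpos i).2 hi).le
    · exact (hrn i hi).ge
  · rw [mulVec_apply_eq_sum, Pi.smul_apply, smul_eq_mul]
    by_cases hi : S i
    · have h1 := congrFun hMρ ⟨i, hi⟩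
      rw [Pi.smul_apply, smul_eq_mul, ← hrS] at h1
      rw [← h1]
      refine (Fintype.sum_of_injective (ι := {i // S i}) Subtype.val Subtype.val_injective _
        (fun j => M i j * r j) (fun j hj => ?_) fun j => ?_).symm
      · rw [hrn j (fun h => hj ⟨⟨j, h⟩, rfl⟩), mul_zero]
      · rw [hrS]; rfl
    · rw [hrn i hi, mul_zero]
      exact Finset.sum_eq_zero fun j _ => by
        rw [not_not.1 (mt (hS i j) fun h => hi h.1), zero_mul]

/-- The part of `t⁻¹ M` leading to the states over the symbol `a`. -/
noncomputable def symbolMatrix (M : Matrix (Fin 3) (Fin 3) ℝ) (t : ℝ) (a : Fin 2) :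
    Matrix (Fin 3) (Fin 3) ℝ :=
  of fun i j => if code j = a then t⁻¹ * M i j else 0

lemma symbolMatrix_add (M : Matrix (Fin 3) (Fin 3) ℝ) (t : ℝ) :
    symbolMatrix M t 0 + symbolMatrix M t 1 = t⁻¹ • M := by
  ext i j
  simp only [symbolMatrix, Matrix.add_apply, of_apply, Matrix.smul_apply, smul_eq_mul]
  rcases fin_two_eq (code j) with h | h <;> simp [h]

/-- Irreducibility of `X` supplies paths between any two occurring symbols, hence right and left
Perron vectors; `l` is scaled so that `l ⬝ᵥ r = 1`. Renewal holds because `code` sends only the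
symbol `0` to `0`. -/
lemma exists_isRenewalData {A : Matrix (Fin 3) (Fin 3) ℕ} (φ : Fin 3 → Fin 3 → ℝ)
    (hirr : IsIrreducible (SFT A)) (h0 : Appears A 0) :
    ∃ (t : ℝ) (l r : Fin 3 → ℝ), 0 < t ∧ (∀ i, 0 < l i ↔ Appears A i) ∧
      (∀ i, 0 < r i ↔ Appears A i) ∧ l ᵥ* weightMatrix A φ = t • l ∧
      IsRenewalData (symbolMatrix (weightMatrix A φ) t) l r := by
  set M := weightMatrix A φ with hM
  have hnn : ∀ i j, 0 ≤ M i j := weightMatrix_nonneg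
  have hS : ∀ i j, M i j ≠ 0 → Appears A i ∧ Appears A j := fun i j h => by
    obtain ⟨x, rfl, rfl⟩ := exists_of_weightMatrix_ne_zero h
    exact ⟨appears_apply x 0, appears_apply x 1⟩
  have hpath : ∀ i j : {i // Appears A i},
      Relation.ReflTransGen (fun i j : {i // Appears A i} => 0 < M i j) i j := by
    rintro ⟨i, hi⟩ ⟨j, hj⟩
    obtain ⟨x, b, hb, rfl, rfl⟩ := exists_path hirr hi hj
    exact (transGen_of_lt (z := fun n => (⟨x.1 n, appears_apply x n⟩ : {i // Appears A i}))
      (fun n => weightMatrix_pos_apply x n) hb).to_reflTransGen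
  obtain ⟨t, r, hr0, hr, hMr⟩ := exists_eigenvector_of_support M (Appears A) hnn hS h0 hpath
  obtain ⟨t', l, hl0, hl, hMl⟩ := exists_eigenvector_of_support Mᵀ (Appears A) (fun i j => hnn j i)
    (fun i j h => (hS j i h).symm) h0 fun i j => by
      have := hpath j i
      rw [← Relation.reflTransGen_swap] at this
      exact this
  rw [mulVec_transpose] at hMl
  have ht : 0 < t := by
    obtain ⟨x, hx⟩ := h0
    have h1 := weightMatrix_pos_apply (φ := φ) x 0
    have h2 := congrFun hMr (x.1 0)
    rw [Pi.smul_apply, smul_eq_mul, mulVec_apply_eq_sum] at h2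
    have h3 : 0 < ∑ j, M (x.1 0) j * r j :=
      Finset.sum_pos' (fun j _ => mul_nonneg (hnn _ _) (hr0 j))
        ⟨x.1 1, Finset.mem_univ _, mul_pos h1 ((hr _).2 (appears_apply x 1))⟩
    rw [h2] at h3
    exact pos_of_mul_pos_left h3 (hr0 _)
  have hdot : 0 < l ⬝ᵥ r := Finset.sum_pos' (fun j _ => mul_nonneg (hl0 j) (hr0 j))
    ⟨0, Finset.mem_univ _, mul_pos ((hl 0).2 h0) ((hr 0).2 h0)⟩
  -- Pair both eigenvector equations with each other and cancel `l ⬝ᵥ r > 0`.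
  have htt : t' = t := by
    have h1 : l ⬝ᵥ (M *ᵥ r) = (l ᵥ* M) ⬝ᵥ r := dotProduct_mulVec _ _ _
    rw [hMr, hMl, dotProduct_smul, smul_dotProduct, smul_eq_mul, smul_eq_mul] at h1
    exact (mul_right_cancel₀ hdot.ne' h1).symm
  rw [htt] at hMl
  set c := (l ⬝ᵥ r)⁻¹ with hc
  have hc0 : 0 < c := inv_pos.2 hdot
  refine ⟨t, c • l, r, ht, fun i => ?_, hr, ?_, ?_⟩
  · rw [Pi.smul_apply, smul_eq_mul, mul_pos_iff_of_pos_left hc0, hl]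
  · rw [smul_vecMul, hMl, smul_comm]
  refine ⟨fun a i j => ?_, fun i => mul_nonneg hc0.le (hl0 i), hr0, mul_pos hc0 ((hl 0).2 h0),
    (hr 0).2 h0, ?_, ?_, ?_, fun i j hj => ?_, fun i => ?_, fun i hi => ?_⟩
  · rw [symbolMatrix, of_apply]
    split_ifs
    exacts [mul_nonneg (inv_nonneg.2 ht.le) (hnn i j), le_rfl]
  · rw [← add_mulVec, symbolMatrix_add, smul_mulVec, hMr, smul_smul, inv_mul_cancel₀ ht.ne', one_smul]
  · rw [← vecMul_add, symbolMatrix_add, smul_vecMul, vecMul_smul, hMl, smul_smul t⁻¹,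
      inv_mul_cancel₀ ht.ne', one_smul]
  · rw [smul_dotProduct, smul_eq_mul, hc, inv_mul_cancel₀ hdot.ne']
  · rw [symbolMatrix, of_apply, if_neg]
    fin_cases j <;> simp_all [code]
  · rw [symbolMatrix, of_apply, if_neg]
    simp [code]
  · obtain ⟨x, b, hb, rfl, hxb⟩ := exists_path hirr ((hr _).1 hi) h0
    rw [← hxb]
    refine transGen_of_lt (fun n => ?_) hb
    have := mul_pos (inv_pos.2 ht) (weightMatrix_pos_apply (φ := φ) x n)
    simp only [symbolMatrix, of_apply]
    rcases fin_two_eq (code (x.1 (n + 1))) with h | h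
    · left; rwa [if_pos h]
    · right; rwa [if_pos h]

end RelPressure

/-! ### Comparison of `g_n` with the hidden Markov weights. -/

namespace RelPressure
open Matrix

/-- The matrix product also sums over a hidden state before the first letter; `l M = t l` absorbs
it. This is why `n + 1` letters leave only `n` factors `t⁻¹`. -/
lemma weight_eq_sum {M : Matrix (Fin 3) (Fin 3) ℝ} {t : ℝ} {l : Fin 3 → ℝ} (ht : t ≠ 0)
    (hl : l ᵥ* M = t • l) (n : ℕ) (y : ℕ → Fin 2) (z : Fin 3 → ℝ) :
    l ⬝ᵥ (wordMatrix (symbolMatrix M t) (n + 1) y *ᵥ z) = t⁻¹ ^ n *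
      ∑ w : Fin (n + 1) → Fin 3, if ∀ i, code (w i) = y i then
        l (w 0) * (∏ i : Fin n, M (w i.castSucc) (w i.succ)) * z (w (Fin.last n)) else 0 := by
  induction n generalizing z with
  | zero =>
    rw [wordMatrix, wordMatrix, one_mul, pow_zero, one_mul, dotProduct_mulVec]
    have h1 : ∀ j, (l ᵥ* symbolMatrix M t (y 0)) j = if code j = y 0 then l j else 0 := by
      intro j
      have h2 := congrFun hl j
      change ∑ i, l i * M i j = t * l j at h2
      change ∑ i, l i * (if code j = y 0 then t⁻¹ * M i j else 0) = _
      split_ifs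
      · have : ∑ i, l i * (t⁻¹ * M i j) = t⁻¹ * ∑ i, l i * M i j := by
          rw [Finset.mul_sum]; exact Finset.sum_congr rfl fun i _ => by ring
        rw [this, h2]; field_simp
      · simp
    rw [dotProduct]
    refine Fintype.sum_equiv (Equiv.funUnique (Fin 1) (Fin 3)).symm _ _ fun j => ?_
    rw [h1]
    simp [Equiv.funUnique]
  | succ n ih =>
    rw [wordMatrix, ← mulVec_mulVec, ih, ← (Fin.snocEquiv fun _ : Fin (n + 1 + 1) => Fin 3).sum_comp,
      Fintype.sum_prod_type_right, pow_succ, mul_assoc]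
    congr 1
    rw [Finset.mul_sum]
    refine Finset.sum_congr rfl fun w _ => ?_
    have hsnoc : ∀ k, (Fin.snocEquiv fun _ : Fin (n + 1 + 1) => Fin 3) (k, w) =
        (Fin.snoc w k : Fin (n + 1 + 1) → Fin 3) := fun k => rfl
    simp only [hsnoc, Fin.forall_fin_succ' (n := n + 1), Fin.snoc_castSucc, Fin.snoc_last,
      Fin.val_castSucc, Fin.val_last, Fin.prod_univ_castSucc (n := n), Fin.succ_last,
      Fin.succ_castSucc]
    have h0 : ∀ k, (Fin.snoc w k : Fin (n + 1 + 1) → Fin 3) 0 = w 0 := fun k => by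
      rw [← Fin.castSucc_zero, Fin.snoc_castSucc]
    simp only [h0]
    by_cases hw : ∀ i : Fin (n + 1), code (w i) = y i
    · simp only [hw, implies_true, true_and]
      rw [mulVec_apply_eq_sum, Finset.mul_sum, Finset.mul_sum]
      refine Finset.sum_congr rfl fun k _ => ?_
      simp only [symbolMatrix, of_apply]
      split_ifs
      · ring
      · simp
    · simp [hw]

lemma exists_bounds {ι : Type*} [Fintype ι] (u : ι → ℝ) (hu : ∀ i, 0 ≤ u i) :
    ∃ c : ℝ, 1 ≤ c ∧ ∀ i, u i ≤ c ∧ (0 < u i → c⁻¹ ≤ u i) := by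
  have h1 : ∀ i, u i ≤ ∑ i, u i := fun i =>
    Finset.single_le_sum (fun i _ => hu i) (Finset.mem_univ i)
  have h2 : ∀ i, (u i)⁻¹ ≤ ∑ i, (u i)⁻¹ := fun i =>
    Finset.single_le_sum (f := fun i => (u i)⁻¹) (fun i _ => inv_nonneg.2 (hu i)) (Finset.mem_univ i)
  have h3 : 0 ≤ ∑ i, u i := Finset.sum_nonneg fun i _ => hu i
  have h4 : 0 ≤ ∑ i, (u i)⁻¹ := Finset.sum_nonneg fun i _ => inv_nonneg.2 (hu i)
  refine ⟨1 + ∑ i, u i + ∑ i, (u i)⁻¹, by linarith, fun i => ⟨by linarith [h1 i], fun hi => ?_⟩⟩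
  rw [inv_le_comm₀ (by linarith) hi]
  linarith [h2 i]

variable {A : Matrix (Fin 3) (Fin 3) ℕ} {B : Matrix (Fin 2) (Fin 2) ℕ} {φ : Fin 3 → Fin 3 → ℝ}
  {f : SFT A → ℝ}

lemma exp_birkhoffSum (hf : ∀ x : SFT A, f x = φ (x.1 0) (x.1 1)) (n : ℕ) (x : SFT A) :
    Real.exp (birkhoffSum (shift A) f (n + 1) x) =
      (∏ i : Fin n, weightMatrix A φ (x.1 i) (x.1 (i + 1))) *
        weightMatrix A φ (x.1 n) (x.1 (n + 1)) := by
  rw [birkhoffSum, Real.exp_sum, Finset.prod_range_succ,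
    Finset.prod_range fun i => Real.exp (f ((shift A)^[i] x))]
  simp only [hf, shift_iterate_val, add_zero, weightMatrix_apply]

open Classical in
/-- Every selection gives the same sum up to a multiplicative constant. -/
lemma sum_selection {y : ℕ → Fin 2} {n : ℕ} {E : Finset (SFT A)} (hE : IsSelection A code n y E)
    (u : (Fin n → Fin 3) → ℝ) :
    ∑ x ∈ E, u (fun i => x.1 i) = ∑ w with w ∈ fiberBlocks A code n y, u w := by
  refine Finset.sum_nbij (fun x i => x.1 i) (fun x hx => ?_) (fun x hx x' hx' hxx' => ?_)
    (fun w hw => ?_) fun _ _ => rfl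
  · exact Finset.mem_filter.2 ⟨Finset.mem_univ _, hE.1 x hx⟩
  · exact (hE.2 _ (hE.1 x hx)).unique ⟨hx, fun _ => rfl⟩ ⟨hx', fun i => (congrFun hxx' i).symm⟩
  · obtain ⟨x, ⟨hx, hxw⟩, -⟩ := hE.2 w (Finset.mem_filter.1 hw).2
    exact ⟨x, hx, funext hxw⟩

lemma exists_isSelection (n : ℕ) (y : ℕ → Fin 2) : ∃ E : Finset (SFT A), IsSelection A code n y E := by
  classical
  have h : ∀ w : fiberBlocks A code n y, ∃ x : SFT A, ∀ i : Fin n, x.1 i = w.1 i :=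
    fun w => mem_blocks_iff.1 w.2.1
  choose s hs using h
  refine ⟨Finset.univ.image s, fun x hx => ?_, fun w hw => ⟨s ⟨w, hw⟩,
    ⟨Finset.mem_image_of_mem _ (Finset.mem_univ _), hs ⟨w, hw⟩⟩, ?_⟩⟩
  · obtain ⟨w, -, rfl⟩ := Finset.mem_image.1 hx
    rw [show (fun i : Fin n => (s w).1 i) = w.1 from funext (hs w)]
    exact w.2
  · rintro x ⟨hx, hxw⟩
    obtain ⟨w', -, rfl⟩ := Finset.mem_image.1 hx
    congr 1
    exact Subtype.ext (funext fun i => (hs w' i).symm.trans (hxw i))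

/-- Both sides are compared with `Z`, the sum over the fiber of the products of internal transition
weights. The matrix weight adds the boundary factors `l` and `r` (constants `c₁`, `c₂`); the
Birkhoff sum adds one transition beyond the word (`c₃`); the powers of `t` differ by one (`c₄`). -/
lemma exists_relSeq_bounds (hf : ∀ x : SFT A, f x = φ (x.1 0) (x.1 1)) {t : ℝ} {l r : Fin 3 → ℝ}
    (ht : 0 < t) (hl : ∀ i, 0 < l i ↔ Appears A i) (hr : ∀ i, 0 < r i ↔ Appears A i)
    (hlM : l ᵥ* weightMatrix A φ = t • l)
    (hP : IsRenewalData (symbolMatrix (weightMatrix A φ) t) l r)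
    {π : SFT A → SFT B} (hπ : Function.Surjective π) (hcode : IsOneBlockCode π code) :
    (∀ n (y : SFT B), 0 < l ⬝ᵥ (wordMatrix (symbolMatrix (weightMatrix A φ) t) n y.1 *ᵥ r)) ∧
    ∃ c : ℝ, 1 ≤ c ∧ ∀ n, 1 ≤ n → ∀ y : SFT B,
      c⁻¹ * (t ^ n * (l ⬝ᵥ (wordMatrix (symbolMatrix (weightMatrix A φ) t) n y.1 *ᵥ r))) ≤
        relSeq code f n y ∧
      relSeq code f n y ≤
        c * (t ^ n * (l ⬝ᵥ (wordMatrix (symbolMatrix (weightMatrix A φ) t) n y.1 *ᵥ r))) := by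
  classical
  set M := weightMatrix A φ with hM
  obtain ⟨c₁, hc₁, h₁⟩ := exists_bounds l hP.left_nonneg
  obtain ⟨c₂, hc₂, h₂⟩ := exists_bounds r hP.right_nonneg
  obtain ⟨c₃, hc₃, h₃⟩ := exists_bounds (fun p : Fin 3 × Fin 3 => M p.1 p.2)
    fun p => weightMatrix_nonneg _ _
  obtain ⟨c₄, hc₄, h₄⟩ := exists_bounds (fun _ : Unit => t) fun _ => ht.le
  set wt : ∀ n : ℕ, (Fin (n + 1) → Fin 3) → ℝ := fun n w =>
    ∏ i : Fin n, M (w i.castSucc) (w i.succ) with hwt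
  have hwt0 : ∀ n w, 0 ≤ wt n w := fun n w => Finset.prod_nonneg fun i _ => weightMatrix_nonneg _ _
  set Z : ∀ n : ℕ, (ℕ → Fin 2) → ℝ := fun n y =>
    ∑ w with w ∈ fiberBlocks A code (n + 1) y, wt n w with hZ
  have happ : ∀ n y, ∀ w ∈ fiberBlocks A code (n + 1) y, ∀ i, Appears A (w i) := by
    intro n y w hw i
    obtain ⟨x, hx⟩ := mem_blocks_iff.1 hw.1
    rw [← hx i]
    exact appears_apply x i
  have hsum : ∀ n y, l ⬝ᵥ (wordMatrix (symbolMatrix M t) (n + 1) y *ᵥ r) = t⁻¹ ^ n *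
      ∑ w with w ∈ fiberBlocks A code (n + 1) y, l (w 0) * wt n w * r (w (Fin.last n)) := by
    intro n y
    rw [weight_eq_sum ht.ne' hlM, Finset.sum_filter]
    congr 1
    refine Finset.sum_congr rfl fun w _ => ?_
    by_cases hw : w ∈ fiberBlocks A code (n + 1) y
    · rw [if_pos hw, if_pos hw.2]
    · rw [if_neg hw, ite_eq_right_iff]
      intro hcw
      by_contra hne
      refine hw ⟨mem_blocks_of_prod_ne_zero (φ := φ) (fun i hi => hne ?_) ?_, hcw⟩
      · rw [Finset.prod_eq_zero (Finset.mem_univ i) hi, mul_zero, zero_mul]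
      · rw [← hr]
        refine (hP.right_nonneg _).lt_of_ne' fun h0 => hne ?_
        rw [h0, mul_zero]
  have hZle : ∀ n y, (c₁ * c₂)⁻¹ * Z n y ≤
        ∑ w with w ∈ fiberBlocks A code (n + 1) y, l (w 0) * wt n w * r (w (Fin.last n)) ∧
      ∑ w with w ∈ fiberBlocks A code (n + 1) y, l (w 0) * wt n w * r (w (Fin.last n)) ≤
        c₁ * c₂ * Z n y := by
    intro n y
    constructor
    · rw [hZ, Finset.mul_sum]
      refine Finset.sum_le_sum fun w hw => ?_
      have hw' := happ n y w (Finset.mem_filter.1 hw).2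
      have e1 := (h₁ (w 0)).2 ((hl _).2 (hw' _))
      have e2 := (h₂ (w (Fin.last n))).2 ((hr _).2 (hw' _))
      have e3 : c₁⁻¹ * c₂⁻¹ ≤ l (w 0) * r (w (Fin.last n)) :=
        mul_le_mul e1 e2 (by positivity) (hP.left_nonneg _)
      rw [mul_inv]
      nlinarith [mul_le_mul_of_nonneg_right e3 (hwt0 n w)]
    · rw [hZ, Finset.mul_sum]
      refine Finset.sum_le_sum fun w hw => ?_
      have e3 : l (w 0) * r (w (Fin.last n)) ≤ c₁ * c₂ :=
        mul_le_mul (h₁ _).1 (h₂ _).1 (hP.right_nonneg _) (by positivity)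
      nlinarith [mul_le_mul_of_nonneg_right e3 (hwt0 n w)]
  have hsel : ∀ n (y : ℕ → Fin 2) (E : Finset (SFT A)), IsSelection A code (n + 1) y E →
      c₃⁻¹ * Z n y ≤ ∑ x ∈ E, Real.exp (birkhoffSum (shift A) f (n + 1) x) ∧
      ∑ x ∈ E, Real.exp (birkhoffSum (shift A) f (n + 1) x) ≤ c₃ * Z n y := by
    intro n y E hE
    have hZE : Z n y = ∑ x ∈ E, wt n (fun i => x.1 i) := (sum_selection hE (wt n)).symm
    have hterm : ∀ x : SFT A, Real.exp (birkhoffSum (shift A) f (n + 1) x) =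
        wt n (fun i => x.1 i) * M (x.1 n) (x.1 (n + 1)) := exp_birkhoffSum hf n
    rw [hZE, Finset.mul_sum, Finset.mul_sum]
    refine ⟨Finset.sum_le_sum fun x _ => ?_, Finset.sum_le_sum fun x _ => ?_⟩
    · rw [hterm, mul_comm]
      exact mul_le_mul_of_nonneg_left
        ((h₃ (x.1 n, x.1 (n + 1))).2 (weightMatrix_pos_apply x n)) (hwt0 n fun i => x.1 i)
    · rw [hterm, mul_comm]
      exact mul_le_mul_of_nonneg_right (h₃ (x.1 n, x.1 (n + 1))).1 (hwt0 n fun i => x.1 i)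
  have hZpos : ∀ n (y : SFT B), 0 < Z n y.1 := by
    intro n y
    obtain ⟨x, rfl⟩ := hπ y
    refine Finset.sum_pos' (fun w _ => hwt0 n w) ⟨fun i => x.1 i, Finset.mem_filter.2
      ⟨Finset.mem_univ _, mem_blocks_iff.2 ⟨x, fun _ => rfl⟩, fun i => (hcode x i).symm⟩, ?_⟩
    exact Finset.prod_pos fun i _ => weightMatrix_pos_apply x i
  have hc12 : 0 < c₁ * c₂ := by positivity
  refine ⟨fun n y => ?_, c₁ * c₂ * c₃ * c₄, ?_, fun n hn y => ?_⟩
  · rcases n with _ | n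
    · rw [wordMatrix, one_mulVec, hP.dotProduct_eq]; exact one_pos
    · rw [hsum]
      exact mul_pos (by positivity) ((mul_pos (by positivity) (hZpos n y)).trans_le (hZle n y.1).1)
  · have := one_le_mul_of_one_le_of_one_le (one_le_mul_of_one_le_of_one_le
      (one_le_mul_of_one_le_of_one_le hc₁ hc₂) hc₃) hc₄
    exact this
  · obtain ⟨n, rfl⟩ := Nat.exists_eq_add_of_le' hn
    have ht1 := (h₄ ()).1
    have ht2 := (h₄ ()).2 ht
    set q := ∑ w with w ∈ fiberBlocks A code (n + 1) y.1, l (w 0) * wt n w * r (w (Fin.last n))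
    have hq : t ^ (n + 1) * (l ⬝ᵥ (wordMatrix (symbolMatrix M t) (n + 1) y.1 *ᵥ r)) = t * q := by
      rw [hsum, pow_succ, inv_pow]; field_simp; rfl
    have hZq1 : (c₁ * c₂)⁻¹ * q ≤ Z n y.1 := by
      rw [inv_mul_le_iff₀ hc12]; exact (hZle n y.1).2
    have hZq2 : Z n y.1 ≤ c₁ * c₂ * q := by
      rw [← inv_mul_le_iff₀ hc12]; exact (hZle n y.1).1
    have hq0 : 0 < q := (mul_pos (by positivity) (hZpos n y)).trans_le (hZle n y.1).1
    -- With the uniform bound `c₃ * Z n y`, the existence of a selection makes the `sSup` in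
    -- `relSeq` a genuine supremum.
    obtain ⟨E₀, hE₀⟩ := exists_isSelection (A := A) (n + 1) y.1
    have hc₃0 : 0 < c₃ := by positivity
    rw [hq]
    constructor
    · calc (c₁ * c₂ * c₃ * c₄)⁻¹ * (t * q) = c₃⁻¹ * ((c₁ * c₂)⁻¹ * q) * (c₄⁻¹ * t) := by
            rw [mul_inv, mul_inv]; ring
        _ ≤ c₃⁻¹ * ((c₁ * c₂)⁻¹ * q) * 1 := by
            refine mul_le_mul_of_nonneg_left ?_ (by positivity)
            rw [inv_mul_le_iff₀ (by positivity)]; linarith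
        _ ≤ c₃⁻¹ * Z n y.1 := by
            rw [mul_one]; exact mul_le_mul_of_nonneg_left hZq1 (by positivity)
        _ ≤ _ := (hsel n y.1 E₀ hE₀).1
        _ ≤ relSeq code f (n + 1) y := by
            refine le_csSup ⟨c₃ * Z n y.1, ?_⟩ ⟨E₀, hE₀, rfl⟩
            rintro _ ⟨E, hE, rfl⟩; exact (hsel n y.1 E hE).2
    · calc relSeq code f (n + 1) y ≤ c₃ * Z n y.1 := by
            rw [relSeq]
            refine csSup_le ⟨_, E₀, hE₀, rfl⟩ ?_
            rintro _ ⟨E, hE, rfl⟩; exact (hsel n y.1 E hE).2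
        _ ≤ c₃ * (c₁ * c₂ * q) := mul_le_mul_of_nonneg_left hZq2 hc₃0.le
        _ = c₁ * c₂ * c₃ * q * 1 := by ring
        _ ≤ c₁ * c₂ * c₃ * q * (c₄ * t) := by
            refine mul_le_mul_of_nonneg_left ?_ (by positivity)
            rwa [← inv_le_iff_one_le_mul₀' (by positivity)]
        _ = _ := by ring

end RelPressure

/-! ### The reference measure on `Y`. -/

namespace RelPressure
open Matrix

section Subshift

variable {B : Matrix (Fin 2) (Fin 2) ℕ}

lemma measurableSet_SFT (B : Matrix (Fin 2) (Fin 2) ℕ) : MeasurableSet (SFT B) := by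
  have : SFT B = ⋂ n, {y | B (y n) (y (n + 1)) = 1} := by
    ext y; simp [SFT]
  rw [this]
  refine MeasurableSet.iInter fun n => ?_
  have h : Measurable fun y : ℕ → Fin 2 => (y n, y (n + 1)) :=
    (measurable_pi_apply n).prodMk (measurable_pi_apply (n + 1))
  exact h (MeasurableSet.of_discrete (s := {p : Fin 2 × Fin 2 | B p.1 p.2 = 1}))

lemma measurable_shift (B : Matrix (Fin 2) (Fin 2) ℕ) : Measurable (shift B) :=
  (measurable_fullShift.comp measurable_subtype_coe).subtype_mk

lemma preimage_cylinder (y : SFT B) (n : ℕ) :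
    (Subtype.val : SFT B → ℕ → Fin 2) ⁻¹' PiNat.cylinder y.1 n = cylinder y n := rfl

lemma real_comap_cylinder {μ : Measure (ℕ → Fin 2)} (hμ : μ (SFT B)ᶜ = 0) (y : SFT B) (n : ℕ) :
    (μ.comap (Subtype.val : SFT B → ℕ → Fin 2)).real (cylinder y n) =
      μ.real (PiNat.cylinder y.1 n) := by
  rw [measureReal_def, measureReal_def,
    (MeasurableEmbedding.subtype_coe (measurableSet_SFT B)).comap_apply, ← preimage_cylinder,
    Subtype.image_preimage_coe, Set.inter_comm, measure_inter_conull hμ]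

lemma isInvariant_comap {μ : Measure (ℕ → Fin 2)} [IsProbabilityMeasure μ]
    (hinv : MeasurePreserving fullShift μ μ) (hμ : μ (SFT B)ᶜ = 0) :
    IsInvariant (μ.comap (Subtype.val : SFT B → ℕ → Fin 2)) := by
  have hemb := MeasurableEmbedding.subtype_coe (measurableSet_SFT B)
  refine ⟨⟨?_⟩, measurable_shift B, Measure.ext fun s hs => ?_⟩
  · rw [hemb.comap_apply, Set.image_univ, Subtype.range_val,
      ← Set.univ_inter (SFT B), measure_inter_conull hμ, measure_univ]
  · rw [Measure.map_apply (measurable_shift B) hs, hemb.comap_apply, hemb.comap_apply]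
    have h1 : (Subtype.val : SFT B → ℕ → Fin 2) '' (shift B ⁻¹' s) =
        fullShift ⁻¹' (Subtype.val '' s) ∩ SFT B := by
      ext z
      constructor
      · rintro ⟨y, hy, rfl⟩
        exact ⟨⟨shift B y, hy, rfl⟩, y.2⟩
      · rintro ⟨⟨y, hy, hyz⟩, hz⟩
        refine ⟨⟨z, hz⟩, ?_, rfl⟩
        rw [Set.mem_preimage, show shift B ⟨z, hz⟩ = y from Subtype.ext hyz.symm]
        exact hy
    rw [h1, measure_inter_conull hμ,
      hinv.measure_preimage (hemb.measurableSet_image.2 hs).nullMeasurableSet]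

/-- Both measures are viewed on all binary sequences. Cylinders missing `Y` have no mass under the
pushforward of `ν'`, so domination on `Y` extends to every cylinder. -/
lemma eq_comap_of_subexponential_le {μ : Measure (ℕ → Fin 2)} [IsProbabilityMeasure μ]
    (hM : ∀ n q, 1 ≤ q → ∀ y v : ℕ → Fin 2, v 0 = 0 →
      μ.real (PiNat.cylinder (splice n y v) (n + q)) * μ.real (PiNat.cylinder v 1) =
        μ.real (PiNat.cylinder (splice n y v) (n + 1)) * μ.real (PiNat.cylinder v q))
    (hpos : 0 < μ.real (PiNat.cylinder 0 1)) {K : ℕ} {θ : ℝ} (hK : 1 ≤ K) (hθ0 : 0 < θ) (hθ : θ < 1)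
    (hdecay : ∀ n, μ.real (PiNat.cylinder 1 (n * K)) ≤ θ ^ n)
    (hinv : MeasurePreserving fullShift μ μ) (hμ : μ (SFT B)ᶜ = 0)
    {ν' : Measure (SFT B)} (hν' : IsInvariant ν') {D : ℕ → ℝ} {N : ℕ} (hD0 : ∀ n, 0 < D n)
    (hD : Tendsto (fun n : ℕ => Real.log (D n) / n) atTop (𝓝 0))
    (hle : ∀ n, N ≤ n → ∀ y : SFT B, ν'.real (cylinder y n) ≤
      D n * (μ.comap (Subtype.val : SFT B → ℕ → Fin 2)).real (cylinder y n)) :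
    ν' = μ.comap Subtype.val := by
  have hemb := MeasurableEmbedding.subtype_coe (measurableSet_SFT B)
  have := hν'.1
  set μ' := ν'.map (Subtype.val : SFT B → ℕ → Fin 2) with hμ'
  have : IsProbabilityMeasure μ' :=
    Measure.isProbabilityMeasure_map measurable_subtype_coe.aemeasurable
  have hinv' : MeasurePreserving fullShift μ' μ' := by
    refine ⟨measurable_fullShift, ?_⟩
    rw [hμ', Measure.map_map measurable_fullShift measurable_subtype_coe,
      show fullShift ∘ (Subtype.val : SFT B → ℕ → Fin 2) = Subtype.val ∘ shift B from rfl,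
      ← Measure.map_map measurable_subtype_coe (measurable_shift B), hν'.2.map_eq]
  have hle' : ∀ n, N ≤ n → ∀ y,
      μ'.real (PiNat.cylinder y n) ≤ D n * μ.real (PiNat.cylinder y n) := by
    intro n hn y
    rw [hμ', map_measureReal_apply measurable_subtype_coe (measurableSet_piNat_cylinder y n)]
    rcases Set.eq_empty_or_nonempty ((Subtype.val : SFT B → ℕ → Fin 2) ⁻¹' PiNat.cylinder y n)
      with h | ⟨z, hz⟩
    · rw [h, measureReal_empty]
      exact mul_nonneg (hD0 n).le measureReal_nonneg
    · rw [← PiNat.mem_cylinder_iff_eq.1 hz, preimage_cylinder, ← real_comap_cylinder hμ]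
      exact hle n hn z
  have heq := eq_of_subexponential_le hK hθ0 hθ hM hpos hdecay hinv hinv' hD0 hD hle'
  rw [← heq, hμ', hemb.comap_map]

end Subshift

/-- The properties of the hidden Markov measure `ν` of the weights on `Y` that determine the
thermodynamic formalism of `g`. -/
structure IsReference {B : Matrix (Fin 2) (Fin 2) ℕ} (g : ℕ → SFT B → ℝ) (ν : Measure (SFT B))
    (t c : ℝ) : Prop where
  inv : IsInvariant ν
  one_le : 1 ≤ c
  pos_t : 0 < t
  pos : ∀ n y, 0 < ν.real (cylinder y n)
  lower : ∀ n, 1 ≤ n → ∀ y, c⁻¹ * (t ^ n * ν.real (cylinder y n)) ≤ g n y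
  upper : ∀ n, 1 ≤ n → ∀ y, g n y ≤ c * (t ^ n * ν.real (cylinder y n))
  renewal : ∀ (n q : ℕ) (y : SFT B), 1 ≤ q → y.1 n = 0 →
    ν.real (cylinder y (n + q)) * ν.real (cylinder ((shift B)^[n] y) 1) =
      ν.real (cylinder y (n + 1)) * ν.real (cylinder ((shift B)^[n] y) q)
  unique : ∀ (ν' : Measure (SFT B)) (D : ℕ → ℝ) (N : ℕ), IsInvariant ν' → (∀ n, 0 < D n) →
    Tendsto (fun n : ℕ => Real.log (D n) / n) atTop (𝓝 0) →
    (∀ n, N ≤ n → ∀ y, ν'.real (cylinder y n) ≤ D n * ν.real (cylinder y n)) → ν' = ν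

variable {A : Matrix (Fin 3) (Fin 3) ℕ} {B : Matrix (Fin 2) (Fin 2) ℕ} {φ : Fin 3 → Fin 3 → ℝ}
  {f : SFT A → ℝ}

/-- A nonzero entry would give a point of `X` whose image under `π` contains the forbidden word
`ab`. -/
lemma symbolMatrix_mul_eq_zero {π : SFT A → SFT B} (hcode : IsOneBlockCode π code) (t : ℝ)
    {a b : Fin 2} (hab : B a b ≠ 1) :
    symbolMatrix (weightMatrix A φ) t a * symbolMatrix (weightMatrix A φ) t b = 0 := by
  ext i j
  rw [mul_apply, Matrix.zero_apply]
  refine Finset.sum_eq_zero fun k _ => ?_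
  simp only [symbolMatrix, of_apply]
  by_contra hne
  have h1 := left_ne_zero_of_mul hne
  have h2 := right_ne_zero_of_mul hne
  have hk : code k = a := by by_contra h; exact h1 (if_neg h)
  have hj : code j = b := by by_contra h; exact h2 (if_neg h)
  rw [if_pos hj] at h2
  obtain ⟨x, rfl, rfl⟩ := exists_of_weightMatrix_ne_zero (right_ne_zero_of_mul h2)
  have := (π x).2 0
  rw [hcode, hcode, hk, zero_add, hj] at this
  exact hab this

/-- The hidden Markov measure lives on the subshift. -/
lemma measure_compl_SFT {π : SFT A → SFT B} (hcode : IsOneBlockCode π code) {t : ℝ}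
    {l r : Fin 3 → ℝ} {μ : Measure (ℕ → Fin 2)} [IsProbabilityMeasure μ]
    (hinv : MeasurePreserving fullShift μ μ)
    (hcyl : ∀ n y, μ.real (PiNat.cylinder y n) =
      l ⬝ᵥ (wordMatrix (symbolMatrix (weightMatrix A φ) t) n y *ᵥ r)) : μ (SFT B)ᶜ = 0 := by
  set s : Set (ℕ → Fin 2) := ⋃ p ∈ {p : Fin 2 × Fin 2 | B p.1 p.2 ≠ 1},
    PiNat.cylinder (consSeq p.1 fun _ => p.2) 2 with hs
  have hsm : MeasurableSet s :=
    MeasurableSet.biUnion (Set.to_countable _) fun p _ => measurableSet_piNat_cylinder _ _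
  have hs0 : μ s = 0 := by
    refine (measure_biUnion_null_iff (Set.to_countable _)).2 fun p hp => ?_
    rw [← measureReal_eq_zero_iff, hcyl, wordMatrix, wordMatrix, wordMatrix, one_mul]
    have h1 : (consSeq p.1 fun _ => p.2) 0 = p.1 := rfl
    have h2 : (consSeq p.1 fun _ => p.2) (0 + 1) = p.2 := rfl
    rw [h1, h2, symbolMatrix_mul_eq_zero hcode t hp, zero_mulVec, dotProduct_zero]
  have hsub : (SFT B)ᶜ ⊆ ⋃ n, fullShift^[n] ⁻¹' s := by
    intro y hy
    obtain ⟨n, hn⟩ := not_forall.1 hy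
    refine Set.mem_iUnion.2 ⟨n, Set.mem_preimage.2 (Set.mem_biUnion
      (x := (y n, y (n + 1))) hn fun i hi => ?_)⟩
    rw [fullShift_iterate]
    interval_cases i <;> rfl
  refine measure_mono_null hsub (measure_iUnion_null fun n => ?_)
  rw [(hinv.iterate n).measure_preimage hsm.nullMeasurableSet, hs0]

/-- In either case the only word of length two that `Y` can forbid is `00`. -/
lemma mem_SFT_of_sparse (hB : B = !![1, 1; 1, 1] ∨ B = !![0, 1; 1, 1]) {y : ℕ → Fin 2}
    (hy : ∀ n, y n = 1 ∨ y (n + 1) = 1) : y ∈ SFT B := by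
  intro n
  rcases hB with rfl | rfl <;> rcases hy n with h | h <;> rw [h] <;>
    rcases fin_two_eq (y n) with h' | h' <;> rcases fin_two_eq (y (n + 1)) with h'' | h'' <;>
    simp_all

theorem exists_isReference (hirr : IsIrreducible (SFT A))
    (hB : B = !![1, 1; 1, 1] ∨ B = !![0, 1; 1, 1]) {π : SFT A → SFT B}
    (hπ : Function.Surjective π) (hcode : IsOneBlockCode π code)
    (hf : ∀ x : SFT A, f x = φ (x.1 0) (x.1 1)) :
    ∃ (ν : Measure (SFT B)) (t c : ℝ) (l r : Fin 3 → ℝ), IsReference (relSeq code f) ν t c ∧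
      l ᵥ* weightMatrix A φ = t • l ∧ IsRenewalData (symbolMatrix (weightMatrix A φ) t) l r ∧
      ∀ n (y : SFT B), ν.real (cylinder y n) =
        l ⬝ᵥ (wordMatrix (symbolMatrix (weightMatrix A φ) t) n y.1 *ᵥ r) := by
  have h0 : Appears A 0 := by
    obtain ⟨x, hx⟩ := hπ ⟨consSeq 0 fun _ => 1, mem_SFT_of_sparse hB fun n => Or.inr rfl⟩
    have := hcode x 0
    rw [hx] at this
    refine ⟨x, ?_⟩
    have h1 : code (x.1 0) = 0 := this.symm
    revert h1
    generalize x.1 0 = a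
    fin_cases a <;> simp [code]
  obtain ⟨t, l, r, ht, hl, hr, hlM, hP⟩ := exists_isRenewalData φ hirr h0
  obtain ⟨μ, hμ, hinv, hcyl⟩ := hP.exists_measure
  obtain ⟨K, θ, hK, hθ0, hθ1, hdecay⟩ := hP.exists_decay
  obtain ⟨hpos, c, hc, hbounds⟩ := exists_relSeq_bounds hf ht hl hr hlM hP hπ hcode
  have hnull := measure_compl_SFT (B := B) hcode hinv hcyl
  have hν : ∀ n (y : SFT B), (μ.comap Subtype.val).real (cylinder y n) =
      l ⬝ᵥ (wordMatrix (symbolMatrix (weightMatrix A φ) t) n y.1 *ᵥ r) := fun n y => by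
    rw [real_comap_cylinder hnull, hcyl]
  have hM : ∀ n q, 1 ≤ q → ∀ y v : ℕ → Fin 2, v 0 = 0 →
      μ.real (PiNat.cylinder (splice n y v) (n + q)) * μ.real (PiNat.cylinder v 1) =
        μ.real (PiNat.cylinder (splice n y v) (n + 1)) * μ.real (PiNat.cylinder v q) := by
    intro n q hq y v hv
    simp only [hcyl]
    exact hP.renewal n q hq y v hv
  have hpos1 : 0 < μ.real (PiNat.cylinder 0 1) := by
    have h1 := hpos 1 (⟨consSeq 0 fun _ => 1, mem_SFT_of_sparse hB fun n => Or.inr rfl⟩ : SFT B)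
    rw [hcyl]
    rwa [wordMatrix_congr (z := 0)] at h1
    intro i hi
    obtain rfl : i = 0 := by omega
    rfl
  refine ⟨μ.comap Subtype.val, t, c, l, r, ⟨isInvariant_comap hinv hnull, hc, ht, fun n y => ?_,
    fun n hn y => ?_, fun n hn y => ?_, fun n q y hq hy => ?_, fun ν' D N hν' hD0 hD hle => ?_⟩,
    hlM, hP, hν⟩
  · rw [hν]; exact hpos n y
  · rw [hν]; exact (hbounds n hn y).1
  · rw [hν]; exact (hbounds n hn y).2
  · have hs : splice n y.1 ((shift B)^[n] y).1 = y.1 := funext fun i => by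
      rw [splice]
      split_ifs with hi
      · rfl
      · rw [shift_iterate_val, show n + (i - n) = i by omega]
    have h1 := hP.renewal n q hq y.1 ((shift B)^[n] y).1 (by rw [shift_iterate_val]; exact hy)
    rw [hs] at h1
    simpa only [hν] using h1
  · exact eq_comap_of_subexponential_le hM hpos1 hK hθ0 hθ1 (fun n => by rw [hcyl]; exact hdecay n)
      hinv hnull hν' hD0 hD hle

end RelPressure

/-! ### Gibbs bounds in logarithmic form and uniqueness. -/

namespace RelPressure

lemma abs_log_sub_sub_le_iff {a b d K : ℝ} (ha : 0 < a) (hb : 0 < b) (hd : 0 < d) :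
    |Real.log a - Real.log b - Real.log d| ≤ K ↔
      a ≤ Real.exp K * b * d ∧ Real.exp (-K) * b * d ≤ a := by
  rw [← Real.log_le_log_iff ha (by positivity), ← Real.log_le_log_iff (by positivity) ha,
    Real.log_mul (by positivity) hd.ne', Real.log_mul (by positivity) hb.ne', Real.log_exp,
    Real.log_mul (by positivity) hd.ne', Real.log_mul (by positivity) hb.ne', Real.log_exp, abs_le]
  constructor
  · rintro ⟨h1, h2⟩; constructor <;> linarith
  · rintro ⟨h1, h2⟩; constructor <;> linarith

variable {B : Matrix (Fin 2) (Fin 2) ℕ} {ν ν' : Measure (SFT B)} {g : ℕ → SFT B → ℝ}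
  {g' : SFT B → ℝ} {P t c : ℝ} {C : ℕ → ℝ}

lemma GibbsBounds.real_pos (h : GibbsBounds ν g' P C) {n : ℕ} (hn : 1 ≤ n) (hC : 0 < C n)
    (y : SFT B) : 0 < ν.real (cylinder y n) := by
  have h1 := (h n hn y).1
  by_contra h0
  have h2 : ν.real (cylinder y n) = 0 := le_antisymm (not_lt.1 h0) measureReal_nonneg
  rw [h2, zero_div] at h1
  exact absurd h1 (not_le.2 (by positivity))

lemma log_gibbsRatio {x s : ℝ} (hx : 0 < x) :
    Real.log (x / (Real.exp (-s) * Real.exp P)) = Real.log x + s - P := by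
  rw [← Real.exp_add, Real.log_div hx.ne' (Real.exp_pos _).ne', Real.log_exp]; ring

lemma GibbsBounds.abs_log_le (h : GibbsBounds ν g' P C) {n : ℕ} (hn : 1 ≤ n) (hC : 0 < C n)
    (y : SFT B) :
    |Real.log (ν.real (cylinder y n)) + n * P - birkhoffSum (shift B) g' n y| ≤ Real.log (C n) := by
  have hpos := h.real_pos hn hC y
  obtain ⟨h1, h2⟩ := h n hn y
  rw [← log_gibbsRatio hpos, abs_le, ← Real.log_inv, ← one_div]
  exact ⟨Real.log_le_log (by positivity) h1, Real.log_le_log (by positivity) h2⟩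

lemma gibbsBounds_of_abs_log_le {L : ℕ → ℝ} (hpos : ∀ n y, 0 < ν.real (cylinder y n))
    (h : ∀ n, 1 ≤ n → ∀ y,
      |Real.log (ν.real (cylinder y n)) + n * P - birkhoffSum (shift B) g' n y| ≤ L n) :
    GibbsBounds ν g' P fun n => Real.exp (L n) := by
  intro n hn y
  have h1 := h n hn y
  rw [← log_gibbsRatio (hpos n y), abs_le] at h1
  have hp : 0 < ν.real (cylinder y n) /
      (Real.exp (-(n * P)) * Real.exp (birkhoffSum (shift B) g' n y)) := by
    have := hpos n y; positivity
  rw [one_div, ← Real.exp_neg]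
  exact ⟨(Real.le_log_iff_exp_le hp).1 h1.1, (Real.log_le_iff_le_exp hp).1 h1.2⟩

/-- Sum over the cylinders of length `n`, which partition `Y`, and use that both total masses are 1.
-/
lemma le_one_of_forall_mul_le (hν : IsInvariant ν) (hν' : IsInvariant ν') {a : ℝ} (n : ℕ)
    (h : ∀ y, a * ν.real (cylinder y n) ≤ ν'.real (cylinder y n)) : a ≤ 1 := by
  classical
  have := hν.1
  have := hν'.1
  set q : SFT B → (Fin n → Fin 2) := fun y => prefixWord n y.1 with hq
  have hqm : Measurable q := (measurable_prefixWord n).comp measurable_subtype_coe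
  have hsum : ∀ (ρ : Measure (SFT B)) [IsProbabilityMeasure ρ], ∑ w, ρ.real (q ⁻¹' {w}) = 1 := by
    intro ρ _
    rw [sum_measureReal_preimage_singleton _ fun w _ => hqm (measurableSet_singleton w)]
    simp
  calc a = ∑ w, a * ν.real (q ⁻¹' {w}) := by rw [← Finset.mul_sum, hsum, mul_one]
    _ ≤ ∑ w, ν'.real (q ⁻¹' {w}) := Finset.sum_le_sum fun w _ => by
        rcases Set.eq_empty_or_nonempty (q ⁻¹' {w}) with h0 | ⟨y, rfl⟩
        · simp [h0]
        · have : q ⁻¹' {q y} = cylinder y n := by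
            rw [← preimage_cylinder, cylinder_eq_preimage_prefixWord]; rfl
          rw [this]
          exact h y
    _ = 1 := hsum ν'

namespace IsReference

variable (h : IsReference g ν t c)
include h

lemma g_pos {n : ℕ} (hn : 1 ≤ n) (y : SFT B) : 0 < g n y := by
  have h1 := h.pos n y
  have h2 := h.pos_t
  have h3 := h.one_le
  exact (by positivity : 0 < c⁻¹ * (t ^ n * ν.real (cylinder y n))).trans_le (h.lower n hn y)

lemma abs_log_g_sub_le {n : ℕ} (hn : 1 ≤ n) (y : SFT B) :
    |Real.log (g n y) - (n * Real.log t + Real.log (ν.real (cylinder y n)))| ≤ Real.log c := by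
  have h1 := h.pos n y
  have h2 := h.pos_t
  have h3 : 0 < c := by have := h.one_le; linarith
  have h4 : n * Real.log t + Real.log (ν.real (cylinder y n)) =
      Real.log (t ^ n * ν.real (cylinder y n)) := by
    rw [Real.log_mul (by positivity) h1.ne', Real.log_pow]
  have h5 := Real.log_le_log (by positivity) (h.lower n hn y)
  have h6 := Real.log_le_log (h.g_pos hn y) (h.upper n hn y)
  rw [Real.log_mul (by positivity) (by positivity), Real.log_inv] at h5
  rw [Real.log_mul (by positivity) (by positivity)] at h6
  rw [h4, abs_le]
  constructor <;> linarith

omit h in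
lemma exists_abs_le_of_approximates (hg : Approximates g g') :
    ∃ (e : ℕ → ℝ) (N : ℕ), Tendsto (fun n : ℕ => e n / n) atTop (𝓝 0) ∧
      ∀ n, N ≤ n → ∀ y, |Real.log (g n y) - birkhoffSum (shift B) g' n y| ≤ e n := by
  set s : ℕ → ENNReal := fun n => ⨆ y : SFT B, ‖Real.log (g n y) - birkhoffSum (shift B) g' n y‖ₑ
    with hs
  have hg' : Tendsto (fun n : ℕ => s n / n) atTop (𝓝 0) := hg
  -- From here on the supremum is finite. For smaller `n` it may be `⊤`, which `toReal` would turn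
  -- into 0, so the bound is claimed only from `N` on.
  obtain ⟨N, hN⟩ := eventually_atTop.1 (hg'.eventually_lt_const (by simp : (0 : ENNReal) < 1))
  refine ⟨fun n => (s n).toReal, max N 1, ?_, fun n hn y => ?_⟩
  · have := (ENNReal.tendsto_toReal ENNReal.zero_ne_top).comp hg'
    simpa [Function.comp_def, ENNReal.toReal_div] using this
  · have h1 := hN n ((le_max_left _ _).trans hn)
    have h2 : s n ≠ ⊤ := by
      intro htop
      rw [htop, ENNReal.top_div_of_ne_top (ENNReal.natCast_ne_top n)] at h1
      exact absurd h1 (by simp)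
    have h3 : ‖Real.log (g n y) - birkhoffSum (shift B) g' n y‖ₑ ≤ s n :=
      le_iSup (fun y : SFT B => ‖Real.log (g n y) - birkhoffSum (shift B) g' n y‖ₑ) y
    have h4 := ENNReal.toReal_mono h2 h3
    rwa [toReal_enorm, Real.norm_eq_abs] at h4

/-- The reference measure is the only invariant measure that can be weak Gibbs for a function
approximating the sequence. -/
theorem eq_of_isWeakGibbs (hg : Approximates g g') (hν' : IsInvariant ν')
    (hw : IsWeakGibbs ν' g') : ν' = ν := by
  obtain ⟨P, C, hC, hClim, hb⟩ := hw
  obtain ⟨e, N, helim, he⟩ := exists_abs_le_of_approximates hg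
  set u : ℕ → ℝ := fun n => Real.log (C n) + e n + Real.log c with hu
  have hulim : Tendsto (fun n : ℕ => u n / n) atTop (𝓝 0) := by
    have := (hClim.add helim).add (tendsto_const_div_atTop_nhds_zero_nat (Real.log c))
    simp only [add_zero] at this
    refine this.congr fun n => ?_
    simp only [hu, add_div]
  have hlog : ∀ n, max N 1 ≤ n → ∀ y, |Real.log (ν'.real (cylinder y n)) + n * P -
      (n * Real.log t + Real.log (ν.real (cylinder y n)))| ≤ u n ∧ 0 < ν'.real (cylinder y n) := by
    intro n hn y
    have hn1 := (le_max_right _ _).trans hn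
    have h1 := hb.abs_log_le hn1 (hC n hn1) y
    have h2 := he n ((le_max_left _ _).trans hn) y
    have h3 := h.abs_log_g_sub_le hn1 y
    refine ⟨?_, hb.real_pos hn1 (hC n hn1) y⟩
    simp only [hu]
    rw [abs_le] at *
    constructor <;> linarith [h1.1, h1.2, h2.1, h2.2, h3.1, h3.2]
  -- Were `P` smaller than `log t`, the cylinder masses of `ν'` would exceed those of `ν` by an
  -- exponential factor, against total mass 1. This one inequality is enough, as the uniqueness
  -- criterion needs only domination of `ν'` by `ν`.
  have hP : Real.log t ≤ P := by
    have hle : ∀ n, max N 1 ≤ n → Real.log t - P - u n / n ≤ 0 := by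
      intro n hn
      have hn0 : (0 : ℝ) < n := by exact_mod_cast (le_max_right _ _).trans hn
      have h1 : Real.exp (n * (Real.log t - P) - u n) ≤ 1 := by
        refine le_one_of_forall_mul_le h.inv hν' n fun y => ?_
        obtain ⟨h2, h3⟩ := hlog n hn y
        have h4 := h.pos n y
        rw [← Real.log_le_log_iff (by positivity) h3, Real.log_mul (Real.exp_pos _).ne' h4.ne',
          Real.log_exp]
        linarith [(abs_le.1 h2).1]
      rw [Real.exp_le_one_iff] at h1
      have h5 : Real.log t - P - u n / n = (n * (Real.log t - P) - u n) / n := by field_simp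
      rw [h5]
      exact div_nonpos_of_nonpos_of_nonneg h1 hn0.le
    have hlim := hulim.const_sub (Real.log t - P)
    have := le_of_tendsto hlim (eventually_atTop.2 ⟨_, hle⟩)
    linarith
  refine h.unique ν' (fun n => Real.exp (u n)) (max N 1) hν' (fun n => Real.exp_pos _)
    (by simpa only [Real.log_exp] using hulim) fun n hn y => ?_
  obtain ⟨h2, h3⟩ := hlog n hn y
  have h4 := h.pos n y
  rw [← Real.log_le_log_iff h3 (by positivity), Real.log_mul (Real.exp_pos _).ne' h4.ne', Real.log_exp]
  have : (n : ℝ) * Real.log t ≤ n * P := mul_le_mul_of_nonneg_left hP n.cast_nonneg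
  linarith [(abs_le.1 h2).2]

omit h in
lemma isWeakGibbs_of_isGibbs (hw : IsGibbs ν' g') : IsWeakGibbs ν' g' := by
  obtain ⟨P, C, hC, hb⟩ := hw
  exact ⟨P, fun _ => C, fun _ _ => hC, tendsto_const_div_atTop_nhds_zero_nat _, hb⟩

/-- Once `ν'` is known to be the reference measure, its Gibbs bounds place `log g_n` within a
constant of `n (log t - P) + S_n g'`, which is exactly additive along orbits. The three terms in
almost additivity account for the factor 3. -/
theorem almostAdditive_of_isGibbs (hg : Approximates g g') (hν' : IsInvariant ν')
    (hw : IsGibbs ν' g') : AlmostAdditive g := by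
  obtain rfl := h.eq_of_isWeakGibbs hg hν' (isWeakGibbs_of_isGibbs hw)
  obtain ⟨P, C, hC, hb⟩ := hw
  have key : ∀ n, 1 ≤ n → ∀ y, |Real.log (g n y) - (n * Real.log t - n * P +
      birkhoffSum (shift B) g' n y)| ≤ Real.log c + Real.log C := by
    intro n hn y
    have h1 := h.abs_log_g_sub_le hn y
    have h2 := hb.abs_log_le hn hC y
    rw [abs_le] at *
    constructor <;> linarith [h1.1, h1.2, h2.1, h2.2]
  refine ⟨|3 * (Real.log c + Real.log C)| + 1, by positivity, fun n m hn hm y => ?_⟩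
  rw [← abs_log_sub_sub_le_iff (h.g_pos (by omega) _) (h.g_pos hn _) (h.g_pos hm _)]
  have h1 := key (n + m) (by omega) y
  have h2 := key n hn y
  have h3 := key m hm ((shift B)^[n] y)
  rw [birkhoffSum_add] at h1
  push_cast at h1
  have h4 := le_abs_self (3 * (Real.log c + Real.log C))
  rw [abs_le] at h1 h2 h3 ⊢
  constructor <;> linarith [h1.1, h1.2, h2.1, h2.2, h3.1, h3.2]

variable {E : ℕ → ℝ} (hE : Tendsto (fun n : ℕ => E n / n) atTop (𝓝 0))
  (hgE : ∀ n, 1 ≤ n → ∀ y, |Real.log (g n y) - birkhoffSum (shift B) g' n y| ≤ E n)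
include hE hgE

omit h in
lemma approximates_of_abs_le : Approximates g g' := by
  have h1 : Tendsto (fun n : ℕ => ENNReal.ofReal (E n / n)) atTop (𝓝 0) := by
    simpa using ENNReal.tendsto_ofReal hE
  refine tendsto_of_tendsto_of_tendsto_of_le_of_le' tendsto_const_nhds h1
    (Eventually.of_forall fun _ => zero_le) (eventually_atTop.2 ⟨1, fun n hn => ?_⟩)
  rw [ENNReal.ofReal_div_of_pos (by exact_mod_cast hn), ENNReal.ofReal_natCast]
  refine ENNReal.div_le_div_right (iSup_le fun y => ?_) _
  rw [← ofReal_norm, Real.norm_eq_abs]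
  exact ENNReal.ofReal_le_ofReal (hgE n hn y)

omit hE in
lemma gibbsBounds : GibbsBounds ν g' (Real.log t) fun n => Real.exp (E n + Real.log c) := by
  refine gibbsBounds_of_abs_log_le h.pos fun n hn y => ?_
  have h1 := h.abs_log_g_sub_le hn y
  have h2 := hgE n hn y
  rw [abs_le] at *
  constructor <;> linarith [h1.1, h1.2, h2.1, h2.2]

theorem existsUnique_isWeakGibbs : Approximates g g' ∧
    ∃! ν : Measure (SFT B), IsInvariant ν ∧ IsWeakGibbs ν g' := by
  have ha := approximates_of_abs_le hE hgE
  refine ⟨ha, ν, ⟨h.inv, Real.log t, _, fun _ _ => Real.exp_pos _, ?_, h.gibbsBounds hgE⟩,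
    fun ν' hν' => h.eq_of_isWeakGibbs ha hν'.1 hν'.2⟩
  have := hE.add (tendsto_const_div_atTop_nhds_zero_nat (Real.log c))
  simp only [add_zero] at this
  refine this.congr fun n => ?_
  rw [Real.log_exp, add_div]

omit hE hgE in
theorem existsUnique_isGibbs {E : ℝ}
    (hgE : ∀ n, 1 ≤ n → ∀ y, |Real.log (g n y) - birkhoffSum (shift B) g' n y| ≤ E) :
    Approximates g g' ∧ ∃! ν : Measure (SFT B), IsInvariant ν ∧ IsGibbs ν g' := by
  have ha := approximates_of_abs_le (E := fun _ => E) (tendsto_const_div_atTop_nhds_zero_nat E) hgE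
  exact ⟨ha, ν, ⟨h.inv, Real.log t, _, Real.exp_pos _, h.gibbsBounds (E := fun _ => E) hgE⟩,
    fun ν' hν' => h.eq_of_isWeakGibbs ha hν'.1 (isWeakGibbs_of_isGibbs hν'.2)⟩

end IsReference

end RelPressure

/-! ### The potential and its Birkhoff sums. -/

namespace RelPressure

variable {B : Matrix (Fin 2) (Fin 2) ℕ} {ν : Measure (SFT B)} {g : ℕ → SFT B → ℝ} {t c : ℝ}

lemma cylinder_congr {y z : SFT B} {n : ℕ} (h : ∀ i < n, y.1 i = z.1 i) :
    cylinder y n = cylinder z n := by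
  ext x
  simp only [cylinder, Set.mem_ofPred_eq]
  exact forall₂_congr fun i hi => by rw [h i hi]

lemma isOpen_cylinder (y : SFT B) (n : ℕ) : IsOpen (cylinder y n) := by
  rw [← preimage_cylinder]
  exact (PiNat.isOpen_cylinder _ y.1 n).preimage continuous_subtype_val

lemma cylinder_mem_nhds (y : SFT B) (n : ℕ) : cylinder y n ∈ 𝓝 y :=
  (isOpen_cylinder y n).mem_nhds fun _ _ => rfl

open Classical in
/-- The potential `log (t ν[y_0 ⋯ y_m] / ν[y_1 ⋯ y_m])`, where `m ≥ 1` is the first positive time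
with `y_m = 0`; if there is none, the value is `β` or `α` according to `y_0`. -/
noncomputable def potential (ν : Measure (SFT B)) (t α β : ℝ) (y : SFT B) : ℝ :=
  if h : ∃ m, 1 ≤ m ∧ y.1 m = 0 then
    Real.log t + Real.log (ν.real (cylinder y (Nat.find h + 1))) -
      Real.log (ν.real (cylinder (shift B y) (Nat.find h)))
  else if y.1 0 = 0 then β else α

lemma potential_of_forall_ne {α β : ℝ} {y : SFT B} (hy : ∀ m, 1 ≤ m → y.1 m ≠ 0) :
    potential ν t α β y = if y.1 0 = 0 then β else α := by
  classical
  rw [potential, dif_neg]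
  rintro ⟨m, h1, h2⟩
  exact hy m h1 h2

namespace IsReference

variable (h : IsReference g ν t c) {α β : ℝ}
include h

/-- Renewal at the first zero `m` splits both cylinders ending at `R`; the common factor `ν[y_m ⋯
y_R] / ν[0]` cancels. Any positive time of a zero may therefore replace the first one. -/
lemma potential_eq {y : SFT B} {R : ℕ} (hR : 1 ≤ R) (hy : y.1 R = 0) :
    potential ν t α β y = Real.log t + Real.log (ν.real (cylinder y (R + 1))) -
      Real.log (ν.real (cylinder (shift B y) R)) := by
  classical
  have hex : ∃ m, 1 ≤ m ∧ y.1 m = 0 := ⟨R, hR, hy⟩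
  rw [potential, dif_pos hex]
  obtain ⟨hm1, hm⟩ := Nat.find_spec hex
  have hmR : Nat.find hex ≤ R := Nat.find_min' hex ⟨hR, hy⟩
  generalize Nat.find hex = m at hm1 hm hmR
  have h1 := h.renewal m (R + 1 - m) y (by omega) hm
  have h2 := h.renewal (m - 1) (R + 1 - m) (shift B y) (by omega) (by
    change y.1 (m - 1 + 1) = 0
    rwa [Nat.sub_add_cancel hm1])
  have h3 : (shift B)^[m - 1] (shift B y) = (shift B)^[m] y := by
    rw [← Function.iterate_succ_apply, Nat.succ_eq_add_one, Nat.sub_add_cancel hm1]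
  rw [h3, show m - 1 + (R + 1 - m) = R by omega, Nat.sub_add_cancel hm1] at h2
  rw [show m + (R + 1 - m) = R + 1 by omega] at h1
  have h1' := congrArg Real.log h1
  have h2' := congrArg Real.log h2
  simp only [Real.log_mul (h.pos _ _).ne' (h.pos _ _).ne'] at h1' h2'
  linarith

/-- Using the same zero at `R` for all shifts of `y`, the sum telescopes. -/
lemma birkhoffSum_potential {y : SFT B} {R n : ℕ} (hy : y.1 R = 0) (hn : n ≤ R) :
    birkhoffSum (shift B) (potential ν t α β) n y = n * Real.log t +
      Real.log (ν.real (cylinder y (R + 1))) -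
        Real.log (ν.real (cylinder ((shift B)^[n] y) (R + 1 - n))) := by
  induction n with
  | zero => simp [birkhoffSum]
  | succ n ih =>
    have h1 : ((shift B)^[n] y).1 (R - n) = 0 := by
      rw [shift_iterate_val, show n + (R - n) = R by omega, hy]
    rw [birkhoffSum_succ, ih (by omega), h.potential_eq (by omega) h1, Function.iterate_succ_apply',
      show R - n + 1 = R + 1 - n by omega, show R + 1 - (n + 1) = R - n by omega]
    push_cast
    ring

lemma potential_congr {y z : SFT B} {R : ℕ} (hR : 1 ≤ R) (hy : y.1 R = 0)
    (hz : z ∈ cylinder y (R + 1)) : potential ν t α β z = potential ν t α β y := by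
  have hz' : z.1 R = 0 := by rw [hz R (by omega), hy]
  rw [h.potential_eq hR hy, h.potential_eq hR hz', cylinder_congr hz,
    cylinder_congr (y := shift B z) (z := shift B y) fun i hi => hz (i + 1) (by omega)]

lemma continuousAt_potential {y : SFT B} {R : ℕ} (hR : 1 ≤ R) (hy : y.1 R = 0) :
    ContinuousAt (potential ν t α β) y := by
  refine (continuousAt_const (y := potential ν t α β y)).congr ?_
  filter_upwards [cylinder_mem_nhds y (R + 1)] with z hz
  exact (h.potential_congr hR hy hz).symm

/-- The potential is continuous on the open set of points with a zero at a positive time, and on its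
complement it depends on `y_0` alone. -/
lemma measurable_potential : Measurable (potential ν t α β) := by
  classical
  set U : Set (SFT B) := {y | ∃ m, 1 ≤ m ∧ y.1 m = 0} with hU
  have hUo : IsOpen U := by
    refine isOpen_iff_mem_nhds.2 fun y ⟨m, hm1, hm⟩ => ?_
    filter_upwards [cylinder_mem_nhds y (m + 1)] with z hz
    exact ⟨m, hm1, by rw [hz m (by omega), hm]⟩
  have h1 : ContinuousOn (potential ν t α β) U := fun y ⟨m, hm1, hm⟩ =>
    (h.continuousAt_potential hm1 hm).continuousWithinAt
  have h2 : ContinuousOn (potential ν t α β) Uᶜ := by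
    have h3 : Continuous fun y : SFT B => if y.1 0 = 0 then β else α :=
      (continuous_of_discreteTopology (f := fun a : Fin 2 => if a = 0 then β else α)).comp
        ((continuous_apply 0).comp continuous_subtype_val)
    refine h3.continuousOn.congr fun y hy => potential_of_forall_ne fun m hm1 hm => hy ⟨m, hm1, hm⟩
  have := h1.measurable_piecewise h2 hUo.measurableSet
  rwa [Set.piecewise_same] at this

variable {C : ℕ → ℝ}
  (hC : ∀ n m, 1 ≤ n → 1 ≤ m → ∀ y,
    |Real.log (g (n + m) y) - Real.log (g n y) - Real.log (g m ((shift B)^[n] y))| ≤ C n)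
include hC

lemma abs_log_real_cylinder_le {n m : ℕ} (hn : 1 ≤ n) (hm : 1 ≤ m) (y : SFT B) :
    |Real.log (ν.real (cylinder y (n + m))) - Real.log (ν.real (cylinder y n)) -
      Real.log (ν.real (cylinder ((shift B)^[n] y) m))| ≤ C n + 3 * Real.log c := by
  have h1 := h.abs_log_g_sub_le (n := n + m) (by omega) y
  have h2 := h.abs_log_g_sub_le hn y
  have h3 := h.abs_log_g_sub_le hm ((shift B)^[n] y)
  have h4 := hC n m hn hm y
  push_cast at h1
  rw [abs_le] at *
  constructor <;> linarith [h1.1, h1.2, h2.1, h2.2, h3.1, h3.2, h4.1, h4.2]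

/-- The Birkhoff sums of the potential approximate the weakly almost additive sequence `g`. -/
lemma exists_abs_log_sub_birkhoffSum_le {one zone : SFT B} (hone : ∀ i, one.1 i = 1)
    (hzone : ∀ i, zone.1 i = if i = 0 then 0 else 1)
    (hα : ∀ k : ℕ, 1 ≤ k → |Real.log (g k one) - k * α| ≤ C k) :
    ∃ K : ℝ, ∀ E : ℕ → ℝ, (∀ k n, 1 ≤ k → k ≤ n → C k ≤ E n) → ∀ n, 1 ≤ n → ∀ y,
      |Real.log (g n y) - birkhoffSum (shift B) (potential ν t α β) n y| ≤ 2 * E n + K := by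
  set K := |Real.log t| + |Real.log (ν.real (cylinder zone 1))| + |β| + 4 * Real.log c with hK
  have hlc : 0 ≤ Real.log c := Real.log_nonneg h.one_le
  have hCn : ∀ n, 1 ≤ n → 0 ≤ C n := fun n hn => (abs_nonneg _).trans (hC n 1 hn le_rfl one)
  have e1 := abs_nonneg (Real.log t)
  have e2 := abs_nonneg (Real.log (ν.real (cylinder zone 1)))
  have e3 := abs_nonneg β
  have f1 := abs_le.1 (le_refl |Real.log t|)
  have f2 := abs_le.1 (le_refl |Real.log (ν.real (cylinder zone 1))|)
  have f3 := abs_le.1 (le_refl |β|)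
  have hpone : potential ν t α β one = α := by
    rw [potential_of_forall_ne fun m _ => by rw [hone]; exact one_ne_zero, hone, if_neg one_ne_zero]
  have hpzone : potential ν t α β zone = β := by
    rw [potential_of_forall_ne fun m hm => by
      rw [hzone, if_neg (by omega)]; exact one_ne_zero, hzone, if_pos rfl, if_pos rfl]
  have hsone : ∀ n, (shift B)^[n] one = one := fun n => Subtype.ext <| funext fun i => by
    rw [shift_iterate_val, hone, hone]
  have hSone : ∀ n : ℕ, birkhoffSum (shift B) (potential ν t α β) n one = n * α := fun n => by
    simp [birkhoffSum, hsone, hpone]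
  refine ⟨K, fun E hE n hn y => ?_⟩
  have hEn : 0 ≤ E n := (hCn n hn).trans (hE n n hn le_rfl)
  have hCE := hE n n hn le_rfl
  -- If a zero occurs at some `R ≥ n`, the telescoped sum is compared with `ν[y_0 ⋯ y_{n-1}]` by
  -- splitting `[y_0 ⋯ y_R]` at time `n`. Otherwise the tail is `1^∞`.
  by_cases hex : ∃ R, n ≤ R ∧ y.1 R = 0
  · obtain ⟨R, hnR, hR⟩ := hex
    rw [h.birkhoffSum_potential hR hnR]
    have h1 := h.abs_log_g_sub_le hn y
    have h2 := h.abs_log_real_cylinder_le hC hn (m := R + 1 - n) (by omega) y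
    rw [show n + (R + 1 - n) = R + 1 by omega] at h2
    rw [abs_le] at *
    constructor <;> linarith [h1.1, h1.2, h2.1, h2.2]
  · have hlast : ∀ i, n ≤ i → y.1 i = 1 := fun i hi =>
      (fin_two_eq (y.1 i)).resolve_left fun h0 => hex ⟨i, hi, h0⟩
    by_cases hs : ∃ s, s < n ∧ y.1 s = 0
    · classical
      obtain ⟨s, hsn, hs0, hsmax⟩ : ∃ s, s < n ∧ y.1 s = 0 ∧ ∀ i, s < i → y.1 i = 1 := by
        set s := Nat.findGreatest (fun i => y.1 i = 0) (n - 1) with hsdef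
        obtain ⟨s', hs'n, hs'0⟩ := hs
        have hs0 : y.1 s = 0 := Nat.findGreatest_spec (P := fun i => y.1 i = 0)
          (by omega : s' ≤ n - 1) hs'0
        have hsle : s ≤ n - 1 := Nat.findGreatest_le _
        refine ⟨s, by omega, hs0, fun i hi => ?_⟩
        rcases lt_or_ge i n with hin | hin
        · exact (fin_two_eq (y.1 i)).resolve_left
            (Nat.findGreatest_is_greatest (P := fun i => y.1 i = 0) hi (by omega))
        · exact hlast i hin
      have hsz : (shift B)^[s] y = zone := Subtype.ext <| funext fun i => by
        rw [shift_iterate_val, hzone]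
        split_ifs with hi
        · rw [hi, add_zero, hs0]
        · exact hsmax _ (by omega)
      have ho : (shift B)^[s + 1] y = one := Subtype.ext <| funext fun i => by
        rw [shift_iterate_val, hone]
        exact hsmax _ (by omega)
      -- Here `y = w 0 1^∞` with the last zero at `s`: the sum telescopes up to `s`, meets `β` once
      -- at `01^∞`, and then equals `k * α`. The single `β` goes into the constant `K`, so its value
      -- is free.
      obtain ⟨k, rfl⟩ : ∃ k, n = s + 1 + k := ⟨n - (s + 1), by omega⟩
      have hS := birkhoffSum_add (shift B) (potential ν t α β) (s + 1) k y
      rw [birkhoffSum_succ, h.birkhoffSum_potential hs0 le_rfl, hsz, hpzone, ho, hSone,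
        Nat.add_sub_cancel_left] at hS
      rw [hS]
      have h1 := h.abs_log_g_sub_le (n := s + 1) (by omega) y
      push_cast at h1
      rcases Nat.eq_zero_or_pos k with rfl | hk
      · simp only [add_zero, Nat.cast_zero, zero_mul] at hEn ⊢
        rw [abs_le] at h1 ⊢
        constructor <;> linarith [h1.1, h1.2]
      · have h2 := hC (s + 1) k (by omega) hk y
        rw [ho] at h2
        have h3 := hα k hk
        have h4 := hE (s + 1) (s + 1 + k) (by omega) (by omega)
        have h5 := hE k (s + 1 + k) hk (by omega)
        rw [abs_le] at h1 h2 h3 ⊢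
        constructor <;> linarith [h1.1, h1.2, h2.1, h2.2, h3.1, h3.2]
    · have ho : y = one := Subtype.ext <| funext fun i => by
        rw [hone]
        rcases lt_or_ge i n with hin | hin
        · exact (fin_two_eq (y.1 i)).resolve_left fun h0 => hs ⟨i, hin, h0⟩
        · exact hlast i hin
      rw [ho, hSone]
      have := hα n hn
      linarith

end IsReference

end RelPressure

/-! ### Continuity: recurrences for the block `N`. -/

namespace RelPressure
open Matrix

/-- The two-sided bound keeps the limit of the ratios away from zero, so logarithms may be taken. -/
lemma exists_tendsto_log_sub_of_recurrence {s u : ℕ → ℝ} {τ δ K : ℝ} (hs : ∀ j, 0 < s j)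
    (hu : ∀ j, 0 < u j) (hsr : ∀ j, s (j + 2) = τ * s (j + 1) - δ * s j)
    (hur : ∀ j, u (j + 2) = τ * u (j + 1) - δ * u j)
    (hK : ∀ j, |Real.log (u j) - Real.log (s j)| ≤ K) (hδ : δ < 0 → 0 < τ) :
    ∃ L, Tendsto (fun j => Real.log (u j) - Real.log (s j)) atTop (𝓝 L) := by
  have hb : ∀ j, Real.exp (-K) ≤ u j / s j ∧ u j / s j ≤ Real.exp K := fun j => by
    have h1 := abs_le.1 (hK j)
    rw [← Real.log_div (hu j).ne' (hs j).ne'] at h1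
    have h2 := div_pos (hu j) (hs j)
    exact ⟨(Real.le_log_iff_exp_le h2).1 h1.1, (Real.log_le_iff_le_exp h2).1 h1.2⟩
  obtain ⟨L, hL⟩ := exists_tendsto_div_of_recurrence hs hu hsr hur
    (fun j => (div_le_iff₀ (hs j)).1 (hb j).2) hδ
  have hL0 : L ≠ 0 :=
    ((Real.exp_pos (-K)).trans_le (ge_of_tendsto' hL fun j => (hb j).1)).ne'
  refine ⟨Real.log L, ((Real.continuousAt_log hL0).tendsto.comp hL).congr fun j => ?_⟩
  exact Real.log_div (hu j).ne' (hs j).ne'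

/-- The hypothesis on the block of the symbols over `1` under which the potential is continuous. -/
def RegularBlock (M : Matrix (Fin 3) (Fin 3) ℝ) : Prop :=
  (¬ ∃ a₁ a₂ : ℝ, 0 < a₁ ∧ 0 < a₂ ∧ M.submatrix ![1, 2] ![1, 2] = !![0, a₁; a₂, 0]) ∨
    ((∃ a₁ : ℝ, 0 < a₁ ∧ M.submatrix ![1, 2] ![1, 2] = !![0, a₁; a₁, 0]) ∧
      (M 1 0 = M 2 0 ∨ M 0 1 = M 0 2))

/-- In the first case this is Cayley–Hamilton for the block `t⁻¹ N`, with `τ` its trace and `δ` its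
determinant; since `N` is nonnegative, `δ < 0` with `τ = 0` would make it antidiagonal with positive
entries. In the second case `N` swaps the two symbols up to the factor `a`, and symmetry on the
right or on the left selects the eigenvalue `a / t`. The vectors `u` allowed are those needed for
`ν[1^m 0]` and `ν[0 1^m 0]`. -/
lemma exists_recurrence {M : Matrix (Fin 3) (Fin 3) ℝ} {t : ℝ} {l r : Fin 3 → ℝ} (ht : 0 < t)
    (hM : ∀ i j, 0 ≤ M i j) (hl : l ᵥ* M = t • l) (hreg : RegularBlock M) :
    ∃ τ δ : ℝ, (δ < 0 → 0 < τ) ∧ ∀ u : Fin 3 → ℝ, (u = l ∨ ∃ w, u = ![w, 0, 0]) → ∀ m : ℕ,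
      u ⬝ᵥ ((symbolMatrix M t 1 ^ (m + 2 + 1)) *ᵥ (symbolMatrix M t 0 *ᵥ r)) =
        τ * (u ⬝ᵥ ((symbolMatrix M t 1 ^ (m + 1 + 1)) *ᵥ (symbolMatrix M t 0 *ᵥ r))) -
        δ * (u ⬝ᵥ ((symbolMatrix M t 1 ^ (m + 1)) *ᵥ (symbolMatrix M t 0 *ᵥ r))) := by
  set Q := symbolMatrix M t 1 with hQ
  have hQe : Q = !![0, t⁻¹ * M 0 1, t⁻¹ * M 0 2; 0, t⁻¹ * M 1 1, t⁻¹ * M 1 2;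
      0, t⁻¹ * M 2 1, t⁻¹ * M 2 2] := by
    ext i j
    fin_cases i <;> fin_cases j <;> simp [hQ, symbolMatrix, code]
  have hQ0 : ∀ i, Q i 0 = 0 := fun i => by rw [hQe]; fin_cases i <;> rfl
  have hQ1 : ∀ i, Q i 1 = t⁻¹ * M i 1 := fun i => by rw [hQe]; fin_cases i <;> rfl
  have hQ2 : ∀ i, Q i 2 = t⁻¹ * M i 2 := fun i => by rw [hQe]; fin_cases i <;> rfl
  have hmul : ∀ (x : Fin 3 → ℝ) i, (Q *ᵥ x) i = t⁻¹ * (M i 1 * x 1 + M i 2 * x 2) := fun x i => by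
    rw [mulVec_apply_eq_sum, Fin.sum_univ_three, hQ0, hQ1, hQ2]; ring
  have hvec : ∀ (v : Fin 3 → ℝ) j, (v ᵥ* Q) j = v 0 * Q 0 j + v 1 * Q 1 j + v 2 * Q 2 j :=
    fun v j => (show (v ᵥ* Q) j = ∑ i, v i * Q i j from rfl).trans (Fin.sum_univ_three _)
  rcases hreg with hreg | ⟨⟨a, ha, hN⟩, hsym⟩
  · refine ⟨t⁻¹ * (M 1 1 + M 2 2), t⁻¹ ^ 2 * (M 1 1 * M 2 2 - M 1 2 * M 2 1), fun hδ => ?_,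
      fun u _ m => ?_⟩
    · have h1 : M 1 1 * M 2 2 < M 1 2 * M 2 1 := by
        by_contra hle
        exact absurd hδ (not_lt.2 (mul_nonneg (by positivity) (by linarith)))
      have h2 : 0 < M 1 2 * M 2 1 := (mul_nonneg (hM 1 1) (hM 2 2)).trans_lt h1
      refine mul_pos (inv_pos.2 ht) ((add_nonneg (hM 1 1) (hM 2 2)).lt_of_ne' fun h0 => hreg ?_)
      have h3 : M 1 1 = 0 := by linarith [hM 1 1, hM 2 2]
      have h4 : M 2 2 = 0 := by linarith [hM 1 1, hM 2 2]
      refine ⟨M 1 2, M 2 1, (hM 1 2).lt_of_ne' fun h => ?_, (hM 2 1).lt_of_ne' fun h => ?_, ?_⟩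
      · rw [h, zero_mul] at h2; exact lt_irrefl _ h2
      · rw [h, mul_zero] at h2; exact lt_irrefl _ h2
      · ext i j
        fin_cases i <;> fin_cases j <;> simp [h3, h4]
    · have h3 : Q ^ 3 = (t⁻¹ * (M 1 1 + M 2 2)) • Q ^ 2 -
          (t⁻¹ ^ 2 * (M 1 1 * M 2 2 - M 1 2 * M 2 1)) • Q := by
        rw [pow_succ, pow_two, hQe]
        ext i j
        fin_cases i <;> fin_cases j <;>
          simp [Matrix.mul_apply, Fin.sum_univ_three] <;> ring
      have h4 : Q ^ (m + 2 + 1) = (t⁻¹ * (M 1 1 + M 2 2)) • Q ^ (m + 1 + 1) -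
          (t⁻¹ ^ 2 * (M 1 1 * M 2 2 - M 1 2 * M 2 1)) • Q ^ (m + 1) := by
        rw [show m + 2 + 1 = m + 3 by ring, pow_add, h3, Matrix.mul_sub, Matrix.mul_smul,
          Matrix.mul_smul, ← pow_add, ← pow_succ]
      rw [h4, sub_mulVec, smul_mulVec, smul_mulVec, dotProduct_sub, dotProduct_smul, dotProduct_smul,
        smul_eq_mul, smul_eq_mul]
  · have e11 : M 1 1 = 0 := by simpa using congrFun (congrFun hN 0) 0
    have e12 : M 1 2 = a := by simpa using congrFun (congrFun hN 0) 1
    have e21 : M 2 1 = a := by simpa using congrFun (congrFun hN 1) 0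
    have e22 : M 2 2 = 0 := by simpa using congrFun (congrFun hN 1) 1
    refine ⟨t⁻¹ * a, 0, fun h => absurd h (lt_irrefl 0), fun u hu m => ?_⟩
    rw [zero_mul, sub_zero]
    rcases hsym with hsym | hsym
    · have hx : ∀ x : Fin 3 → ℝ, x 1 = x 2 → Q *ᵥ (Q *ᵥ x) = (t⁻¹ * a) • (Q *ᵥ x) := by
        intro x hx
        ext i
        rw [Pi.smul_apply, smul_eq_mul, hmul, hmul x 1, hmul x 2, hmul x i, e11, e12, e21, e22, hx]
        ring
      have h1 := hx (symbolMatrix M t 0 *ᵥ r) (by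
        simp [mulVec_apply_eq_sum, Fin.sum_univ_three, symbolMatrix, code, hsym])
      rw [show m + 2 + 1 = (m + 1) + 1 + 1 by ring, pow_succ, pow_succ, ← mulVec_mulVec,
        ← mulVec_mulVec, h1, mulVec_smul, dotProduct_smul, smul_eq_mul, ← mulVec_mulVec]
    · have hv : ∀ v : Fin 3 → ℝ, v 0 = 0 → v 1 = v 2 → v ᵥ* Q = (t⁻¹ * a) • v := by
        intro v h0 h12
        ext j
        rw [Pi.smul_apply, smul_eq_mul, hvec]
        fin_cases j
        · simp [hQ0, h0]
        · simp [hQ1, h0, e11, e21, h12]; ring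
        · simp [hQ2, h0, e12, e22, h12]; ring
      have hl1 : ∀ j, l 0 * M 0 j + l 1 * M 1 j + l 2 * M 2 j = t * l j := fun j => by
        have := congrFun hl j
        simpa [vecMul, dotProduct, Fin.sum_univ_three] using this
      -- Subtracting two coordinates of `l M = t l` gives `(t + a) (l 1 - l 2) = 0`, and `t + a >
      -- 0`.
      have hl12 : l 1 = l 2 := by
        have h1 := hl1 1
        have h2 := hl1 2
        rw [e11, e21, hsym] at h1
        rw [e12, e22] at h2
        have : (t + a) * (l 1 - l 2) = 0 := by linarith
        rcases mul_eq_zero.1 this with h | h <;> linarith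
      have huQ : (u ᵥ* Q) ᵥ* Q = (t⁻¹ * a) • (u ᵥ* Q) := by
        refine hv _ (by simp [hvec, hQ0]) ?_
        rcases hu with rfl | ⟨w, rfl⟩
        · rw [hvec, hvec, hQ1, hQ1, hQ1, hQ2, hQ2, hQ2, e11, e12, e21, e22, hsym, hl12]; ring
        · rw [hvec, hvec, hQ1, hQ1, hQ1, hQ2, hQ2, hQ2, hsym]; simp
      have hpull : ∀ (v x : Fin 3 → ℝ) (k : ℕ),
          v ⬝ᵥ ((Q ^ (k + 1)) *ᵥ x) = (v ᵥ* Q) ⬝ᵥ ((Q ^ k) *ᵥ x) := fun v x k => by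
        rw [pow_succ', ← mulVec_mulVec, dotProduct_mulVec]
      rw [hpull u _ (m + 2), hpull _ _ (m + 1), huQ, hpull u _ (m + 1), smul_dotProduct, smul_eq_mul]

end RelPressure

namespace RelPressure
open Matrix

variable {B : Matrix (Fin 2) (Fin 2) ℕ} {ν : Measure (SFT B)} {g : ℕ → SFT B → ℝ} {t c : ℝ}

/-- The point `1^m 0 1^∞`. -/
def zeroAt (hB : B = !![1, 1; 1, 1] ∨ B = !![0, 1; 1, 1]) (m : ℕ) : SFT B :=
  ⟨fun i => if i = m then 0 else 1, mem_SFT_of_sparse hB fun n => by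
    by_cases h : n = m
    · right; exact if_neg (by omega)
    · left; exact if_neg h⟩

/-- The point `0 1^{m+1} 0 1^∞`. -/
def zeroZeroAt (hB : B = !![1, 1; 1, 1] ∨ B = !![0, 1; 1, 1]) (m : ℕ) : SFT B :=
  ⟨fun i => if i = 0 ∨ i = m + 2 then 0 else 1, mem_SFT_of_sparse hB fun n => by
    by_cases h : n = 0 ∨ n = m + 2
    · right; exact if_neg (by omega)
    · left; exact if_neg h⟩

/-- The point `1^∞`. -/
def onePoint (hB : B = !![1, 1; 1, 1] ∨ B = !![0, 1; 1, 1]) : SFT B :=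
  ⟨fun _ => 1, mem_SFT_of_sparse hB fun _ => Or.inl rfl⟩

namespace IsReference

variable (h : IsReference g ν t c) {α β : ℝ}
include h

/-- The potential depends only on the letters up to the first positive zero. Near `1^∞` or `01^∞`
that zero is far away, so the value is the one at `1^m 0 1^∞` or `0 1^{m+1} 0 1^∞` with `m` large.
-/
lemma continuous_potential (hB : B = !![1, 1; 1, 1] ∨ B = !![0, 1; 1, 1])
    (hα : Tendsto (fun m => potential ν t α β (zeroAt hB m)) atTop (𝓝 α))
    (hβ : Tendsto (fun m => potential ν t α β (zeroZeroAt hB m)) atTop (𝓝 β)) :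
    Continuous (potential ν t α β) := by
  classical
  refine continuous_iff_continuousAt.2 fun y => ?_
  by_cases hy : ∃ m, 1 ≤ m ∧ y.1 m = 0
  · obtain ⟨m, hm1, hm⟩ := hy
    exact h.continuousAt_potential hm1 hm
  · have hy' : ∀ m, 1 ≤ m → y.1 m ≠ 0 := fun m h1 h2 => hy ⟨m, h1, h2⟩
    have hval := potential_of_forall_ne (ν := ν) (t := t) (α := α) (β := β) hy'
    refine Metric.continuousAt_iff'.2 fun ε hε => ?_
    obtain ⟨N₁, hN₁⟩ := Metric.tendsto_atTop.1 hα ε hε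
    obtain ⟨N₂, hN₂⟩ := Metric.tendsto_atTop.1 hβ ε hε
    filter_upwards [cylinder_mem_nhds y (N₁ + N₂ + 3)] with z hz
    by_cases hzz : ∃ m, 1 ≤ m ∧ z.1 m = 0
    · obtain ⟨hm1, hm⟩ := Nat.find_spec hzz
      have hmin : ∀ i, 1 ≤ i → i < Nat.find hzz → z.1 i = 1 := fun i hi hlt =>
        (fin_two_eq (z.1 i)).resolve_left fun h0 => Nat.find_min hzz hlt ⟨hi, h0⟩
      generalize Nat.find hzz = m at hm1 hm hmin
      have hmN : N₁ + N₂ + 3 ≤ m := by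
        by_contra hlt
        exact hy' m hm1 (by rw [← hz m (by omega), hm])
      have hz0 : z.1 0 = y.1 0 := hz 0 (by omega)
      rw [hval]
      rcases fin_two_eq (y.1 0) with h0 | h0
      · rw [if_pos h0]
        have hp : potential ν t α β (zeroZeroAt hB (m - 2)) = potential ν t α β z := by
          refine h.potential_congr hm1 hm fun i hi => ?_
          change (if i = 0 ∨ i = m - 2 + 2 then (0 : Fin 2) else 1) = z.1 i
          rcases Nat.eq_zero_or_pos i with rfl | hi0
          · rw [if_pos (Or.inl rfl), hz0, h0]
          · rcases eq_or_ne i m with rfl | him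
            · rw [if_pos (by omega), hm]
            · rw [if_neg (by omega), hmin i hi0 (by omega)]
        rw [← hp]
        exact hN₂ _ (by omega)
      · rw [if_neg (by rw [h0]; exact one_ne_zero)]
        have hp : potential ν t α β (zeroAt hB m) = potential ν t α β z := by
          refine h.potential_congr hm1 hm fun i hi => ?_
          change (if i = m then (0 : Fin 2) else 1) = z.1 i
          rcases Nat.eq_zero_or_pos i with rfl | hi0
          · rw [if_neg (by omega), hz0, h0]
          · rcases eq_or_ne i m with rfl | him
            · rw [if_pos rfl, hm]
            · rw [if_neg him, hmin i hi0 (by omega)]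
        rw [← hp]
        exact hN₁ _ (by omega)
    · rw [potential_of_forall_ne fun m h1 h2 => hzz ⟨m, h1, h2⟩, hval, hz 0 (by omega), dist_self]
      exact hε

/-- The values along the two families are `log t` plus logarithms of ratios of `ν[1^m 0]` and `ν[0
1^{m+1} 0]`. Both sequences obey one recurrence, and the bound `hC` at `n = 1` bounds the ratios, so
both limits exist. The first must equal the prescribed `α`; the second is taken as `β`. -/
lemma exists_continuous_potential (hB : B = !![1, 1; 1, 1] ∨ B = !![0, 1; 1, 1])
    {M : Matrix (Fin 3) (Fin 3) ℝ} {l r : Fin 3 → ℝ} (hM : ∀ i j, 0 ≤ M i j)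
    (hl : l ᵥ* M = t • l) (hP : IsRenewalData (symbolMatrix M t) l r)
    (hν : ∀ n (y : SFT B), ν.real (cylinder y n) =
      l ⬝ᵥ (wordMatrix (symbolMatrix M t) n y.1 *ᵥ r)) (hreg : RegularBlock M) {C : ℕ → ℝ}
    (hC : ∀ n m, 1 ≤ n → 1 ≤ m → ∀ y,
      |Real.log (g (n + m) y) - Real.log (g n y) - Real.log (g m ((shift B)^[n] y))| ≤ C n)
    (hC0 : Tendsto (fun n : ℕ => C n / n) atTop (𝓝 0))
    (hα : ∀ k : ℕ, 1 ≤ k → |Real.log (g k (onePoint hB)) - k * α| ≤ C k) :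
    ∃ β, Continuous (potential ν t α β) := by
  obtain ⟨τ, δ, hδ, hrec⟩ := exists_recurrence (r := r) h.pos_t hM hl hreg
  set X := symbolMatrix M t 0 *ᵥ r with hX
  set s : ℕ → ℝ := fun m => ν.real (cylinder (zeroAt hB m) (m + 1)) with hs
  set u : ℕ → ℝ := fun m => ν.real (cylinder (zeroZeroAt hB m) (m + 3)) with hu
  have hword : ∀ m, wordMatrix (symbolMatrix M t) (m + 1) (zeroAt hB m).1 =
      symbolMatrix M t 1 ^ m * symbolMatrix M t 0 := by
    intro m
    rw [wordMatrix, ← wordMatrix_const]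
    congr 1
    · exact wordMatrix_congr m fun i hi => if_neg (by omega)
    · exact congrArg _ (if_pos rfl)
  have hs' : ∀ m, s m = l ⬝ᵥ ((symbolMatrix M t 1 ^ m) *ᵥ X) := fun m => by
    change ν.real (cylinder (zeroAt hB m) (m + 1)) = _
    rw [hν, hword, ← mulVec_mulVec]
  have hu' : ∀ m, u m = (l ᵥ* symbolMatrix M t 0) ⬝ᵥ ((symbolMatrix M t 1 ^ (m + 1)) *ᵥ X) := by
    intro m
    have h1 : fullShift (zeroZeroAt hB m).1 = (zeroAt hB (m + 1)).1 := funext fun i => by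
      change (if i + 1 = 0 ∨ i + 1 = m + 2 then (0 : Fin 2) else 1) = if i = m + 1 then 0 else 1
      congr 1
      simp
    have h2 : (zeroZeroAt hB m).1 0 = 0 := rfl
    change ν.real (cylinder (zeroZeroAt hB m) (m + 3)) = _
    rw [hν, wordMatrix_succ', h1, h2, hword, ← mulVec_mulVec, ← mulVec_mulVec, dotProduct_mulVec]
  have hl0 : ∃ w, l ᵥ* symbolMatrix M t 0 = ![w, 0, 0] := by
    have hz : ∀ j, j ≠ 0 → (l ᵥ* symbolMatrix M t 0) j = 0 := fun j hj =>
      (show (l ᵥ* symbolMatrix M t 0) j = ∑ i, l i * symbolMatrix M t 0 i j from rfl).trans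
        (Finset.sum_eq_zero fun i _ => by rw [hP.zero_col i j hj, mul_zero])
    refine ⟨(l ᵥ* symbolMatrix M t 0) 0, funext fun j => ?_⟩
    fin_cases j
    · rfl
    · exact hz 1 (by decide)
    · exact hz 2 (by decide)
  have hspos : ∀ m, 0 < s m := fun m => h.pos _ _
  have hupos : ∀ m, 0 < u m := fun m => h.pos _ _
  -- The recurrence holds for positive powers of the symbol matrix, so `s` is used from index 1.
  have hsr : ∀ j, s (j + 2 + 1) = τ * s (j + 1 + 1) - δ * s (j + 1) := fun j => by
    simp only [hs']; exact hrec l (Or.inl rfl) j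
  have hur : ∀ j, u (j + 2) = τ * u (j + 1) - δ * u j := fun j => by
    simp only [hu']; exact hrec _ (Or.inr hl0) j
  have hshift1 : ∀ m, shift B (zeroAt hB (m + 1)) = zeroAt hB m := fun m =>
    Subtype.ext <| funext fun i => by
      change (if i + 1 = m + 1 then (0 : Fin 2) else 1) = if i = m then 0 else 1
      simp
  have hshift2 : ∀ m, shift B (zeroZeroAt hB m) = zeroAt hB (m + 1) := fun m =>
    Subtype.ext <| funext fun i => by
      change (if i + 1 = 0 ∨ i + 1 = m + 2 then (0 : Fin 2) else 1) = if i = m + 1 then 0 else 1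
      congr 1
      simp
  have hbs : ∀ j, |Real.log (s (j + 1 + 1)) - Real.log (s (j + 1))| ≤
      C 1 + 3 * Real.log c + |Real.log (ν.real (cylinder (onePoint hB) 1))| := fun j => by
    have h1 := h.abs_log_real_cylinder_le hC (n := 1) (m := j + 1 + 1) le_rfl (by omega)
      (zeroAt hB (j + 1 + 1))
    rw [Function.iterate_one, hshift1, add_comm 1 (j + 1 + 1),
      cylinder_congr (n := 1) (z := onePoint hB) fun i hi => if_neg (by omega)] at h1
    have h2 := abs_le.1 (le_refl |Real.log (ν.real (cylinder (onePoint hB) 1))|)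
    rw [abs_le] at *
    constructor <;> linarith [h1.1, h1.2, h2.1, h2.2]
  have hbu : ∀ j, |Real.log (u j) - Real.log (s (j + 1))| ≤
      C 1 + 3 * Real.log c + |Real.log (ν.real (cylinder (zeroAt hB 0) 1))| := fun j => by
    have h1 := h.abs_log_real_cylinder_le hC (n := 1) (m := j + 1 + 1) le_rfl (by omega)
      (zeroZeroAt hB j)
    rw [Function.iterate_one, hshift2, add_comm 1 (j + 1 + 1),
      cylinder_congr (n := 1) (z := zeroAt hB 0) fun i hi => by
        obtain rfl : i = 0 := by omega
        rfl] at h1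
    have h2 := abs_le.1 (le_refl |Real.log (ν.real (cylinder (zeroAt hB 0) 1))|)
    rw [abs_le] at *
    constructor <;> linarith [h1.1, h1.2, h2.1, h2.2]
  obtain ⟨L, hL⟩ := exists_tendsto_log_sub_of_recurrence (s := fun j => s (j + 1))
    (u := fun j => s (j + 1 + 1)) (fun j => hspos _) (fun j => hspos _) hsr
    (fun j => hsr (j + 1)) hbs hδ
  obtain ⟨L', hL'⟩ := exists_tendsto_log_sub_of_recurrence (s := fun j => s (j + 1))
    (u := u) (fun j => hspos _) hupos hsr hur hbu hδ
  have hpot : ∀ β m, potential ν t α β (zeroAt hB (m + 1)) =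
      Real.log t + (Real.log (s (m + 1)) - Real.log (s m)) := fun β m => by
    rw [h.potential_eq (R := m + 1) (by omega) (if_pos rfl), hshift1]; ring
  have hpotlim : ∀ β, Tendsto (fun m => potential ν t α β (zeroAt hB m)) atTop
      (𝓝 (Real.log t + L)) := fun β => by
    rw [← tendsto_add_atTop_iff_nat 2]
    exact (hL.const_add (Real.log t)).congr fun m => (hpot β (m + 1)).symm
  -- the value at `1^∞` is the limit of the values at `1^m 0 1^∞`
  have hαL : Real.log t + L = α := by
    have hinc : Tendsto (fun m => Real.log t + (Real.log (s (m + 1)) - Real.log (s m))) atTop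
        (𝓝 (Real.log t + L)) := by
      rw [← tendsto_add_atTop_iff_nat 1]
      exact hL.const_add (Real.log t)
    have hces := hinc.cesaro
    have hsum : ∀ n : ℕ, ∑ m ∈ Finset.range n,
        (Real.log t + (Real.log (s (m + 1)) - Real.log (s m))) =
          n * Real.log t + (Real.log (s n) - Real.log (s 0)) := fun n => by
      rw [Finset.sum_add_distrib, Finset.sum_range_sub (fun m => Real.log (s m)), Finset.sum_const,
        Finset.card_range, nsmul_eq_mul]
    simp only [hsum] at hces
    set K := |Real.log (ν.real (cylinder (zeroAt hB 0) 1))| + |Real.log (s 0)| + 4 * Real.log c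
      with hK
    have hdiff : ∀ n : ℕ, 1 ≤ n → |(n : ℝ)⁻¹ * (n * Real.log t + (Real.log (s n) - Real.log (s 0)))
        - α| ≤ 2 * (C n / n) + K / n := by
      intro n hn
      have hn0 : (0 : ℝ) < n := by exact_mod_cast hn
      have h1 := h.abs_log_real_cylinder_le hC (n := n) (m := 1) hn le_rfl (zeroAt hB n)
      have h2 := h.abs_log_g_sub_le hn (onePoint hB)
      have h3 := hα n hn
      have h4 := abs_le.1 (le_refl |Real.log (ν.real (cylinder (zeroAt hB 0) 1))|)
      have h5 := abs_le.1 (le_refl |Real.log (s 0)|)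
      rw [cylinder_congr (y := zeroAt hB n) (n := n) (z := onePoint hB)
        fun i hi => if_neg (by omega), cylinder_congr (y := (shift B)^[n] (zeroAt hB n)) (n := 1)
        (z := zeroAt hB 0) fun i hi => by
          obtain rfl : i = 0 := by omega
          rw [shift_iterate_val]; exact if_pos rfl] at h1
      have h6 : (n : ℝ)⁻¹ * (n * Real.log t + (Real.log (s n) - Real.log (s 0))) - α =
          (n * Real.log t + (Real.log (s n) - Real.log (s 0)) - n * α) / n := by field_simp
      have h7 : 2 * (C n / n) + K / n = (2 * C n + K) / n := by ring
      rw [h6, h7, abs_div, abs_of_pos hn0]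
      refine div_le_div_of_nonneg_right ?_ hn0.le
      change |Real.log (s n) - _ - _| ≤ _ at h1
      rw [abs_le] at *
      constructor <;> linarith [h1.1, h1.2, h2.1, h2.2, h3.1, h3.2, h4.1, h4.2, h5.1, h5.2]
    have hz : Tendsto (fun n : ℕ => 2 * (C n / n) + K / n) atTop (𝓝 0) := by
      simpa using (hC0.const_mul 2).add (tendsto_const_div_atTop_nhds_zero_nat K)
    have habs := (hces.sub_const α).abs
    have := le_of_tendsto_of_tendsto habs hz (eventually_atTop.2 ⟨1, hdiff⟩)
    exact sub_eq_zero.1 (abs_eq_zero.1 (le_antisymm this (abs_nonneg _)))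
  refine ⟨Real.log t + L', h.continuous_potential hB ?_ ?_⟩
  · have := hpotlim (Real.log t + L')
    rwa [hαL] at this
  · refine (hL'.const_add (Real.log t)).congr fun m => ?_
    rw [h.potential_eq (R := m + 2) (by omega) (if_pos (Or.inr rfl)), hshift2]
    ring

end IsReference

/-! ### From potentials to the two statements. -/

lemma almostAdditive_iff (h : IsReference g ν t c) : AlmostAdditive g ↔
    ∃ C : ℝ, ∀ n m, 1 ≤ n → 1 ≤ m → ∀ y,
      |Real.log (g (n + m) y) - Real.log (g n y) - Real.log (g m ((shift B)^[n] y))| ≤ C := by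
  constructor
  · rintro ⟨C, -, hC⟩
    exact ⟨C, fun n m hn hm y => (abs_log_sub_sub_le_iff (h.g_pos (by omega) _) (h.g_pos hn _)
      (h.g_pos hm _)).2 (hC n m hn hm y)⟩
  · rintro ⟨C, hC⟩
    exact ⟨|C| + 1, by positivity, fun n m hn hm y => (abs_log_sub_sub_le_iff
      (h.g_pos (by omega) _) (h.g_pos hn _) (h.g_pos hm _)).1
      ((hC n m hn hm y).trans (by linarith [le_abs_self C]))⟩

lemma WeaklyAlmostAdditive.exists_abs_le (h : IsReference g ν t c) (hg : WeaklyAlmostAdditive g) :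
    ∃ C : ℕ → ℝ, (∀ n, 0 ≤ C n) ∧ Tendsto (fun n : ℕ => C n / n) atTop (𝓝 0) ∧
      ∀ n m, 1 ≤ n → 1 ≤ m → ∀ y,
        |Real.log (g (n + m) y) - Real.log (g n y) - Real.log (g m ((shift B)^[n] y))| ≤ C n := by
  obtain ⟨C, -, hlim, hC⟩ := hg
  refine ⟨fun n => |C n|, fun n => abs_nonneg _, ?_, fun n m hn hm y => ?_⟩
  · have := hlim.abs
    simpa only [abs_div, Nat.abs_cast, abs_zero] using this
  · exact ((abs_log_sub_sub_le_iff (h.g_pos (by omega) _) (h.g_pos hn _) (h.g_pos hm _)).2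
      (hC n m hn hm y)).trans (le_abs_self _)

/-- A class `p` of functions that contains a potential for every weakly almost additive sequence gives
both statements of the theorem. -/
lemma thermodynamic_of_exists_potential (h : IsReference g ν t c)
    (hB : B = !![1, 1; 1, 1] ∨ B = !![0, 1; 1, 1]) (p : (SFT B → ℝ) → Prop)
    (hp : ∀ C : ℕ → ℝ, (∀ n m, 1 ≤ n → 1 ≤ m → ∀ y,
        |Real.log (g (n + m) y) - Real.log (g n y) - Real.log (g m ((shift B)^[n] y))| ≤ C n) →
      Tendsto (fun n : ℕ => C n / n) atTop (𝓝 0) → ∀ α : ℝ,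
      (∀ k : ℕ, 1 ≤ k → |Real.log (g k (onePoint hB)) - k * α| ≤ C k) →
      ∃ β, p (potential ν t α β)) :
    (AlmostAdditive g ↔ ∃ g' : SFT B → ℝ, p g' ∧ Approximates g g' ∧
      ∃! ν : Measure (SFT B), IsInvariant ν ∧ IsGibbs ν g') ∧
    (WeaklyAlmostAdditive g → ∃ g' : SFT B → ℝ, p g' ∧ Approximates g g' ∧
      ∃! ν : Measure (SFT B), IsInvariant ν ∧ IsWeakGibbs ν g') := by
  have hsone : ∀ n, (shift B)^[n] (onePoint hB) = onePoint hB := fun n =>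
    Subtype.ext <| funext fun i => shift_iterate_val n _ i
  have key : ∀ C : ℕ → ℝ, (∀ n m, 1 ≤ n → 1 ≤ m → ∀ y,
        |Real.log (g (n + m) y) - Real.log (g n y) - Real.log (g m ((shift B)^[n] y))| ≤ C n) →
      Tendsto (fun n : ℕ => C n / n) atTop (𝓝 0) → ∃ g', p g' ∧ ∃ K : ℝ, ∀ E : ℕ → ℝ,
      (∀ k n, 1 ≤ k → k ≤ n → C k ≤ E n) → ∀ n, 1 ≤ n → ∀ y,
      |Real.log (g n y) - birkhoffSum (shift B) g' n y| ≤ 2 * E n + K := by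
    intro C hC hlim
    -- At the fixed point `1^∞` the sequence `log g_n` is itself approximately additive in `n`,
    -- which determines the growth rate `α`.
    obtain ⟨α, hα⟩ := exists_forall_abs_sub_le (a := fun n => Real.log (g n (onePoint hB))) (C := C)
      fun n m hn hm => by simpa only [hsone] using hC n m hn hm (onePoint hB)
    obtain ⟨β, hβ⟩ := hp C hC hlim α hα
    exact ⟨_, hβ, h.exists_abs_log_sub_birkhoffSum_le hC (fun _ => rfl)
      (zone := zeroAt hB 0) (fun _ => rfl) hα⟩
  refine ⟨⟨fun hg => ?_, ?_⟩, fun hg => ?_⟩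
  · obtain ⟨C, hC⟩ := (almostAdditive_iff h).1 hg
    obtain ⟨g', hg', K, hK⟩ := key (fun _ => C) hC (tendsto_const_div_atTop_nhds_zero_nat C)
    exact ⟨g', hg', h.existsUnique_isGibbs (hK (fun _ => C) fun _ _ _ _ => le_rfl)⟩
  · rintro ⟨g', -, ha, ν', hν', -⟩
    exact h.almostAdditive_of_isGibbs ha hν'.1 hν'.2
  · obtain ⟨C, hC0, hlim, hC⟩ := hg.exists_abs_le h
    obtain ⟨E, hE, hElim⟩ := exists_majorant hC0 hlim
    obtain ⟨g', hg', K, hK⟩ := key C hC hlim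
    refine ⟨g', hg', h.existsUnique_isWeakGibbs (E := fun n => 2 * E n + K) ?_
      (hK E fun k n _ hkn => hE k n hkn)⟩
    have := (hElim.const_mul 2).add (tendsto_const_div_atTop_nhds_zero_nat K)
    simp only [mul_zero, add_zero] at this
    exact this.congr fun n => by ring

end RelPressure

theorem corollary4p11
    (A : Matrix (Fin 3) (Fin 3) ℕ) (hA : ∀ i j, A i j = 0 ∨ A i j = 1)
    (hirr : RelPressure.IsIrreducible (RelPressure.SFT A))
    (B : Matrix (Fin 2) (Fin 2) ℕ) (hB : B = !![1, 1; 1, 1] ∨ B = !![0, 1; 1, 1])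
    (π : RelPressure.SFT A → RelPressure.SFT B)
    (hπ : RelPressure.IsFactorMap π) (hcode : RelPressure.IsOneBlockCode π RelPressure.code)
    (f : RelPressure.SFT A → ℝ) (φ : Fin 3 → Fin 3 → ℝ)
    (hf : ∀ x : RelPressure.SFT A, f x = φ (x.1 0) (x.1 1))
    (g : ℕ → RelPressure.SFT B → ℝ) (hg : g = RelPressure.relSeq RelPressure.code f) :
    ((RelPressure.AlmostAdditive g ↔
        ∃ g' : RelPressure.SFT B → ℝ, Measurable g' ∧ RelPressure.Approximates g g' ∧
          ∃! ν : MeasureTheory.Measure (RelPressure.SFT B),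
            RelPressure.IsInvariant ν ∧ RelPressure.IsGibbs ν g') ∧
      (RelPressure.WeaklyAlmostAdditive g →
        ∃ g' : RelPressure.SFT B → ℝ, Measurable g' ∧ RelPressure.Approximates g g' ∧
          ∃! ν : MeasureTheory.Measure (RelPressure.SFT B),
            RelPressure.IsInvariant ν ∧ RelPressure.IsWeakGibbs ν g')) ∧
    (((¬ ∃ a₁ a₂ : ℝ, 0 < a₁ ∧ 0 < a₂ ∧ RelPressure.block22 A φ = !![0, a₁; a₂, 0]) ∨
        ((∃ a₁ : ℝ, 0 < a₁ ∧ RelPressure.block22 A φ = !![0, a₁; a₁, 0]) ∧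
          (RelPressure.weightMatrix A φ 1 0 = RelPressure.weightMatrix A φ 2 0 ∨
            RelPressure.weightMatrix A φ 0 1 = RelPressure.weightMatrix A φ 0 2))) →
      (RelPressure.AlmostAdditive g ↔
        ∃ g' : RelPressure.SFT B → ℝ, Continuous g' ∧ RelPressure.Approximates g g' ∧
          ∃! ν : MeasureTheory.Measure (RelPressure.SFT B),
            RelPressure.IsInvariant ν ∧ RelPressure.IsGibbs ν g') ∧
      (RelPressure.WeaklyAlmostAdditive g →
        ∃ g' : RelPressure.SFT B → ℝ, Continuous g' ∧ RelPressure.Approximates g g' ∧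
          ∃! ν : MeasureTheory.Measure (RelPressure.SFT B),
            RelPressure.IsInvariant ν ∧ RelPressure.IsWeakGibbs ν g')) := by
  subst hg
  obtain ⟨ν, t, c, l, r, h, hl, hP, hν⟩ :=
    RelPressure.exists_isReference hirr hB hπ.surjective hcode hf
  exact ⟨RelPressure.thermodynamic_of_exists_potential h hB Measurable
      -- Measurability holds for every value at `01^∞`; `0` is an arbitrary choice.
      fun C _ _ α _ => ⟨0, h.measurable_potential⟩,
    fun hreg => RelPressure.thermodynamic_of_exists_potential h hB Continuous
      fun C hC hlim α hα => h.exists_continuous_potential hB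
        (fun _ _ => RelPressure.weightMatrix_nonneg _ _) hl hP hν hreg hC hlim hα⟩
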